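/- **Setting.** Let $n\ge 1$, $d\ge 0$, and let $r=(m,V)$ with $m\in\mathbb R^d$, $V\in\mathbb R^{d\times d}$ be identified with a vector of $\mathbb R^{d+d^2}$ (Euclidean norm). For $i=1,\dots,n$ let $f\mapsto p(y_i\mid f)$ be a twice differentiable likelihood function on $\mathbb R$, and let $q(f_i\mid r)=\mathcal N(a_{i,1}^\top m+b_{i,1},\,a_{i,2}^\top V a_{i,2}+b_{i,2})$ with fixed vectors $a_{i,1},a_{i,2}$ and scalars $b_{i,1}\in\mathbb R$, $b_{i,2}\ge 0$. Put $g_i(r,\epsilon)=\sqrt{a_{i,2}^\top Va_{i,2}+b_{i,2}}\,\epsilon+a_{i,1}^\top m+b_{i,1}$, $\phi_i(r,\epsilon)=p(y_i\mid g_i(r,\epsilon))$, and let $\phi_i',\phi_i''$ be the first and second derivatives of $p(y_i\mid f)$ in $f$ evaluated at $f=g_i(r,\epsilon)$. Write $\mathbb E\phi_i(r)=\mathbb E_{\epsilon\sim\mathcal N(0,1)}\phi_i(r,\epsilon)=\mathbb E_{q(f_i|r)}p(y_i|f_i)$, and similarly $\mathbb E\phi_i'(r)$, $\mathbb E\phi_i''(r)$.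 With a Gaussian prior $\mathcal N(m_0,S_0)$, $S_0$ positive definite, and $\beta\ge 0$, the objective is $$h(r)=-\frac1n\sum_{i=1}^n\log\mathbb E\phi_i(r)+\frac{\beta}{n}\,d_{KL}\big(\mathcal N(m,V)\,\|\,\mathcal N(m_0,S_0)\big).$$ Assume there are finite constants with $0\le\phi_i\le B$, $b'\le\phi_i'\le B'$, $b''\le\phi_i''\le B''$ for all $i,r,\epsilon$. **Algorithm (smooth-bMC).** Let $\gamma_t>0$ with $\sum_t\gamma_t=\infty$, $\sum_t\gamma_t^2<\infty$, let $\zeta>0$, and let $\nu_t=\gamma_t\zeta$. Start from an $\mathcal F_0$-measurable, square-integrable $r_0$ (e.g. a constant), where $(\mathcal F_t)$ is the history filtration. At step $t$ choose an $\mathcal F_t$-measurable sample size $L=L_t\ge1$; for every $i$ draw i.i.d. $\epsilon^{(\ell)}=\epsilon^{(\ell)}_{t,i}\sim\mathcal N(0,1)$, independent of $\mathcal F_t$ and known at time $t+1$ (draws for different $i$ may be shared, independent or otherwise dependent), and set $r_{t+1}=r_t+\gamma_t d_t$ with $$d_t=\frac1n\sum_i(d_{i,m},d_{i,V})-\nabla\Big(\frac\beta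 n d_{KL}\Big)(r_t),$$ $$d_{i,m}=\frac{\frac1L\sum_\ell\phi_i'(r_t,\epsilon^{(\ell)})}{\frac1L\sum_\ell\phi_i(r_t,\epsilon^{(\ell)})+\nu_t}\,a_{i,1},\qquad d_{i,V}=\frac{\frac1L\sum_\ell\phi_i''(r_t,\epsilon^{(\ell)})}{\frac1L\sum_\ell\phi_i(r_t,\epsilon^{(\ell)})+\nu_t}\,\frac{a_{i,2}a_{i,2}^\top}{2}.$$ **Corollary.** Suppose that, almost surely, for all $t$ and $i$: $\mathbb E_{q(f_i|r_t)}p(y_i|f_i)\ge\zeta$; $V_t$ is symmetric with all eigenvalues at least a fixed $v>0$; and, with $\delta_t=\gamma_t^4$, $$L_t>\frac{\log(6n/\delta_t)}{2\gamma_t^2}\max\Big\{\frac{B^2}{|\mathbb E\phi_i(r_t)|^2},\frac{(B'-b')^2}{P^2},\frac{(B''-b'')^2}{Q^2}\Big\},$$ where $P=|\mathbb E\phi_i'(r_t)|$ if this is nonzero and $P=1$ otherwise, and $Q=|\mathbb E\phi_i''(r_t)|$ if this is nonzero and $Q=1$ otherwise. Let $s_t=-\nabla h(r_t)$ and $w_t=d_t-s_t$.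 Then smooth-bMC satisfies the conditions of the modified stochastic gradient proposition: there are a constant $C$ and a function $f:\mathbb R^{d+d^2}\to\mathbb R$ such that, on the set of all $r=(m,V)$ with $V$ symmetric, $V\succeq vI$ and $\mathbb E\phi_i(r)\ge\zeta$ for all $i$ (which a.s. contains every $r_t$), $f=h+C$, $h$ is differentiable and $\nabla f=\nabla h$, and such that * (a) $f\ge 0$ on $\mathbb R^{d+d^2}$; * (b) $f$ is $C^1$ on $\mathbb R^{d+d^2}$ with globally Lipschitz gradient; * (c) for some $c_1,c_2>0$ and all $t$, a.s. $c_1\|\nabla f(r_t)\|^2\le-\nabla f(r_t)^\top\mathbb E[s_t|\mathcal F_t]$ and $\mathbb E[\|s_t\|^2|\mathcal F_t]\le c_2\|\nabla f(r_t)\|^2$; * (d) for some $p,q>0$ and all $t$, a.s. $\mathbb E[\|w_t\|^2|\mathcal F_t]\le\big(\gamma_t(q+p\|\nabla f(r_t)\|)\big)^2$; where $r_t$ is $\mathcal F_t$-measurable, $s_t,w_t$ are square-integrable, $r_{t+1}=r_t+\gamma_t(s_t+w_t)$, $\gamma_t\ge0$, $\sum\gamma_t=\infty$ and $\sum\gamma_t^2<\infty$.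 Hence smooth-bMC converges with probability 1: almost surely $h(r_t)$ converges to a finite limit, $\nabla h(r_t)\to0$, and every limit point of $(r_t)$ is a stationary point of $h$. -/

import Mathlib

open MeasureTheory ProbabilityTheory Filter Topology
open scoped Matrix NNReal

noncomputable section

namespace SmoothBMC

/-! ### The model and its objective -/

/-- The parameter space of `r = (m, V)`, with `m ∈ ℝ^d` and the `d × d` matrix `V` vectorised,
carrying the Euclidean norm of `ℝ^(d + d²)`. -/
abbrev Param (d : ℕ) : Type := EuclideanSpace ℝ (Fin d ⊕ Fin d × Fin d)

/-- The mean `m` of `r = (m, V)`. -/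
def mean {d : ℕ} (r : Param d) : EuclideanSpace ℝ (Fin d) :=
  WithLp.toLp 2 fun j => r (Sum.inl j)

/-- The covariance matrix `V` of `r = (m, V)`. -/
def cov {d : ℕ} (r : Param d) : Matrix (Fin d) (Fin d) ℝ :=
  Matrix.of fun j k => r (Sum.inr (j, k))

/-- The vector `(u, W)` of the parameter space. -/
def pack {d : ℕ} (u : Fin d → ℝ) (W : Matrix (Fin d) (Fin d) ℝ) : Param d :=
  WithLp.toLp 2 (Sum.elim u fun jk => W jk.1 jk.2)

/-- The Kullback-Leibler divergence of `N(m, V)` from `N(m₀, S)` in closed form, for positive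
definite `V` and `S` (see `klDiv_multivariateGaussian` below). -/
def gaussianKL {d : ℕ} (m : EuclideanSpace ℝ (Fin d)) (V : Matrix (Fin d) (Fin d) ℝ)
    (m₀ : EuclideanSpace ℝ (Fin d)) (S : Matrix (Fin d) (Fin d) ℝ) : ℝ :=
  1 / 2 * ((S⁻¹ * V).trace + (m.ofLp - m₀.ofLp) ⬝ᵥ S⁻¹ *ᵥ (m.ofLp - m₀.ofLp) - (d : ℝ)
    + Real.log S.det - Real.log V.det)

/-- The density of the standard Gaussian measure on `ℝ^d`. -/
theorem stdGaussian_eq_withDensity (d : ℕ) :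
    stdGaussian (EuclideanSpace ℝ (Fin d)) = volume.withDensity fun x =>
      ENNReal.ofReal (((2 * Real.pi) ^ ((d : ℝ) / 2))⁻¹ * Real.exp (-(1 / 2) * ‖x‖ ^ 2)) := by
  have hhalf : (0 : ℝ) < ((1 / 2 : ℂ)).re := by norm_num
  have hint : Integrable (fun x : EuclideanSpace ℝ (Fin d) => Real.exp (-(1 / 2) * ‖x‖ ^ 2)) := by
    have h := (GaussianFourier.integrable_cexp_neg_mul_sq_norm_add hhalf 0
      (0 : EuclideanSpace ℝ (Fin d))).norm
    refine h.congr (ae_of_all _ fun x => ?_)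
    simp only [Complex.norm_exp]
    rw [zero_mul, add_zero, ← Complex.ofReal_pow]
    congr 1
    simp [-Complex.ofReal_pow]
  have hκ : (0 : ℝ) < ((2 * Real.pi) ^ ((d : ℝ) / 2))⁻¹ := by positivity
  have hint' := hint.const_mul (((2 * Real.pi) ^ ((d : ℝ) / 2))⁻¹)
  have hfin : IsFiniteMeasure ((volume : Measure (EuclideanSpace ℝ (Fin d))).withDensity fun x =>
      ENNReal.ofReal (((2 * Real.pi) ^ ((d : ℝ) / 2))⁻¹ * Real.exp (-(1 / 2) * ‖x‖ ^ 2))) :=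
    isFiniteMeasure_withDensity_ofReal hint'.2
  apply Measure.ext_of_charFun
  ext t
  rw [charFun_stdGaussian, charFun_apply,
    integral_withDensity_eq_integral_toReal_smul (by fun_prop) (by simp)]
  have h := GaussianFourier.integral_cexp_neg_mul_sq_norm_add hhalf Complex.I t
  have : ∀ x : EuclideanSpace ℝ (Fin d), (ENNReal.ofReal (((2 * Real.pi) ^ ((d : ℝ) / 2))⁻¹ *
      Real.exp (-(1 / 2) * ‖x‖ ^ 2))).toReal • Complex.exp ((inner ℝ x t : ℝ) * Complex.I) =
      ((((2 * Real.pi) ^ ((d : ℝ) / 2))⁻¹ : ℝ) : ℂ) *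
        Complex.exp (-(1 / 2 : ℂ) * ‖x‖ ^ 2 + Complex.I * (inner ℝ t x : ℝ)) := by
    intro x
    rw [ENNReal.toReal_ofReal (by positivity), Complex.exp_add, real_inner_comm t x]
    simp only [Complex.real_smul, Complex.ofReal_mul, Complex.ofReal_exp]
    push_cast
    ring_nf
  simp_rw [this]
  rw [integral_const_mul, h, Complex.I_sq]
  have hc : ((Real.pi : ℂ) / (1 / 2)) ^ ((Module.finrank ℝ (EuclideanSpace ℝ (Fin d)) : ℂ) / 2) =
      (((2 * Real.pi) ^ ((d : ℝ) / 2) : ℝ) : ℂ) := by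
    rw [Complex.ofReal_cpow (by positivity)]
    push_cast
    simp
    ring_nf
  rw [hc, ← mul_assoc, ← Complex.ofReal_mul, inv_mul_cancel₀ (by positivity)]
  simp
  ring_nf

/-- The density of a non-degenerate Gaussian measure on `ℝ^d`. -/
theorem multivariateGaussian_eq_withDensity {d : ℕ} (m : EuclideanSpace ℝ (Fin d))
    {V : Matrix (Fin d) (Fin d) ℝ} (hV : V.PosDef) :
    multivariateGaussian m V = volume.withDensity fun x =>
      ENNReal.ofReal (((2 * Real.pi) ^ ((d : ℝ) / 2))⁻¹ * Real.exp (-(1 / 2) * Real.log V.det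
        - 1 / 2 * ((x - m).ofLp ⬝ᵥ V⁻¹ *ᵥ (x - m).ofLp))) := by
  open scoped MatrixOrder in
  set A : Matrix (Fin d) (Fin d) ℝ := CFC.sqrt V with hA
  have hAA : A * A = V := CFC.sqrt_mul_sqrt_self _ hV.posSemidef.nonneg
  have hAsymm : Aᵀ = A := by
    have : A.PosSemidef := by
      rw [← Matrix.nonneg_iff_posSemidef]; exact CFC.sqrt_nonneg V
    exact (by simpa using this.1 : A.IsSymm)
  have hdet : A.det * A.det = V.det := by rw [← Matrix.det_mul, hAA]
  have hdetpos : 0 < V.det := hV.det_pos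
  have hA0 : A.det ≠ 0 := by
    intro h; rw [h] at hdet; simp at hdet; linarith
  have habs : |A.det| = Real.exp (1 / 2 * Real.log V.det) := by
    rw [← hdet, ← abs_mul_abs_self, Real.log_mul (by simpa) (by simpa)]
    rw [show 1 / 2 * (Real.log |A.det| + Real.log |A.det|) = Real.log |A.det| by ring,
      Real.exp_log (abs_pos.2 hA0)]
  have hAu : IsUnit A.det := isUnit_iff_ne_zero.2 hA0
  have hquad : ∀ x : EuclideanSpace ℝ (Fin d),
      (A *ᵥ x.ofLp) ⬝ᵥ V⁻¹ *ᵥ (A *ᵥ x.ofLp) = ‖x‖ ^ 2 := by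
    intro x
    rw [Matrix.mulVec_mulVec, ← hAA, Matrix.mul_inv_rev, Matrix.mul_assoc,
      Matrix.nonsing_inv_mul _ hAu, Matrix.mul_one, Matrix.dotProduct_mulVec,
      ← Matrix.mulVec_transpose, Matrix.transpose_nonsing_inv, hAsymm, Matrix.mulVec_mulVec,
      Matrix.nonsing_inv_mul _ hAu, Matrix.one_mulVec, EuclideanSpace.real_norm_sq_eq]
    simp [dotProduct, sq]
  set T : EuclideanSpace ℝ (Fin d) → EuclideanSpace ℝ (Fin d) :=
    fun x => m + Matrix.toEuclideanCLM (𝕜 := ℝ) A x with hT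
  have hTm : Measurable T := by fun_prop
  have hTinj : Function.Injective T := by
    intro x y hxy
    have h1 : Matrix.toEuclideanCLM (𝕜 := ℝ) A x = Matrix.toEuclideanCLM (𝕜 := ℝ) A y :=
      add_left_cancel hxy
    have h2 : A *ᵥ x.ofLp = A *ᵥ y.ofLp := by
      simpa using congrArg WithLp.ofLp h1
    have h3 := congrArg (fun z => A⁻¹ *ᵥ z) h2
    simp only [Matrix.mulVec_mulVec, Matrix.nonsing_inv_mul _ hAu, Matrix.one_mulVec] at h3
    exact WithLp.ofLp_injective 2 h3
  have hTsurj : Function.Surjective T := by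
    intro y
    refine ⟨WithLp.toLp 2 (A⁻¹ *ᵥ (y - m).ofLp), ?_⟩
    simp only [hT, Matrix.toEuclideanCLM_toLp, Matrix.mulVec_mulVec,
      Matrix.mul_nonsing_inv _ hAu, Matrix.one_mulVec]
    simp
  have hcdet : (Matrix.toEuclideanCLM (𝕜 := ℝ) A).det = A.det := by
    change LinearMap.det (Matrix.toEuclideanLin A) = _
    exact LinearMap.det_toLin (PiLp.basisFun 2 ℝ (Fin d)) A
  rw [multivariateGaussian, stdGaussian_eq_withDensity]
  ext s hs
  rw [Measure.map_apply (by fun_prop) hs, withDensity_apply _ (hTm hs), withDensity_apply _ hs]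
  have himg : T '' (T ⁻¹' s) = s := Set.image_preimage_eq s hTsurj
  conv_rhs => rw [← himg]
  rw [lintegral_image_eq_lintegral_abs_det_fderiv_mul volume (hTm hs)
    (fun x _ => (((Matrix.toEuclideanCLM (𝕜 := ℝ) A).hasFDerivAt (x := x)).const_add
      m).hasFDerivWithinAt) hTinj.injOn]
  refine lintegral_congr fun x => ?_
  rw [hcdet, ← ENNReal.ofReal_mul (abs_nonneg _)]
  congr 1
  rw [habs]
  have : (T x - m).ofLp = A *ᵥ x.ofLp := by simp [hT]
  rw [this, hquad, mul_left_comm, ← Real.exp_add]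
  congr 2
  ring

/-- The expectation of a quadratic form under a Gaussian measure. -/
theorem integral_quadratic_multivariateGaussian {d : ℕ} (m c : EuclideanSpace ℝ (Fin d))
    {V : Matrix (Fin d) (Fin d) ℝ} (hV : V.PosSemidef) (Q : Matrix (Fin d) (Fin d) ℝ) :
    Integrable (fun x => (x - c).ofLp ⬝ᵥ Q *ᵥ (x - c).ofLp) (multivariateGaussian m V) ∧
    ∫ x, (x - c).ofLp ⬝ᵥ Q *ᵥ (x - c).ofLp ∂multivariateGaussian m V =
      (Q * V).trace + (m.ofLp - c.ofLp) ⬝ᵥ Q *ᵥ (m.ofLp - c.ofLp) := by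
  set μ := multivariateGaussian m V with hμ
  have hL2 : ∀ j, MemLp (fun x : EuclideanSpace ℝ (Fin d) => x j) 2 μ := by
    intro j
    have := (EuclideanSpace.proj (𝕜 := ℝ) j).comp_memLp' (IsGaussian.memLp_two_id (μ := μ))
    exact this
  have hL2c : ∀ j, MemLp (fun x : EuclideanSpace ℝ (Fin d) => x j - c j) 2 μ :=
    fun j => (hL2 j).sub (memLp_const _)
  have hmean : ∀ j, ∫ x, x j ∂μ = m j := by
    intro j
    have h := (EuclideanSpace.proj (𝕜 := ℝ) j).integral_comp_comm
      (IsGaussian.integrable_fun_id (μ := μ))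
    rw [hμ, integral_id_multivariateGaussian] at h
    exact h
  have hi : ∀ j k, Integrable (fun x : EuclideanSpace ℝ (Fin d) => (x j - c j) * (x k - c k)) μ :=
    fun j k => (hL2c j).integrable_mul (hL2c k)
  have hE : ∀ j k, ∫ x, (x j - c j) * (x k - c k) ∂μ = V j k + (m j - c j) * (m k - c k) := by
    intro j k
    have h := covariance_eval_multivariateGaussian (μ := m) hV j k
    rw [covariance] at h
    have hj := (hL2 j).integrable one_le_two
    have hk := (hL2 k).integrable one_le_two
    rw [← hμ, hmean, hmean] at h
    rw [← h]
    have e : ∀ x : EuclideanSpace ℝ (Fin d), (x j - c j) * (x k - c k) =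
        (x j - m j) * (x k - m k) + ((m k - c k) * (x j - m j) + (m j - c j) * (x k - m k)
          + (m j - c j) * (m k - c k)) := by intro x; ring
    have i1 : Integrable (fun x : EuclideanSpace ℝ (Fin d) => (x j - m j) * (x k - m k)) μ :=
      ((hL2 j).sub (memLp_const _)).integrable_mul ((hL2 k).sub (memLp_const _))
    have ij : Integrable (fun x : EuclideanSpace ℝ (Fin d) => (m k - c k) * (x j - m j)) μ :=
      (hj.sub (integrable_const (m j))).const_mul (m k - c k)
    have ik : Integrable (fun x : EuclideanSpace ℝ (Fin d) => (m j - c j) * (x k - m k)) μ :=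
      (hk.sub (integrable_const (m k))).const_mul (m j - c j)
    have ijk : Integrable (fun x : EuclideanSpace ℝ (Fin d) =>
        (m k - c k) * (x j - m j) + (m j - c j) * (x k - m k)) μ := ij.add ik
    have i0 : Integrable (fun _ : EuclideanSpace ℝ (Fin d) => (m j - c j) * (m k - c k)) μ :=
      integrable_const _
    have i2 : Integrable (fun x : EuclideanSpace ℝ (Fin d) => (m k - c k) * (x j - m j)
        + (m j - c j) * (x k - m k) + (m j - c j) * (m k - c k)) μ := ijk.add i0
    rw [integral_congr_ae (ae_of_all μ e)]
    rw [integral_add i1 i2, integral_add ijk i0, integral_add ij ik, integral_const_mul,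
      integral_const_mul]
    have e1 : ∀ j, ∫ x, (x j - m j) ∂μ = 0 := by
      intro j
      rw [integral_sub ((hL2 j).integrable one_le_two) (integrable_const _), hmean]
      simp
    rw [e1, e1]
    simp
  have hexp : ∀ x : EuclideanSpace ℝ (Fin d), (x - c).ofLp ⬝ᵥ Q *ᵥ (x - c).ofLp =
      ∑ j, ∑ k, Q j k * ((x j - c j) * (x k - c k)) := by
    intro x
    simp only [dotProduct, Matrix.mulVec, Finset.mul_sum]
    refine Finset.sum_congr rfl fun j _ => Finset.sum_congr rfl fun k _ => ?_
    simp
    ring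
  simp_rw [hexp]
  have hi' : ∀ j k, Integrable (fun x : EuclideanSpace ℝ (Fin d) =>
      Q j k * ((x j - c j) * (x k - c k))) μ := fun j k => (hi j k).const_mul _
  refine ⟨integrable_finsetSum _ fun j _ => integrable_finsetSum _ fun k _ => hi' j k, ?_⟩
  rw [integral_finsetSum _ fun j _ => integrable_finsetSum _ fun k _ => hi' j k]
  simp_rw [integral_finsetSum _ fun k _ => hi' _ k, integral_const_mul, hE]
  have hVs : ∀ j k, V j k = V k j := fun j k => by
    have := hV.1.apply k j
    simpa using this
  simp only [Matrix.trace, Matrix.diag, Matrix.mul_apply, dotProduct, Matrix.mulVec,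
    Finset.mul_sum, ← Finset.sum_add_distrib]
  refine Finset.sum_congr rfl fun j _ => Finset.sum_congr rfl fun k _ => ?_
  rw [hVs j k]
  simp
  ring

/-- `gaussianKL` is the Kullback-Leibler divergence of Gaussian measures. -/
theorem klDiv_multivariateGaussian {d : ℕ} (m m₀ : EuclideanSpace ℝ (Fin d))
    {V S : Matrix (Fin d) (Fin d) ℝ} (hV : V.PosDef) (hS : S.PosDef) :
    InformationTheory.klDiv (multivariateGaussian m V) (multivariateGaussian m₀ S) =
      ENNReal.ofReal (gaussianKL m V m₀ S) := by
  set μ := multivariateGaussian m V with hμ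
  set ν := multivariateGaussian m₀ S with hν
  set ℓ : EuclideanSpace ℝ (Fin d) → ℝ := fun x =>
    (1 / 2 * (Real.log S.det - Real.log V.det)
      + 1 / 2 * ((x - m₀).ofLp ⬝ᵥ S⁻¹ *ᵥ (x - m₀).ofLp))
      - 1 / 2 * ((x - m).ofLp ⬝ᵥ V⁻¹ *ᵥ (x - m).ofLp) with hℓ
  have hquad : ∀ (c : EuclideanSpace ℝ (Fin d)) (Q : Matrix (Fin d) (Fin d) ℝ),
      Measurable fun x : EuclideanSpace ℝ (Fin d) => (x - c).ofLp ⬝ᵥ Q *ᵥ (x - c).ofLp := by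
    intro c Q
    simp only [dotProduct, Matrix.mulVec]
    fun_prop
  have hℓm : Measurable ℓ := by
    have := hquad m V⁻¹
    have := hquad m₀ S⁻¹
    fun_prop
  have hdens : μ = ν.withDensity fun x => ENNReal.ofReal (Real.exp (ℓ x)) := by
    rw [hμ, hν, multivariateGaussian_eq_withDensity m hV,
      multivariateGaussian_eq_withDensity m₀ hS, ← withDensity_mul]
    · congr 1
      ext x
      rw [Pi.mul_apply, ← ENNReal.ofReal_mul (by positivity), mul_assoc, ← Real.exp_add]
      congr 3
      simp only [hℓ]
      ring
    · have := hquad m₀ S⁻¹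
      fun_prop
    · fun_prop
  have hac : μ ≪ ν := by rw [hdens]; exact withDensity_absolutelyContinuous _ _
  have hllr : llr μ ν =ᵐ[μ] ℓ := by
    refine hac.ae_le ?_
    have h := Measure.rnDeriv_withDensity ν (f := fun x => ENNReal.ofReal (Real.exp (ℓ x)))
      (by fun_prop)
    rw [← hdens] at h
    filter_upwards [h] with x hx
    rw [llr, hx, ENNReal.toReal_ofReal (Real.exp_pos _).le, Real.log_exp]
  obtain ⟨i₁, e₁⟩ := integral_quadratic_multivariateGaussian m m₀ hV.posSemidef S⁻¹
  obtain ⟨i₂, e₂⟩ := integral_quadratic_multivariateGaussian m m hV.posSemidef V⁻¹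
  have hi : Integrable (llr μ ν) μ :=
    ((((integrable_const _).add (i₁.const_mul _)).sub (i₂.const_mul _)).congr hllr.symm :)
  have hval : ∫ x, llr μ ν x ∂μ = gaussianKL m V m₀ S := by
    rw [integral_congr_ae hllr]
    have j₁ := i₁.const_mul (1 / 2)
    have j₂ := i₂.const_mul (1 / 2)
    have j₀ : Integrable (fun _ : EuclideanSpace ℝ (Fin d) =>
        1 / 2 * (Real.log S.det - Real.log V.det)) μ := integrable_const _
    have j₃ : Integrable (fun x : EuclideanSpace ℝ (Fin d) =>
        1 / 2 * (Real.log S.det - Real.log V.det)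
          + 1 / 2 * ((x - m₀).ofLp ⬝ᵥ S⁻¹ *ᵥ (x - m₀).ofLp)) μ := j₀.add j₁
    simp only [hℓ]
    rw [integral_sub j₃ j₂, integral_add j₀ j₁, integral_const_mul,
      integral_const_mul, integral_const_mul, e₁, e₂, Matrix.nonsing_inv_mul _ (isUnit_iff_ne_zero.2 hV.det_pos.ne')]
    simp [gaussianKL]
    ring
  rw [← ENNReal.ofReal_toReal (InformationTheory.klDiv_ne_top hac hi),
    InformationTheory.toReal_klDiv_of_measure_eq hac (by simp), hval]

/-- The data of the learning problem with `n` examples: `lik i f` is the likelihood `p(y_i | f)`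
of the observation `y_i`; the predictive distribution is
`q(f_i | r) = N(a₁ᵢᵀ m + b₁ᵢ, a₂ᵢᵀ V a₂ᵢ + b₂ᵢ)`; the prior is `N(m₀, S₀)` and `β` is the
regularization parameter. -/
structure Model (n d : ℕ) where
  lik : Fin n → ℝ → ℝ
  a₁ : Fin n → Fin d → ℝ
  a₂ : Fin n → Fin d → ℝ
  b₁ : Fin n → ℝ
  b₂ : Fin n → ℝ
  m₀ : EuclideanSpace ℝ (Fin d)
  S₀ : Matrix (Fin d) (Fin d) ℝ
  β : ℝ

namespace Model

variable {n d : ℕ} (M : Model n d)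

/-- The mean of `q(f_i | r)`. -/
def latentMean (i : Fin n) (r : Param d) : ℝ := M.a₁ i ⬝ᵥ (mean r).ofLp + M.b₁ i

/-- The variance of `q(f_i | r)`. -/
def latentVar (i : Fin n) (r : Param d) : ℝ := M.a₂ i ⬝ᵥ cov r *ᵥ M.a₂ i + M.b₂ i

/-- The reparameterization `g_i(r, ε)`. -/
def g (i : Fin n) (r : Param d) (ε : ℝ) : ℝ := √(M.latentVar i r) * ε + M.latentMean i r

/-- `φ_i(r, ε) = p(y_i | f_i = g_i(r, ε))`. -/
def φ (i : Fin n) (r : Param d) (ε : ℝ) : ℝ := M.lik i (M.g i r ε)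

/-- `φ_i'(r, ε) = ∂/∂f_i p(y_i | f_i = g_i(r, ε))`. -/
def φ' (i : Fin n) (r : Param d) (ε : ℝ) : ℝ := deriv (M.lik i) (M.g i r ε)

/-- `φ_i''(r, ε) = ∂²/∂f_i² p(y_i | f_i = g_i(r, ε))`. -/
def φ'' (i : Fin n) (r : Param d) (ε : ℝ) : ℝ := deriv (deriv (M.lik i)) (M.g i r ε)

/-- `E_{N(ε|0,1)} φ_i(r, ε)`, that is, `E_{q(f_i|r)} p(y_i | f_i)`. -/
def Eφ (i : Fin n) (r : Param d) : ℝ := ∫ ε, M.φ i r ε ∂gaussianReal 0 1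

/-- `Eφ` is the expectation of the likelihood under `q(f_i | r)`. -/
theorem Eφ_eq_integral (i : Fin n) (r : Param d) (hv : 0 ≤ M.latentVar i r)
    (hm : Measurable (M.lik i)) :
    M.Eφ i r =
      ∫ f, M.lik i f ∂gaussianReal (M.latentMean i r) (M.latentVar i r).toNNReal := by
  have h : (gaussianReal 0 1).map (fun ε => √(M.latentVar i r) * ε + M.latentMean i r) =
      gaussianReal (M.latentMean i r) (M.latentVar i r).toNNReal := by
    have e : (fun ε => √(M.latentVar i r) * ε + M.latentMean i r) =
        (fun x => x + M.latentMean i r) ∘ fun ε => √(M.latentVar i r) * ε := rfl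
    rw [e, ← Measure.map_map (by fun_prop) (by fun_prop), gaussianReal_map_const_mul,
      gaussianReal_map_add_const]
    congr 1
    · simp
    · ext
      simp [Real.sq_sqrt hv, Real.coe_toNNReal _ hv]
  rw [← h, integral_map (by fun_prop) hm.aestronglyMeasurable]
  rfl

/-- `E_{N(ε|0,1)} φ_i'(r, ε)`. -/
def Eφ' (i : Fin n) (r : Param d) : ℝ := ∫ ε, M.φ' i r ε ∂gaussianReal 0 1

/-- `E_{N(ε|0,1)} φ_i''(r, ε)`. -/
def Eφ'' (i : Fin n) (r : Param d) : ℝ := ∫ ε, M.φ'' i r ε ∂gaussianReal 0 1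

/-- The regularizer `(β / n) KL(N(m, V) ‖ N(m₀, S₀))`. -/
def regularizer (r : Param d) : ℝ := M.β / n * gaussianKL (mean r) (cov r) M.m₀ M.S₀

/-- The log-loss objective, scaled by the number of examples:
`h(r) = -(1/n) ∑ᵢ log E_{q(f_i|r)} p(y_i | f_i) + (β / n) KL(N(m, V) ‖ N(m₀, S₀))`. -/
def objective (r : Param d) : ℝ :=
  1 / (n : ℝ) * ∑ i, -Real.log (M.Eφ i r) + M.regularizer r

/-- `φ`, `φ'` and `φ''` are bounded:
`0 ≤ φ_i ≤ B`, `b' ≤ φ_i' ≤ B'` and `b'' ≤ φ_i'' ≤ B''` for all `i`, `r` and `ε`. -/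
def DerivBounds (B b' B' b'' B'' : ℝ) : Prop :=
  ∀ i r ε, (0 ≤ M.φ i r ε ∧ M.φ i r ε ≤ B) ∧ (b' ≤ M.φ' i r ε ∧ M.φ' i r ε ≤ B') ∧
    (b'' ≤ M.φ'' i r ε ∧ M.φ'' i r ε ≤ B'')

/-- The factor `max {B² / |Eφ_i|², (B' - b')² / P², (B'' - b'')² / Q²}` of the sample size, where
`P = |Eφ_i'|` and `Q = |Eφ_i''|`, replaced by `1` when they vanish. -/
def sampleFactor (B b' B' b'' B'' : ℝ) (i : Fin n) (r : Param d) : ℝ :=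
  let P : ℝ := if M.Eφ' i r ≠ 0 then |M.Eφ' i r| else 1
  let Q : ℝ := if M.Eφ'' i r ≠ 0 then |M.Eφ'' i r| else 1
  max (B ^ 2 / |M.Eφ i r| ^ 2) (max ((B' - b') ^ 2 / P ^ 2) ((B'' - b'') ^ 2 / Q ^ 2))

/-! ### The smoothed biased Monte Carlo algorithm -/

/-- The Monte Carlo average `(1/L) ∑_{ℓ < L} ψ(ε_ℓ)`. -/
def avg (L : ℕ) (e : ℕ → ℝ) (ψ : ℝ → ℝ) : ℝ := 1 / (L : ℝ) * ∑ l ∈ Finset.range L, ψ (e l)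

/-- The smoothed estimate `(d_{i,m}, d_{i,V})` of the negative gradient of
`r ↦ -log E_{q(f_i|r)} p(y_i | f_i)` from `L` draws, with smoothing `ν`. -/
def lossDirection (ν : ℝ) (L : ℕ) (e : ℕ → ℝ) (i : Fin n) (r : Param d) : Param d :=
  pack ((avg L e (M.φ' i r) / (avg L e (M.φ i r) + ν)) • M.a₁ i)
    ((avg L e (M.φ'' i r) / (avg L e (M.φ i r) + ν)) •
      ((1 / 2 : ℝ) • Matrix.vecMulVec (M.a₂ i) (M.a₂ i)))

/-- The step direction: the estimates of the loss terms are combined with the exact gradient of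
the regularizer; `e i` are the draws for the `i`-th example. -/
def direction (ν : ℝ) (L : ℕ) (e : Fin n → ℕ → ℝ) (r : Param d) : Param d :=
  (1 / (n : ℝ)) • ∑ i, M.lossDirection ν L (e i) i r - gradient M.regularizer r

/-- `r` is a run of smooth-bMC with step sizes `γ t`, smoothing `ν t`, sample sizes `L t` and draws
`ε t i l` (step `t`, example `i`, `l`-th draw), where `ℱ t` is the history up to step `t`. For each
example the draws are independent standard normal variables, independent of the history; nothing
is asked about the joint law of the draws of different examples (they may be shared, or
independent). The sample size may depend on the history. -/
structure IsSmoothBMC {Ω : Type*} [MeasurableSpace Ω] (P : Measure Ω) (ℱ : Filtration ℕ ‹_›)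
    (γ ν : ℕ → ℝ) (L : ℕ → Ω → ℕ) (ε : ℕ → Fin n → ℕ → Ω → ℝ) (r : ℕ → Ω → Param d) :
    Prop where
  init_measurable : Measurable[ℱ 0] (r 0)
  init_memLp : MemLp (r 0) 2 P
  sampleSize_measurable : ∀ t, Measurable[ℱ t] (L t)
  sampleSize_pos : ∀ t ω, 0 < L t ω
  draw_measurable : ∀ t i l, Measurable[ℱ (t + 1)] (ε t i l)
  draw_law : ∀ t i l, P.map (ε t i l) = gaussianReal 0 1
  draw_indep : ∀ t i, iIndepFun (fun l => ε t i l) P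
  draw_indep_history : ∀ t i,
    Indep (MeasurableSpace.comap (fun ω l => ε t i l ω) inferInstance) (ℱ t) P
  update : ∀ t ω, r (t + 1) ω =
    r t ω + γ t • M.direction (ν t) (L t ω) (fun i l => ε t i l ω) (r t ω)

/-- The parameters at which the `N(m, V)` are uniformly non-degenerate (`V` is symmetric with all
eigenvalues at least `v`) and `E_{q(f_i|r)} p(y_i | f_i) ≥ ζ` for every `i`. -/
def domain (ζ v : ℝ) : Set (Param d) :=
  {r | (cov r - v • (1 : Matrix (Fin d) (Fin d) ℝ)).PosSemidef ∧ ∀ i, ζ ≤ M.Eφ i r}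

end Model

/-! ### The modified stochastic gradient proposition -/

/-- The hypotheses of the modified stochastic gradient proposition, for the function `f` and the
algorithm `r_{t+1} = r_t + γ_t (s_t + w_t)` with history `ℱ`. -/
structure StochasticGradientConditions {E : Type*} [NormedAddCommGroup E] [InnerProductSpace ℝ E]
    [CompleteSpace E] [MeasurableSpace E] {Ω : Type*} [MeasurableSpace Ω] (P : Measure Ω)
    (ℱ : Filtration ℕ ‹_›) (γ : ℕ → ℝ) (f : E → ℝ) (r s w : ℕ → Ω → E) : Prop where
  adapted : ∀ t, Measurable[ℱ t] (r t)
  memLp_s : ∀ t, MemLp (s t) 2 P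
  memLp_w : ∀ t, MemLp (w t) 2 P
  update : ∀ t ω, r (t + 1) ω = r t ω + γ t • (s t ω + w t ω)
  step_nonneg : ∀ t, 0 ≤ γ t
  step_sum : Tendsto (fun T => ∑ t ∈ Finset.range T, γ t) atTop atTop
  step_sq_sum : Summable fun t => γ t ^ 2
  nonneg : ∀ x, 0 ≤ f x
  contDiff : ContDiff ℝ 1 f
  lipschitz : ∃ K : ℝ≥0, LipschitzWith K (gradient f)
  descent : ∃ c₁ c₂ : ℝ, 0 < c₁ ∧ 0 < c₂ ∧ ∀ t,
    (∀ᵐ ω ∂P, c₁ * ‖gradient f (r t ω)‖ ^ 2 ≤ -inner ℝ (gradient f (r t ω)) ((P[s t|ℱ t]) ω)) ∧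
    (∀ᵐ ω ∂P, (P[fun ω' => ‖s t ω'‖ ^ 2|ℱ t]) ω ≤ c₂ * ‖gradient f (r t ω)‖ ^ 2)
  error : ∃ p q : ℝ, 0 < p ∧ 0 < q ∧ ∀ t,
    ∀ᵐ ω ∂P, (P[fun ω' => ‖w t ω'‖ ^ 2|ℱ t]) ω ≤ (γ t * (q + p * ‖gradient f (r t ω)‖)) ^ 2

end SmoothBMC

end

open MeasureTheory ProbabilityTheory Filter Topology
open scoped Matrix NNReal

noncomputable section

namespace SmoothBMC

/-! ### Functions with Lipschitz gradient -/

section Gradient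

variable {E : Type*} [NormedAddCommGroup E] [InnerProductSpace ℝ E] [CompleteSpace E]

/-! The objective `h` is well behaved only on the domain, where V ⪰ vI and Eφ_i ≥ ζ. Segments
between iterates may leave this set, and for d ≥ 2 it has empty interior because V is symmetric
there. The descent lemma therefore needs a substitute `f` for `h` on the whole space, and the
gradient of `h` at domain points cannot be read off from the values of `f` there. The proof has
three ingredients.

Extension. Every singular scalar function is replaced outside the range visited on the domain. The
standard deviation √x and the loss -log x are continued by tangents, so their derivatives are
bounded and Lipschitz and the chain rule preserves Lipschitz gradients. For -log det V the scalar
function acts on the eigenvalues of the symmetric part of V. Klein's inequality makes the resulting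
matrix function a subgradient, and a trace inequality makes it Lipschitz, which together give
differentiability (`HasLipschitzGradient.of_subgradient`). Here the continuation is quadratic, so
that it dominates the linear term tr(S₀⁻¹V) and the regularizer stays bounded below. Stein's
identity rewrites the derivative in V through Eφ'', the quantity which the algorithm estimates. A
constant makes the extension nonnegative (`exists_extension_objective`).

Error. The exact regularizer gradient cancels in w_t, so w_t is a combination of errors of smoothed
ratios of Monte Carlo averages. The sample size makes the variances of the averages O(γ_t²). The
denominator falls below half its mean with probability at most exp(-1/(4γ_t²)) = O(γ_t⁴) by
Hoeffding; there the smoothing still bounds the ratio by O(1/γ_t). Both contributions to the mean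
square are O(γ_t²) (`integral_sq_ratio_error_le`). Independence of the draws from the history turns
this into a conditional bound. Since s_t = -∇f(r_t) is known at time t, conditions (c) and (d)
follow.

Convergence. The bound gives ∑ E‖w_t‖² < ∞, so almost surely ∑‖w_t‖² < ∞. From there on the argument
is deterministic, path by path: gradient descent with square-summable errors
(`tendsto_of_gradient_descent`). The domain is closed and ∇f is continuous, so limit points are
stationary. -/

theorem hasGradientAt_add {f g : E → ℝ} {u w x : E} (hf : HasGradientAt f u x)
    (hg : HasGradientAt g w x) : HasGradientAt (fun y => f y + g y) (u + w) x := by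
  rw [hasGradientAt_iff_hasFDerivAt] at *
  rw [map_add]
  exact hf.add hg

theorem hasGradientAt_const_mul {f : E → ℝ} {u x : E} (c : ℝ) (hf : HasGradientAt f u x) :
    HasGradientAt (fun y => c * f y) (c • u) x := by
  rw [hasGradientAt_iff_hasFDerivAt] at *
  rw [map_smulₛₗ]
  exact hf.const_mul c

theorem hasGradientAt_sum {ι : Type*} (s : Finset ι) {f : ι → E → ℝ} {u : ι → E} {x : E}
    (hf : ∀ i ∈ s, HasGradientAt (f i) (u i) x) :
    HasGradientAt (fun y => ∑ i ∈ s, f i y) (∑ i ∈ s, u i) x := by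
  simp only [hasGradientAt_iff_hasFDerivAt] at *
  rw [map_sum]
  exact HasFDerivAt.fun_sum hf

theorem hasGradientAt_comp {φ : ℝ → ℝ} {f : E → ℝ} {c : ℝ} {u x : E} (hφ : HasDerivAt φ c (f x))
    (hf : HasGradientAt f u x) : HasGradientAt (fun y => φ (f y)) (c • u) x := by
  rw [hasGradientAt_iff_hasFDerivAt] at *
  rw [map_smulₛₗ]
  exact hφ.comp_hasFDerivAt x hf

theorem hasGradientAt_inner_add_const (u : E) (c : ℝ) (x : E) :
    HasGradientAt (fun y => inner ℝ u y + c) u x := by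
  rw [hasGradientAt_iff_hasFDerivAt]
  exact ((InnerProductSpace.toDual ℝ E) u).hasFDerivAt.add_const c

/-- `f` is differentiable with the Lipschitz gradient `G`. -/
def HasLipschitzGradient (f : E → ℝ) (G : E → E) : Prop :=
  (∀ x, HasGradientAt f (G x) x) ∧ ∃ K : ℝ≥0, LipschitzWith K G

theorem lipschitz_of_norm_sub_le {X F : Type*} [SeminormedAddCommGroup X]
    [SeminormedAddCommGroup F] {G : X → F} {K : ℝ} (h : ∀ x y, ‖G x - G y‖ ≤ K * ‖x - y‖) :
    ∃ K : ℝ≥0, LipschitzWith K G :=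
  ⟨K.toNNReal, LipschitzWith.of_dist_le_mul fun x y => by
    rw [dist_eq_norm, dist_eq_norm]
    exact (h x y).trans (mul_le_mul_of_nonneg_right (Real.le_coe_toNNReal K) (norm_nonneg _))⟩

/-- The product rule for differences, which needs both factors bounded. This is why bounds on
gradients are carried along with their Lipschitz constants. -/
theorem lipschitz_smul {X F : Type*} [SeminormedAddCommGroup X] [SeminormedAddCommGroup F]
    [NormedSpace ℝ F] {f : X → ℝ} {g : X → F} {A B : ℝ} (hf : ∃ K : ℝ≥0, LipschitzWith K f)
    (hg : ∃ K : ℝ≥0, LipschitzWith K g) (hA : ∀ x, |f x| ≤ A) (hB : ∀ x, ‖g x‖ ≤ B) :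
    ∃ K : ℝ≥0, LipschitzWith K fun x => f x • g x := by
  obtain ⟨K, hK⟩ := hf
  obtain ⟨J, hJ⟩ := hg
  refine lipschitz_of_norm_sub_le (K := A * J + K * B) fun x y => ?_
  have e : f x • g x - f y • g y = f x • (g x - g y) + (f x - f y) • g y := by
    rw [smul_sub, sub_smul]; abel
  have h1 := hJ.dist_le_mul x y
  have h2 := hK.dist_le_mul x y
  rw [dist_eq_norm, dist_eq_norm] at h1 h2
  rw [e]
  refine (norm_add_le _ _).trans ?_
  rw [norm_smul, norm_smul, add_mul, Real.norm_eq_abs]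
  have hA0 : 0 ≤ A := (abs_nonneg _).trans (hA x)
  refine add_le_add ?_ ?_
  · rw [mul_assoc]
    exact mul_le_mul (hA x) h1 (norm_nonneg _) hA0
  · rw [mul_right_comm]
    exact mul_le_mul h2 (hB y) (norm_nonneg _) (by positivity)

theorem lipschitz_sum {X F ι : Type*} [PseudoEMetricSpace X] [SeminormedAddCommGroup F]
    (s : Finset ι) {g : ι → X → F} (hg : ∀ i ∈ s, ∃ K : ℝ≥0, LipschitzWith K (g i)) :
    ∃ K : ℝ≥0, LipschitzWith K fun x => ∑ i ∈ s, g i x := by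
  classical
  induction s using Finset.induction_on with
  | empty => exact ⟨0, by simpa using LipschitzWith.const (0 : F)⟩
  | insert a s ha ih =>
    obtain ⟨K, hK⟩ := ih fun i hi => hg i (Finset.mem_insert_of_mem hi)
    obtain ⟨J, hJ⟩ := hg a (Finset.mem_insert_self a s)
    exact ⟨J + K, by simpa [Finset.sum_insert ha] using hJ.add hK⟩

theorem lipschitz_const_smul {X F : Type*} [PseudoEMetricSpace X] [SeminormedAddCommGroup F]
    [NormedSpace ℝ F] (c : ℝ) {g : X → F} (hg : ∃ K : ℝ≥0, LipschitzWith K g) :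
    ∃ K : ℝ≥0, LipschitzWith K fun x => c • g x := by
  obtain ⟨K, hK⟩ := hg
  exact ⟨_, (lipschitzWith_smul c).comp hK⟩

namespace HasLipschitzGradient

variable {f g : E → ℝ} {F G : E → E}

theorem add (hf : HasLipschitzGradient f F) (hg : HasLipschitzGradient g G) :
    HasLipschitzGradient (fun x => f x + g x) fun x => F x + G x := by
  obtain ⟨hf, K, hK⟩ := hf
  obtain ⟨hg, J, hJ⟩ := hg
  exact ⟨fun x => hasGradientAt_add (hf x) (hg x), K + J, hK.add hJ⟩

theorem const (c : ℝ) : HasLipschitzGradient (fun _ : E => c) fun _ => 0 :=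
  ⟨fun x => hasGradientAt_const x c, 0, LipschitzWith.const 0⟩

theorem const_mul (c : ℝ) (hf : HasLipschitzGradient f F) :
    HasLipschitzGradient (fun x => c * f x) fun x => c • F x :=
  ⟨fun x => hasGradientAt_const_mul c (hf.1 x), lipschitz_const_smul c hf.2⟩

theorem sum {ι : Type*} (s : Finset ι) {f : ι → E → ℝ} {F : ι → E → E}
    (hf : ∀ i ∈ s, HasLipschitzGradient (f i) (F i)) :
    HasLipschitzGradient (fun x => ∑ i ∈ s, f i x) fun x => ∑ i ∈ s, F i x :=
  ⟨fun x => hasGradientAt_sum s fun i hi => (hf i hi).1 x,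
    lipschitz_sum s fun i hi => (hf i hi).2⟩

/-- A function with a Lipschitz selection of subgradients has this selection as its gradient. -/
theorem of_subgradient {K : ℝ} (hsub : ∀ x y, f x + inner ℝ (F x) (y - x) ≤ f y)
    (hF : ∀ x y, ‖F x - F y‖ ≤ K * ‖x - y‖) : HasLipschitzGradient f F := by
  refine ⟨fun x => ?_, lipschitz_of_norm_sub_le hF⟩
  rw [hasGradientAt_iff_hasFDerivAt, hasFDerivAt_iff_isLittleO]
  -- The subgradient inequality at x makes the remainder nonnegative. The one at y bounds it by ⟨F y
  -- - F x, y - x⟩ ≤ K‖y - x‖².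
  have hO : (fun y => f y - f x - (InnerProductSpace.toDual ℝ E) (F x) (y - x)) =O[𝓝 x]
      fun y => ‖y - x‖ ^ 2 := by
    refine Asymptotics.IsBigO.of_bound K (Eventually.of_forall fun y => ?_)
    have h1 := hsub x y
    have h2 := hsub y x
    have h3 : inner ℝ (F y - F x) (y - x) ≤ ‖F y - F x‖ * ‖y - x‖ := real_inner_le_norm _ _
    have h4 := mul_le_mul_of_nonneg_right (hF y x) (norm_nonneg (y - x))
    have h5 : inner ℝ (F y) (x - y) = -inner ℝ (F y) (y - x) := by
      rw [← inner_neg_right, neg_sub]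
    rw [inner_sub_left] at h3
    rw [InnerProductSpace.toDual_apply_apply, Real.norm_eq_abs, Real.norm_eq_abs,
      abs_of_nonneg (by linarith), abs_of_nonneg (by positivity)]
    linarith [sq (‖y - x‖), mul_assoc K ‖y - x‖ ‖y - x‖]
  refine hO.trans_isLittleO ?_
  rw [← Asymptotics.isLittleO_norm_right]
  have h0 : Tendsto (fun y => ‖y - x‖) (𝓝 x) (𝓝 0) := by
    have : Continuous fun y => ‖y - x‖ := by fun_prop
    simpa using this.tendsto x
  have := ((Asymptotics.isLittleO_one_iff ℝ).2 h0).mul_isBigO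
    (Asymptotics.isBigO_refl (fun y => ‖y - x‖) (𝓝 x))
  simpa [sq] using this

theorem contDiff (hf : HasLipschitzGradient f F) : ContDiff ℝ 1 f := by
  obtain ⟨hf, K, hK⟩ := hf
  rw [contDiff_one_iff_fderiv]
  refine ⟨fun x => (hf x).differentiableAt, ?_⟩
  have : fderiv ℝ f = fun x => (InnerProductSpace.toDual ℝ E) (F x) := by
    ext1 x
    exact (hasGradientAt_iff_hasFDerivAt.1 (hf x)).fderiv
  rw [this]
  exact (InnerProductSpace.toDual ℝ E).continuous.comp hK.continuous

theorem gradient_eq (hf : HasLipschitzGradient f F) : gradient f = F :=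
  _root_.gradient_eq hf.1

theorem lipschitz_of_bounded (hf : HasLipschitzGradient f F) {A : ℝ} (hA : ∀ x, ‖F x‖ ≤ A) :
    ∃ K : ℝ≥0, LipschitzWith K f := by
  refine ⟨A.toNNReal, lipschitzWith_of_nnnorm_fderiv_le (𝕜 := ℝ)
    (fun x => (hf.1 x).differentiableAt) fun x => ?_⟩
  rw [(hasGradientAt_iff_hasFDerivAt.1 (hf.1 x)).fderiv, ← NNReal.coe_le_coe, coe_nnnorm,
    LinearIsometryEquiv.norm_map]
  exact (hA x).trans (Real.le_coe_toNNReal A)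

/-- The bound on `F` serves twice: it makes `f`, and hence `φ' ∘ f`, Lipschitz, and it bounds the
second factor of the product. -/
theorem comp {φ φ' : ℝ → ℝ} {A B : ℝ} (hφ : ∀ x, HasDerivAt φ (φ' x) x)
    (hφ' : ∃ K : ℝ≥0, LipschitzWith K φ') (hB : ∀ x, |φ' x| ≤ B)
    (hf : HasLipschitzGradient f F) (hA : ∀ x, ‖F x‖ ≤ A) :
    HasLipschitzGradient (fun x => φ (f x)) fun x => φ' (f x) • F x := by
  refine ⟨fun x => hasGradientAt_comp (hφ _) (hf.1 x), ?_⟩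
  obtain ⟨K, hK⟩ := hf.lipschitz_of_bounded hA
  obtain ⟨J, hJ⟩ := hφ'
  exact lipschitz_smul ⟨_, hJ.comp hK⟩ hf.2 (fun x => hB _) hA

/-- The mean value inequality on the segment, where the gradient differs from `F x` by at most K‖y -
x‖. The sharp factor 1/2 is not needed. -/
theorem descent (hf : ∀ x, HasGradientAt f (F x) x) {K : ℝ≥0} (hK : LipschitzWith K F)
    (x y : E) : f y ≤ f x + inner ℝ (F x) (y - x) + K * ‖y - x‖ ^ 2 := by
  have h := (convex_segment (𝕜 := ℝ) x y).norm_image_sub_le_of_norm_hasFDerivWithin_le'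
    (f := f) (f' := fun z => (InnerProductSpace.toDual ℝ E) (F z))
    (φ := (InnerProductSpace.toDual ℝ E) (F x)) (C := K * ‖y - x‖)
    (fun z _ => (hasGradientAt_iff_hasFDerivAt.1 (hf z)).hasFDerivWithinAt)
    (fun z hz => by
      rw [← map_sub, LinearIsometryEquiv.norm_map, ← dist_eq_norm]
      refine (hK.dist_le_mul z x).trans (mul_le_mul_of_nonneg_left ?_ K.2)
      rw [dist_eq_norm]
      obtain ⟨a, b, ha, hb, hab, rfl⟩ := hz
      have : a • x + b • y - x = b • (y - x) := by
        rw [← eq_sub_iff_add_eq] at hab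
        rw [hab, sub_smul, smul_sub, one_smul]; abel
      rw [this, norm_smul, Real.norm_eq_abs, abs_of_nonneg hb]
      exact mul_le_of_le_one_left (norm_nonneg _) (by linarith))
    (left_mem_segment ℝ x y) (right_mem_segment ℝ x y)
  rw [InnerProductSpace.toDual_apply_apply, Real.norm_eq_abs] at h
  have := (abs_le.1 h).2
  nlinarith

end HasLipschitzGradient

end Gradient

/-! ### Extension along a tangent -/

/-- The function `φ` on `[a, ∞)`, continued to the left of `a` by its tangent of slope `c`. -/
def tangentExtension (a c : ℝ) (φ : ℝ → ℝ) (x : ℝ) : ℝ :=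
  if a ≤ x then φ x else φ a + c * (x - a)

theorem tangentExtension_of_le {a x : ℝ} (c : ℝ) (φ : ℝ → ℝ) (h : a ≤ x) :
    tangentExtension a c φ x = φ x := if_pos h

theorem tangentExtension_of_ge {a x : ℝ} (c : ℝ) (φ : ℝ → ℝ) (h : x ≤ a) :
    tangentExtension a c φ x = φ a + c * (x - a) := by
  rcases h.lt_or_eq with h | rfl
  · exact if_neg h.not_ge
  · simp [tangentExtension]

/-- The one-sided derivatives at `a` agree, so the pieces glue. The derivative is frozen at its
value in `a` to the left, hence bounds and Lipschitz estimates on [a, ∞) extend to the line. -/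
theorem hasDerivAt_tangentExtension {a : ℝ} {φ φ' : ℝ → ℝ}
    (hφ : ∀ x, a ≤ x → HasDerivAt φ (φ' x) x) (x : ℝ) :
    HasDerivAt (tangentExtension a (φ' a) φ) (φ' (max x a)) x := by
  have hr : ∀ y, a ≤ y → HasDerivWithinAt (tangentExtension a (φ' a) φ) (φ' y) (Set.Ici a) y :=
    fun y hy => (hφ y hy).hasDerivWithinAt.congr
      (fun z hz => tangentExtension_of_le _ _ hz) (tangentExtension_of_le _ _ hy)
  have hl : ∀ y, y ≤ a → HasDerivWithinAt (tangentExtension a (φ' a) φ) (φ' a) (Set.Iic a) y := by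
    intro y hy
    have : HasDerivAt (fun z => φ a + φ' a * (z - a)) (φ' a) y := by
      simpa using (((hasDerivAt_id y).sub_const a).const_mul (φ' a)).const_add (φ a)
    exact this.hasDerivWithinAt.congr
      (fun z hz => tangentExtension_of_ge _ _ hz) (tangentExtension_of_ge _ _ hy)
  rcases lt_trichotomy x a with h | rfl | h
  · rw [max_eq_right h.le]
    exact (hl x h.le).hasDerivAt (Iic_mem_nhds h)
  · rw [max_self]
    have := (hl x le_rfl).union (hr x le_rfl)
    rwa [Set.Iic_union_Ici, hasDerivWithinAt_univ] at this
  · rw [max_eq_left h.le]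
    exact (hr x h.le).hasDerivAt (Ici_mem_nhds h)

theorem abs_max_sub_max_le (x y a : ℝ) : |max x a - max y a| ≤ |x - y| := by
  simpa using abs_max_sub_max_le_max x a y a

theorem abs_inv_max_sub_inv_max_le {a : ℝ} (ha : 0 < a) (x y : ℝ) :
    |(max x a)⁻¹ - (max y a)⁻¹| ≤ a⁻¹ ^ 2 * |x - y| := by
  have hx : a ≤ max x a := le_max_right _ _
  have hy : a ≤ max y a := le_max_right _ _
  have hx0 := ha.trans_le hx
  have hy0 := ha.trans_le hy
  rw [inv_sub_inv hx0.ne' hy0.ne', abs_div, abs_sub_comm, abs_of_pos (mul_pos hx0 hy0), inv_pow,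
    div_eq_inv_mul]
  refine mul_le_mul ?_ (abs_max_sub_max_le x y a) (abs_nonneg _) (by positivity)
  rw [sq]
  gcongr

/-- The function `-log` on `[a, ∞)`, continued by its tangent. -/
def negLogExtension (a : ℝ) : ℝ → ℝ := tangentExtension a (-a⁻¹) fun x => -Real.log x

theorem hasDerivAt_negLogExtension {a : ℝ} (ha : 0 < a) (x : ℝ) :
    HasDerivAt (negLogExtension a) (-(max x a)⁻¹) x :=
  hasDerivAt_tangentExtension (φ' := fun x => -x⁻¹)
    (fun _ hx => (Real.hasDerivAt_log (ha.trans_le hx).ne').neg) x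

theorem negLogExtension_of_le {a x : ℝ} (h : a ≤ x) : negLogExtension a x = -Real.log x :=
  tangentExtension_of_le _ _ h

/-- Turns an upper bound for the expected likelihood into a lower bound for the loss. -/
theorem antitone_negLogExtension {a : ℝ} (ha : 0 < a) : Antitone (negLogExtension a) := by
  refine antitone_of_deriv_nonpos (fun x => (hasDerivAt_negLogExtension ha x).differentiableAt)
    fun x => ?_
  rw [(hasDerivAt_negLogExtension ha x).deriv]
  have := ha.trans_le (le_max_right x a)
  simpa using this.le

theorem lipschitz_deriv_negLogExtension {a : ℝ} (ha : 0 < a) :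
    ∃ K : ℝ≥0, LipschitzWith K fun x => -(max x a)⁻¹ := by
  refine lipschitz_of_norm_sub_le (K := a⁻¹ ^ 2) fun x y => ?_
  have := abs_inv_max_sub_inv_max_le ha y x
  rw [Real.norm_eq_abs, Real.norm_eq_abs, neg_sub_neg, abs_sub_comm x y]
  exact this

theorem abs_deriv_negLogExtension_le {a : ℝ} (ha : 0 < a) (x : ℝ) : |-(max x a)⁻¹| ≤ a⁻¹ := by
  have := le_max_right x a
  rw [abs_neg, abs_of_nonneg (inv_nonneg.2 (ha.le.trans this))]
  gcongr

/-- The square root on `[a, ∞)`, continued by its tangent. -/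
def sqrtExtension (a : ℝ) : ℝ → ℝ := tangentExtension a (1 / (2 * √a)) Real.sqrt

theorem hasDerivAt_sqrtExtension {a : ℝ} (ha : 0 < a) (x : ℝ) :
    HasDerivAt (sqrtExtension a) (1 / (2 * √(max x a))) x :=
  hasDerivAt_tangentExtension (φ' := fun x => 1 / (2 * √x))
    (fun _ hx => Real.hasDerivAt_sqrt (ha.trans_le hx).ne') x

theorem sqrtExtension_of_le {a x : ℝ} (h : a ≤ x) : sqrtExtension a x = √x :=
  tangentExtension_of_le _ _ h

/-- The estimate for reciprocals above √a, combined with |√x - √y| ≤ |x - y| / √a above `a`, which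
comes from x - y = (√x - √y)(√x + √y). -/
theorem lipschitz_deriv_sqrtExtension {a : ℝ} (ha : 0 < a) :
    ∃ K : ℝ≥0, LipschitzWith K fun x => 1 / (2 * √(max x a)) := by
  have hs : 0 < √a := Real.sqrt_pos.2 ha
  refine lipschitz_of_norm_sub_le (K := 1 / 2 * ((√a)⁻¹ ^ 2 * (√a)⁻¹)) fun x y => ?_
  have hmono : ∀ x, √(max x a) = max (√x) (√a) := fun x =>
    (Real.sqrt_monotone.map_max (a := x) (b := a))
  have e : 1 / (2 * √(max x a)) - 1 / (2 * √(max y a)) =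
      1 / 2 * ((√(max x a))⁻¹ - (√(max y a))⁻¹) := by
    rw [one_div, one_div, mul_inv, mul_inv]; ring
  rw [e, Real.norm_eq_abs, abs_mul, abs_of_pos one_half_pos, mul_assoc]
  refine mul_le_mul_of_nonneg_left ?_ one_half_pos.le
  have h1 := abs_inv_max_sub_inv_max_le hs (√(max x a)) (√(max y a))
  rw [max_eq_left (Real.sqrt_le_sqrt (le_max_right x a)),
    max_eq_left (Real.sqrt_le_sqrt (le_max_right y a))] at h1
  refine h1.trans ?_
  rw [mul_assoc]
  refine mul_le_mul_of_nonneg_left ?_ (by positivity)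
  have hx : √a ≤ √(max x a) := Real.sqrt_le_sqrt (le_max_right x a)
  have hy : √a ≤ √(max y a) := Real.sqrt_le_sqrt (le_max_right y a)
  have h2 := abs_max_sub_max_le x y a
  have h3 : max x a - max y a = (√(max x a) - √(max y a)) * (√(max x a) + √(max y a)) := by
    have hx' := Real.mul_self_sqrt (ha.le.trans (le_max_right x a))
    have hy' := Real.mul_self_sqrt (ha.le.trans (le_max_right y a))
    linear_combination hy' - hx'
  rw [h3, abs_mul, abs_of_pos (by linarith : 0 < √(max x a) + √(max y a))] at h2
  rw [Real.norm_eq_abs, ← div_eq_inv_mul, le_div_iff₀ hs]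
  refine le_trans ?_ h2
  exact mul_le_mul_of_nonneg_left (by linarith) (abs_nonneg _)

theorem abs_deriv_sqrtExtension_le {a : ℝ} (ha : 0 < a) (x : ℝ) :
    |1 / (2 * √(max x a))| ≤ 1 / (2 * √a) := by
  have hs : 0 < √a := Real.sqrt_pos.2 ha
  have hx : √a ≤ √(max x a) := Real.sqrt_le_sqrt (le_max_right x a)
  rw [abs_of_nonneg (by positivity)]
  gcongr

/-! ### Gaussian expectations of smooth functions -/

theorem integrable_of_abs_le {α : Type*} [MeasurableSpace α] {μ : Measure α} [IsFiniteMeasure μ]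
    {f : α → ℝ} (hf : Measurable f) {A : ℝ} (hA : ∀ x, |f x| ≤ A) : Integrable f μ :=
  Integrable.of_bound hf.aestronglyMeasurable A (ae_of_all _ hA)

theorem integrable_id_stdGaussianReal : Integrable (fun x : ℝ => x) (gaussianReal 0 1) :=
  (memLp_id_gaussianReal (μ := 0) (v := 1) 1).integrable (by simp)

theorem integrable_mul_of_abs_le {f : ℝ → ℝ} (hf : Measurable f) {A : ℝ} (hA : ∀ x, |f x| ≤ A) :
    Integrable (fun x => f x * x) (gaussianReal 0 1) :=
  integrable_id_stdGaussianReal.bdd_mul hf.aestronglyMeasurable (ae_of_all _ hA)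

theorem integrable_gaussianReal_iff {f : ℝ → ℝ} :
    Integrable f (gaussianReal 0 1) ↔ Integrable fun x => gaussianPDFReal 0 1 x * f x := by
  rw [gaussianReal_of_var_ne_zero _ one_ne_zero,
    integrable_withDensity_iff_integrable_smul₀' (by fun_prop)
      (ae_of_all _ fun _ => gaussianPDF_lt_top)]
  simp [toReal_gaussianPDF]

theorem hasDerivAt_gaussianPDFReal (x : ℝ) :
    HasDerivAt (gaussianPDFReal 0 1) (-(gaussianPDFReal 0 1 x * x)) x := by
  have h : HasDerivAt (fun y : ℝ => (√(2 * Real.pi))⁻¹ * Real.exp (-y ^ 2 / 2))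
      ((√(2 * Real.pi))⁻¹ * (Real.exp (-x ^ 2 / 2) * (-(2 * x) / 2))) x := by
    have := (((hasDerivAt_pow 2 x).neg.div_const 2).exp).const_mul (√(2 * Real.pi))⁻¹
    simpa using this
  have e : gaussianPDFReal 0 1 = fun y : ℝ => (√(2 * Real.pi))⁻¹ * Real.exp (-y ^ 2 / 2) := by
    simp [gaussianPDFReal_def]
  rw [e]
  convert! h using 1
  ring

/-- **Stein's identity** for a bounded function with bounded derivative. -/
theorem integral_mul_id_gaussianReal {w w' : ℝ → ℝ} (hw : ∀ x, HasDerivAt w (w' x) x)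
    (hw' : Measurable w') {A A' : ℝ} (hA : ∀ x, |w x| ≤ A) (hA' : ∀ x, |w' x| ≤ A') :
    ∫ x, w x * x ∂gaussianReal 0 1 = ∫ x, w' x ∂gaussianReal 0 1 := by
  have hwm : Measurable w := (continuous_iff_continuousAt.2 fun x => (hw x).continuousAt).measurable
  have i1 := integrable_gaussianReal_iff.1 (integrable_mul_of_abs_le hwm hA)
  have i2 := integrable_gaussianReal_iff.1 (integrable_of_abs_le (μ := gaussianReal 0 1) hw' hA')
  have i3 := integrable_gaussianReal_iff.1 (integrable_of_abs_le (μ := gaussianReal 0 1) hwm hA)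
  -- Integration by parts on the line: the derivative of the density is -x times the density.
  have h := integral_mul_deriv_eq_deriv_mul_of_integrable (u := w) (v := gaussianPDFReal 0 1)
    (u' := w') (v' := fun x => -(gaussianPDFReal 0 1 x * x)) (fun x _ => hw x)
    (fun x _ => hasDerivAt_gaussianPDFReal x)
    (i1.neg.congr (ae_of_all _ fun x => by simp; ring))
    (i2.congr (ae_of_all _ fun x => by simp; ring))
    (i3.congr (ae_of_all _ fun x => by simp; ring))
  rw [integral_gaussianReal_eq_integral_smul one_ne_zero,
    integral_gaussianReal_eq_integral_smul one_ne_zero]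
  calc ∫ x, gaussianPDFReal 0 1 x • (w x * x)
      = -∫ x, w x * -(gaussianPDFReal 0 1 x * x) := by
        rw [← integral_neg]
        exact integral_congr_ae (ae_of_all _ fun x => by simp; ring)
    _ = ∫ x, w' x * gaussianPDFReal 0 1 x := by rw [h, neg_neg]
    _ = _ := integral_congr_ae (ae_of_all _ fun x => by simp; ring)

section Reparam

variable {u : ℝ → ℝ} {A₀ A₁ A₂ : ℝ}

/-- Differentiation under the integral, jointly in mean `p.1` and scale `p.2`, with the integrable
dominating function A₁(1 + |ε|). The scale may be zero or negative. -/
theorem hasFDerivAt_gaussianExpectation (hu : Differentiable ℝ u)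
    (h₀ : ∀ x, |u x| ≤ A₀) (h₁ : ∀ x, |deriv u x| ≤ A₁) (p : ℝ × ℝ) :
    HasFDerivAt (fun p : ℝ × ℝ => ∫ ε, u (p.2 * ε + p.1) ∂gaussianReal 0 1)
      ((∫ ε, deriv u (p.2 * ε + p.1) ∂gaussianReal 0 1) • ContinuousLinearMap.fst ℝ ℝ ℝ +
        (∫ ε, deriv u (p.2 * ε + p.1) * ε ∂gaussianReal 0 1) •
          ContinuousLinearMap.snd ℝ ℝ ℝ) p := by
  have hum := hu.continuous.measurable
  have hum' := measurable_deriv u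
  have j1 : Integrable (fun ε => deriv u (p.2 * ε + p.1)) (gaussianReal 0 1) :=
    integrable_of_abs_le (by fun_prop) fun x => h₁ _
  have j2 : Integrable (fun ε => deriv u (p.2 * ε + p.1) * ε) (gaussianReal 0 1) :=
    integrable_mul_of_abs_le (f := fun ε => deriv u (p.2 * ε + p.1)) (by fun_prop) fun x => h₁ _
  have h := hasFDerivAt_integral_of_dominated_of_fderiv_le (μ := gaussianReal 0 1) (𝕜 := ℝ)
    (F := fun (p : ℝ × ℝ) ε => u (p.2 * ε + p.1)) (x₀ := p) (s := Set.univ)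
    (F' := fun p ε => deriv u (p.2 * ε + p.1) • (ContinuousLinearMap.fst ℝ ℝ ℝ) +
      (deriv u (p.2 * ε + p.1) * ε) • ContinuousLinearMap.snd ℝ ℝ ℝ)
    (bound := fun ε => A₁ * (1 + |ε|)) univ_mem
    (Eventually.of_forall fun q =>
      (by fun_prop : Measurable fun ε => u (q.2 * ε + q.1)).aestronglyMeasurable)
    (integrable_of_abs_le (by fun_prop) fun x => h₀ _)
    ((j1.aestronglyMeasurable.smul_const _).add (j2.aestronglyMeasurable.smul_const _))
    (ae_of_all _ fun ε q _ => by
      refine (norm_add_le _ _).trans ?_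
      rw [norm_smul, norm_smul, norm_mul, Real.norm_eq_abs, Real.norm_eq_abs]
      have e1 := ContinuousLinearMap.norm_fst_le ℝ ℝ ℝ
      have e2 := ContinuousLinearMap.norm_snd_le ℝ ℝ ℝ
      have e3 := h₁ (q.2 * ε + q.1)
      have := abs_nonneg (deriv u (q.2 * ε + q.1))
      calc _ ≤ |deriv u (q.2 * ε + q.1)| * 1 + |deriv u (q.2 * ε + q.1)| * |ε| * 1 := by gcongr
        _ = |deriv u (q.2 * ε + q.1)| * (1 + |ε|) := by ring
        _ ≤ _ := by gcongr)
    (((integrable_const _).add integrable_id_stdGaussianReal.abs).const_mul _)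
    (ae_of_all _ fun ε q _ => by
      have e : HasFDerivAt (fun q : ℝ × ℝ => q.2 * ε + q.1)
          (ε • ContinuousLinearMap.snd ℝ ℝ ℝ + ContinuousLinearMap.fst ℝ ℝ ℝ) q :=
        (hasFDerivAt_snd.mul_const ε).add hasFDerivAt_fst
      convert! (hu (q.2 * ε + q.1)).hasDerivAt.comp_hasFDerivAt q e using 1
      rw [smul_add, smul_smul, add_comm])
  convert! h using 1
  rw [integral_add (j1.smul_const _) (j2.smul_const _), integral_smul_const, integral_smul_const]

variable {E : Type*} [NormedAddCommGroup E] [InnerProductSpace ℝ E] [CompleteSpace E]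

theorem hasGradientAt_gaussianExpectation (hu : Differentiable ℝ u)
    (h₀ : ∀ x, |u x| ≤ A₀) (h₁ : ∀ x, |deriv u x| ≤ A₁) {m σ : E → ℝ} {a b x : E}
    (hm : HasGradientAt m a x) (hσ : HasGradientAt σ b x) :
    HasGradientAt (fun y => ∫ ε, u (σ y * ε + m y) ∂gaussianReal 0 1)
      ((∫ ε, deriv u (σ x * ε + m x) ∂gaussianReal 0 1) • a +
        (∫ ε, deriv u (σ x * ε + m x) * ε ∂gaussianReal 0 1) • b) x := by
  rw [hasGradientAt_iff_hasFDerivAt] at *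
  have h := (hasFDerivAt_gaussianExpectation hu h₀ h₁ (m x, σ x)).comp x (hm.prodMk hσ)
  rw [map_add, map_smulₛₗ, map_smulₛₗ]
  convert! h using 1

theorem abs_deriv_sub_le {w : ℝ → ℝ} (hw : Differentiable ℝ w) (h : ∀ x, |deriv w x| ≤ A₂)
    (x y : ℝ) : |w x - w y| ≤ A₂ * |x - y| :=
  Convex.norm_image_sub_le_of_norm_deriv_le (s := Set.univ) (fun z _ => hw z)
    (fun z _ => h z) convex_univ trivial trivial

theorem abs_integral_le {f : ℝ → ℝ} {A : ℝ} (h : ∀ x, |f x| ≤ A) :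
    |∫ x, f x ∂gaussianReal 0 1| ≤ A := by
  simpa using norm_integral_le_of_norm_le_const (μ := gaussianReal 0 1) (f := f) (ae_of_all _ h)

theorem abs_integral_mul_id_le {f : ℝ → ℝ} {A : ℝ} (h : ∀ x, |f x| ≤ A) :
    |∫ x, f x * x ∂gaussianReal 0 1| ≤ A * ∫ x, |x| ∂gaussianReal 0 1 := by
  rw [← integral_const_mul, ← Real.norm_eq_abs]
  refine norm_integral_le_of_norm_le (integrable_id_stdGaussianReal.abs.const_mul A)
    (ae_of_all _ fun x => ?_)
  rw [Real.norm_eq_abs, abs_mul]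
  exact mul_le_mul_of_nonneg_right (h x) (abs_nonneg x)

/-- The expectation of `u (σ ε + m)` has a bounded Lipschitz gradient if `m` and `σ` have. -/
theorem hasLipschitzGradient_gaussianExpectation (hu : Differentiable ℝ u)
    (hu' : Differentiable ℝ (deriv u)) (h₀ : ∀ x, |u x| ≤ A₀) (h₁ : ∀ x, |deriv u x| ≤ A₁)
    (h₂ : ∀ x, |deriv (deriv u) x| ≤ A₂) {m σ : E → ℝ} {a b : E → E}
    (hm : HasLipschitzGradient m a) (hσ : HasLipschitzGradient σ b) {A B : ℝ}
    (hA : ∀ x, ‖a x‖ ≤ A) (hB : ∀ x, ‖b x‖ ≤ B) :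
    HasLipschitzGradient (fun y => ∫ ε, u (σ y * ε + m y) ∂gaussianReal 0 1)
      (fun x => (∫ ε, deriv u (σ x * ε + m x) ∂gaussianReal 0 1) • a x +
        (∫ ε, deriv u (σ x * ε + m x) * ε ∂gaussianReal 0 1) • b x) := by
  refine ⟨fun x => hasGradientAt_gaussianExpectation hu h₀ h₁ (hm.1 x) (hσ.1 x), ?_⟩
  have hum' := measurable_deriv u
  have i1 : ∀ x, Integrable (fun ε => deriv u (σ x * ε + m x)) (gaussianReal 0 1) := fun x =>
    integrable_of_abs_le (by fun_prop) fun x => h₁ _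
  have i2 : ∀ x, Integrable (fun ε => deriv u (σ x * ε + m x) * ε) (gaussianReal 0 1) := fun x =>
    integrable_mul_of_abs_le (f := fun ε => deriv u (σ x * ε + m x)) (by fun_prop) fun x => h₁ _
  have hA₂ : 0 ≤ A₂ := (abs_nonneg _).trans (h₂ 0)
  obtain ⟨K, hK⟩ := hm.lipschitz_of_bounded hA
  obtain ⟨J, hJ⟩ := hσ.lipschitz_of_bounded hB
  -- A pointwise Lipschitz bound that grows linearly in |ε|. Integrating it against 1 and against
  -- |ε| uses the first and second Gaussian moments.
  have hstep : ∀ x y ε, |deriv u (σ x * ε + m x) - deriv u (σ y * ε + m y)| ≤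
      A₂ * (J * |ε| + K) * ‖x - y‖ := by
    intro x y ε
    refine (abs_deriv_sub_le hu' h₂ _ _).trans ?_
    rw [mul_assoc]
    refine mul_le_mul_of_nonneg_left ?_ hA₂
    have e : σ x * ε + m x - (σ y * ε + m y) = (σ x - σ y) * ε + (m x - m y) := by ring
    have e1 := hK.dist_le_mul x y
    have e2 := hJ.dist_le_mul x y
    rw [Real.dist_eq, dist_eq_norm] at e1 e2
    rw [e]
    refine (abs_add_le _ _).trans ?_
    rw [abs_mul]
    have := mul_le_mul_of_nonneg_right e2 (abs_nonneg ε)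
    linarith
  have iabs := integrable_id_stdGaussianReal.abs
  have isq : Integrable (fun x : ℝ => x ^ 2) (gaussianReal 0 1) :=
    (memLp_id_gaussianReal (μ := 0) (v := 1) 2).integrable_sq
  have l1 : ∃ K : ℝ≥0, LipschitzWith K fun x =>
      ∫ ε, deriv u (σ x * ε + m x) ∂gaussianReal 0 1 := by
    refine lipschitz_of_norm_sub_le (K := ∫ ε, A₂ * (J * |ε| + K) ∂gaussianReal 0 1) fun x y => ?_
    rw [← integral_sub (i1 x) (i1 y), ← integral_mul_const]
    refine norm_integral_le_of_norm_le ?_ (ae_of_all _ fun ε => hstep x y ε)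
    exact (((iabs.const_mul _).add (integrable_const _)).const_mul _).mul_const _
  have l2 : ∃ K : ℝ≥0, LipschitzWith K fun x =>
      ∫ ε, deriv u (σ x * ε + m x) * ε ∂gaussianReal 0 1 := by
    refine lipschitz_of_norm_sub_le
      (K := ∫ ε, A₂ * (J * ε ^ 2 + K * |ε|) ∂gaussianReal 0 1) fun x y => ?_
    rw [← integral_sub (i2 x) (i2 y), ← integral_mul_const]
    refine norm_integral_le_of_norm_le ?_ (ae_of_all _ fun ε => ?_)
    · exact (((isq.const_mul _).add (iabs.const_mul _)).const_mul _).mul_const _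
    · rw [← sub_mul, norm_mul, Real.norm_eq_abs, Real.norm_eq_abs]
      refine (mul_le_mul_of_nonneg_right (hstep x y ε) (abs_nonneg ε)).trans_eq ?_
      rw [← sq_abs ε]
      ring
  obtain ⟨N₁, hN₁⟩ := lipschitz_smul l1 hm.2 (fun x => abs_integral_le fun ε => h₁ _) hA
  obtain ⟨N₂, hN₂⟩ := lipschitz_smul l2 hσ.2 (fun x => abs_integral_mul_id_le fun ε => h₁ _) hB
  exact ⟨_, hN₁.add hN₂⟩

theorem norm_gradient_gaussianExpectation_le {F : Type*} [NormedAddCommGroup F]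
    [NormedSpace ℝ F] (h₁ : ∀ x, |deriv u x| ≤ A₁) {s μ : ℝ} {a b : F}
    {A B : ℝ} (hA : ‖a‖ ≤ A) (hB : ‖b‖ ≤ B) :
    ‖(∫ ε, deriv u (s * ε + μ) ∂gaussianReal 0 1) • a +
        (∫ ε, deriv u (s * ε + μ) * ε ∂gaussianReal 0 1) • b‖ ≤
      A₁ * A + A₁ * (∫ x, |x| ∂gaussianReal 0 1) * B := by
  refine (norm_add_le _ _).trans ?_
  rw [norm_smul, norm_smul, Real.norm_eq_abs, Real.norm_eq_abs]
  have hA₁ : 0 ≤ A₁ := (abs_nonneg _).trans (h₁ 0)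
  have : 0 ≤ ∫ x, |x| ∂gaussianReal 0 1 := integral_nonneg fun x => abs_nonneg x
  refine add_le_add ?_ ?_
  · exact mul_le_mul (abs_integral_le fun ε => h₁ _) hA (norm_nonneg _) hA₁
  · exact mul_le_mul (abs_integral_mul_id_le fun ε => h₁ _) hB (norm_nonneg _) (by positivity)

/-- Stein's identity, with `s` coming from the chain rule. Since the gradient of a standard
deviation σ is that of σ² divided by 2σ, this factor cancels the denominator and leaves Eφ''/2. -/
theorem integral_deriv_mul_id (hu' : Differentiable ℝ (deriv u)) (h₁ : ∀ x, |deriv u x| ≤ A₁)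
    (h₂ : ∀ x, |deriv (deriv u) x| ≤ A₂) (s μ : ℝ) :
    ∫ ε, deriv u (s * ε + μ) * ε ∂gaussianReal 0 1 =
      s * ∫ ε, deriv (deriv u) (s * ε + μ) ∂gaussianReal 0 1 := by
  have hum'' := measurable_deriv (deriv u)
  rw [← integral_const_mul]
  refine integral_mul_id_gaussianReal (w := fun ε => deriv u (s * ε + μ)) (A' := |s| * A₂)
    (fun ε => ?_) (by fun_prop) (fun ε => h₁ _) (fun ε => ?_)
  · have e : HasDerivAt (fun ε => s * ε + μ) s ε := by
      simpa using ((hasDerivAt_id ε).const_mul s).add_const μ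
    rw [mul_comm]
    exact (hu' (s * ε + μ)).hasDerivAt.comp ε e
  · rw [abs_mul]
    exact mul_le_mul_of_nonneg_left (h₂ _) (abs_nonneg s)

end Reparam

/-! ### The parameter space -/

section Param

variable {d : ℕ}

@[simp] theorem mean_pack (u : Fin d → ℝ) (W : Matrix (Fin d) (Fin d) ℝ) :
    (mean (pack u W)).ofLp = u := rfl

@[simp] theorem cov_pack (u : Fin d → ℝ) (W : Matrix (Fin d) (Fin d) ℝ) :
    cov (pack u W) = W := rfl

@[simp] theorem pack_mean_cov (r : Param d) : pack (mean r).ofLp (cov r) = r := by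
  ext j
  rcases j with j | ⟨j, k⟩ <;> rfl

theorem pack_add (u u' : Fin d → ℝ) (W W' : Matrix (Fin d) (Fin d) ℝ) :
    pack (u + u') (W + W') = pack u W + pack u' W' := by
  ext j
  rcases j with j | ⟨j, k⟩ <;> rfl

theorem pack_sub (u u' : Fin d → ℝ) (W W' : Matrix (Fin d) (Fin d) ℝ) :
    pack (u - u') (W - W') = pack u W - pack u' W' := by
  ext j
  rcases j with j | ⟨j, k⟩ <;> rfl

theorem pack_smul (c : ℝ) (u : Fin d → ℝ) (W : Matrix (Fin d) (Fin d) ℝ) :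
    pack (c • u) (c • W) = c • pack u W := by
  ext j
  rcases j with j | ⟨j, k⟩ <;> rfl

@[simp] theorem pack_zero : pack (0 : Fin d → ℝ) 0 = 0 := by
  ext j
  rcases j with j | ⟨j, k⟩ <;> rfl

theorem pack_smul_smul (x y : ℝ) (u : Fin d → ℝ) (W : Matrix (Fin d) (Fin d) ℝ) :
    pack (x • u) (y • W) = x • pack u 0 + y • pack 0 W := by
  rw [← pack_smul, ← pack_smul, ← pack_add]
  simp

theorem mean_sub (x y : Param d) : (mean (x - y)).ofLp = (mean x).ofLp - (mean y).ofLp := rfl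

theorem cov_sub (x y : Param d) : cov (x - y) = cov x - cov y := rfl

theorem cov_add (x y : Param d) : cov (x + y) = cov x + cov y := rfl

theorem cov_smul (c : ℝ) (x : Param d) : cov (c • x) = c • cov x := rfl

/-- The Euclidean inner product of matrix entries is the trace form, so gradients in V become matrix
algebra. -/
theorem inner_pack (u : Fin d → ℝ) (W : Matrix (Fin d) (Fin d) ℝ) (r : Param d) :
    inner ℝ (pack u W) r = u ⬝ᵥ (mean r).ofLp + (Wᵀ * cov r).trace := by
  rw [PiLp.inner_apply, Fintype.sum_sum_type, Fintype.sum_prod_type]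
  simp only [Matrix.trace, Matrix.diag, Matrix.mul_apply, dotProduct, Matrix.transpose_apply]
  rw [Finset.sum_comm (f := fun x y => W y x * cov r y x)]
  simp [pack, mean, cov, mul_comm]

theorem norm_sq_pack (u : Fin d → ℝ) (W : Matrix (Fin d) (Fin d) ℝ) :
    ‖pack u W‖ ^ 2 = u ⬝ᵥ u + (Wᵀ * W).trace := by
  rw [← real_inner_self_eq_norm_sq, inner_pack, mean_pack, cov_pack]

theorem norm_sq_eq_mean_cov (r : Param d) :
    ‖r‖ ^ 2 = (mean r).ofLp ⬝ᵥ (mean r).ofLp + ((cov r)ᵀ * cov r).trace := by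
  conv_lhs => rw [← pack_mean_cov r]
  exact norm_sq_pack _ _

theorem continuous_cov : Continuous (cov : Param d → Matrix (Fin d) (Fin d) ℝ) :=
  continuous_matrix fun j k => by
    simp only [cov, Matrix.of_apply]
    fun_prop

end Param

/-! ### The predictive mean and variance, and the extension of the expected likelihood. -/

namespace Model

variable {n d : ℕ} (M : Model n d)

theorem latentMean_eq_inner (i : Fin n) (r : Param d) :
    M.latentMean i r = inner ℝ (pack (M.a₁ i) 0) r + M.b₁ i := by
  simp [latentMean, inner_pack]

theorem latentVar_eq_inner (i : Fin n) (r : Param d) :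
    M.latentVar i r = inner ℝ (pack 0 (Matrix.vecMulVec (M.a₂ i) (M.a₂ i))) r + M.b₂ i := by
  rw [latentVar, inner_pack, Matrix.transpose_vecMulVec, Matrix.vecMulVec_mul, Matrix.trace_vecMulVec,
    Matrix.dotProduct_mulVec, dotProduct_comm]
  simp

theorem hasLipschitzGradient_latentMean (i : Fin n) :
    HasLipschitzGradient (M.latentMean i) fun _ => pack (M.a₁ i) 0 := by
  rw [funext (M.latentMean_eq_inner i)]
  exact ⟨hasGradientAt_inner_add_const _ _, 0, LipschitzWith.const _⟩

theorem hasLipschitzGradient_latentVar (i : Fin n) :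
    HasLipschitzGradient (M.latentVar i)
      fun _ => pack 0 (Matrix.vecMulVec (M.a₂ i) (M.a₂ i)) := by
  rw [funext (M.latentVar_eq_inner i)]
  exact ⟨hasGradientAt_inner_add_const _ _, 0, LipschitzWith.const _⟩

theorem continuous_latentMean (i : Fin n) : Continuous (M.latentMean i) := by
  rw [funext (M.latentMean_eq_inner i)]; fun_prop

theorem continuous_latentVar (i : Fin n) : Continuous (M.latentVar i) := by
  rw [funext (M.latentVar_eq_inner i)]; fun_prop

/-- Supplies the threshold below which the square root is replaced by its tangent. -/
theorem latentVar_ge {v : ℝ} (i : Fin n) {r : Param d}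
    (h : (cov r - v • (1 : Matrix (Fin d) (Fin d) ℝ)).PosSemidef) :
    v * (M.a₂ i ⬝ᵥ M.a₂ i) + M.b₂ i ≤ M.latentVar i r := by
  have := h.dotProduct_mulVec_nonneg (M.a₂ i)
  rw [Matrix.sub_mulVec, dotProduct_sub, Matrix.smul_mulVec, Matrix.one_mulVec, dotProduct_smul]
    at this
  simp only [star_trivial, smul_eq_mul] at this
  rw [latentVar]
  linarith

/-- The assumed bounds concern only the values of `g`. Unless both vectors vanish these fill the
line: move m along a₁ with ε = 0, or choose V with unit variance and vary ε. So the bounds hold for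
the likelihood itself. -/
theorem exists_g_eq (i : Fin n) (h : M.a₁ i ≠ 0 ∨ M.a₂ i ≠ 0) (x : ℝ) :
    ∃ r ε, M.g i r ε = x := by
  by_cases h1 : M.a₁ i = 0
  · have h2 : M.a₂ i ⬝ᵥ M.a₂ i ≠ 0 := by simpa [h1] using h
    refine ⟨pack 0 (((1 - M.b₂ i) / (M.a₂ i ⬝ᵥ M.a₂ i)) • 1), x - M.b₁ i, ?_⟩
    simp [g, latentMean, latentVar, h1, Matrix.smul_mulVec, h2]
  · have h2 : M.a₁ i ⬝ᵥ M.a₁ i ≠ 0 := by simpa using h1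
    refine ⟨pack (((x - M.b₁ i) / (M.a₁ i ⬝ᵥ M.a₁ i)) • M.a₁ i) 0, 0, ?_⟩
    simp [g, latentMean, h2]

variable {M}

theorem DerivBounds.lik_mem {B b' B' b'' B'' : ℝ} (hb : M.DerivBounds B b' B' b'' B'') {i : Fin n}
    (h : M.a₁ i ≠ 0 ∨ M.a₂ i ≠ 0) (x : ℝ) :
    (0 ≤ M.lik i x ∧ M.lik i x ≤ B) ∧ |deriv (M.lik i) x| ≤ max |b'| |B'| ∧
      |deriv (deriv (M.lik i)) x| ≤ max |b''| |B''| := by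
  obtain ⟨r, ε, rfl⟩ := M.exists_g_eq i h x
  obtain ⟨h0, h1, h2⟩ := hb i r ε
  exact ⟨h0, abs_le_max_abs_abs h1.1 h1.2, abs_le_max_abs_abs h2.1 h2.2⟩

/-- On the parameters with `V ⪰ v I`, `Eφ` agrees together with its gradient with a function on the
whole parameter space that has a bounded Lipschitz gradient. -/
theorem exists_extension_Eφ (hb₂ : ∀ i, 0 ≤ M.b₂ i)
    (hlik : ∀ i, Differentiable ℝ (M.lik i)) (hlik' : ∀ i, Differentiable ℝ (deriv (M.lik i)))
    {B b' B' b'' B'' : ℝ} (hb : M.DerivBounds B b' B' b'' B'') {v : ℝ} (hv : 0 < v) (i : Fin n) :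
    ∃ (Φ : Param d → ℝ) (D : Param d → Param d) (A : ℝ), HasLipschitzGradient Φ D ∧
      (∀ x, ‖D x‖ ≤ A) ∧ (∀ x, Φ x ≤ B) ∧
      ∀ x, (cov x - v • (1 : Matrix (Fin d) (Fin d) ℝ)).PosSemidef →
        Φ x = M.Eφ i x ∧ HasGradientAt (M.Eφ i) (D x) x ∧
        D x = pack (M.Eφ' i x • M.a₁ i)
          (M.Eφ'' i x • ((1 / 2 : ℝ) • Matrix.vecMulVec (M.a₂ i) (M.a₂ i))) := by
  by_cases h0 : M.a₁ i = 0 ∧ M.a₂ i = 0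
  -- Here `g` does not depend on r, so nothing is known about the likelihood off its range; but `Eφ`
  -- is constant.
  · obtain ⟨h1, h2⟩ := h0
    have hg : ∀ r ε, M.g i r ε = M.g i 0 ε := by
      intro r ε
      simp [g, latentMean, latentVar, h1, h2]
    have hE : ∀ r, M.Eφ i r = M.Eφ i 0 := by
      intro r
      simp only [Eφ, φ, hg r]
    refine ⟨fun _ => M.Eφ i 0, fun _ => 0, 0, HasLipschitzGradient.const _, by simp, fun _ => ?_,
      fun x _ => ⟨(hE x).symm, ?_, by simp [h1, h2]⟩⟩
    · have : M.Eφ i 0 ≤ ∫ _, B ∂gaussianReal 0 1 :=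
        integral_mono_of_nonneg (ae_of_all _ fun ε => (hb i 0 ε).1.1) (integrable_const _)
          (ae_of_all _ fun ε => (hb i 0 ε).1.2)
      simpa using this
    · rw [funext hE]
      exact hasGradientAt_const x _
  have hne : M.a₁ i ≠ 0 ∨ M.a₂ i ≠ 0 := by tauto
  have hu := hb.lik_mem hne
  have hu0 : ∀ x, |M.lik i x| ≤ B := fun x => by
    rw [abs_of_nonneg (hu x).1.1]
    exact (hu x).1.2
  have hm := M.hasLipschitzGradient_latentMean i
  -- It suffices to replace the standard deviation by some σ with bounded Lipschitz gradient b
  -- satisfying σ b = a₂a₂ᵀ/2 on the domain; Stein's identity then gives the gradient its stated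
  -- form.
  have key : ∀ (σ : Param d → ℝ) (b : Param d → Param d) (A : ℝ), HasLipschitzGradient σ b →
      (∀ x, ‖b x‖ ≤ A) → (∀ x, (cov x - v • (1 : Matrix (Fin d) (Fin d) ℝ)).PosSemidef →
        σ x = √(M.latentVar i x) ∧ HasGradientAt (fun x => √(M.latentVar i x)) (b x) x ∧
        √(M.latentVar i x) • b x =
          pack 0 ((1 / 2 : ℝ) • Matrix.vecMulVec (M.a₂ i) (M.a₂ i))) →
      ∃ (Φ : Param d → ℝ) (D : Param d → Param d) (A : ℝ), HasLipschitzGradient Φ D ∧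
      (∀ x, ‖D x‖ ≤ A) ∧ (∀ x, Φ x ≤ B) ∧
      ∀ x, (cov x - v • (1 : Matrix (Fin d) (Fin d) ℝ)).PosSemidef →
        Φ x = M.Eφ i x ∧ HasGradientAt (M.Eφ i) (D x) x ∧
        D x = pack (M.Eφ' i x • M.a₁ i)
          (M.Eφ'' i x • ((1 / 2 : ℝ) • Matrix.vecMulVec (M.a₂ i) (M.a₂ i))) := by
    intro σ b A hσ hA hx
    refine ⟨_, _, _, hasLipschitzGradient_gaussianExpectation (hlik i) (hlik' i) hu0
      (fun x => (hu x).2.1) (fun x => (hu x).2.2) hm hσ (fun _ => le_rfl) hA,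
      fun x => norm_gradient_gaussianExpectation_le (fun x => (hu x).2.1) le_rfl (hA x),
      fun x => ?_, fun x hdom => ?_⟩
    · have h := integral_mono_of_nonneg (μ := gaussianReal 0 1)
        (f := fun ε => M.lik i (σ x * ε + M.latentMean i x))
        (ae_of_all _ fun ε => (hu _).1.1) (integrable_const B) (ae_of_all _ fun ε => (hu _).1.2)
      simpa using h
    · obtain ⟨e, hd, hs⟩ := hx x hdom
      rw [e]
      refine ⟨rfl, ?_, ?_⟩
      · exact hasGradientAt_gaussianExpectation (hlik i) hu0 (fun x => (hu x).2.1) (hm.1 x) hd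
      · rw [integral_deriv_mul_id (hlik' i) (fun x => (hu x).2.1) (fun x => (hu x).2.2),
          mul_comm, mul_smul, hs, pack_smul_smul]
        rfl
  -- If a₂ = 0 the standard deviation is the constant √b₂, possibly zero, where the square root is
  -- not differentiable. Otherwise the variance is bounded away from zero.
  by_cases h2 : M.a₂ i = 0
  · have hV : ∀ x, M.latentVar i x = M.b₂ i := fun x => by simp [latentVar, h2]
    refine key (fun _ => √(M.b₂ i)) (fun _ => 0) 0 (HasLipschitzGradient.const _) (by simp)
      fun x _ => ⟨by rw [hV], ?_, by simp [h2]⟩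
    simp_rw [hV]
    exact hasGradientAt_const x _
  · have h2' : 0 < M.a₂ i ⬝ᵥ M.a₂ i := by simpa using Matrix.dotProduct_star_self_pos_iff.2 h2
    have hs₀ : 0 < v * (M.a₂ i ⬝ᵥ M.a₂ i) + M.b₂ i := by
      have := hb₂ i
      positivity
    have hW := M.hasLipschitzGradient_latentVar i
    refine key _ _ (1 / (2 * √(v * (M.a₂ i ⬝ᵥ M.a₂ i) + M.b₂ i)) *
        ‖pack 0 (Matrix.vecMulVec (M.a₂ i) (M.a₂ i))‖)
      (HasLipschitzGradient.comp (hasDerivAt_sqrtExtension hs₀)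
      (lipschitz_deriv_sqrtExtension hs₀) (abs_deriv_sqrtExtension_le hs₀) hW (fun _ => le_rfl))
      (fun x => ?_) fun x hx => ?_
    · rw [norm_smul]
      exact mul_le_mul_of_nonneg_right (abs_deriv_sqrtExtension_le hs₀ _) (norm_nonneg _)
    · have hle := M.latentVar_ge i hx
      have hpos := hs₀.trans_le hle
      rw [max_eq_left hle]
      refine ⟨sqrtExtension_of_le hle,
        hasGradientAt_comp (Real.hasDerivAt_sqrt hpos.ne') (hW.1 x), ?_⟩
      have hsq : √(M.latentVar i x) ≠ 0 := (Real.sqrt_pos.2 hpos).ne'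
      rw [smul_smul, show √(M.latentVar i x) * (1 / (2 * √(M.latentVar i x))) = 1 / 2 by
        field_simp, ← pack_smul, smul_zero]

/-- Dominated convergence. No extension is needed, as the square root is continuous everywhere. -/
theorem continuous_Eφ (hlik : ∀ i, Differentiable ℝ (M.lik i))
    {B b' B' b'' B'' : ℝ} (hb : M.DerivBounds B b' B' b'' B'') (i : Fin n) :
    Continuous (M.Eφ i) := by
  have h1 := M.continuous_latentMean i
  have h2 := M.continuous_latentVar i
  have h3 := (hlik i).continuous
  refine continuous_of_dominated (bound := fun _ => B) (fun r => ?_) (fun r => ?_)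
    (integrable_const B) (ae_of_all _ fun ε => ?_)
  · exact (by fun_prop : Continuous fun ε => M.lik i (√(M.latentVar i r) * ε +
      M.latentMean i r)).aestronglyMeasurable
  · refine ae_of_all _ fun ε => ?_
    rw [Real.norm_eq_abs, abs_of_nonneg (hb i r ε).1.1]
    exact (hb i r ε).1.2
  · exact (by fun_prop : Continuous fun r => M.lik i (√(M.latentVar i r) * ε +
      M.latentMean i r))

/-- Keeps limit points of the iterates in the set where ∇h agrees with the gradient of the
extension. Semidefiniteness is symmetry together with one closed inequality for each vector. -/
theorem isClosed_domain (hlik : ∀ i, Differentiable ℝ (M.lik i))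
    {B b' B' b'' B'' : ℝ} (hb : M.DerivBounds B b' B' b'' B'') (ζ v : ℝ) :
    IsClosed (M.domain ζ v) := by
  have e : M.domain ζ v = {r | (cov r - v • (1 : Matrix (Fin d) (Fin d) ℝ)).IsHermitian} ∩
      (⋂ x : Fin d → ℝ,
        {r | 0 ≤ x ⬝ᵥ (cov r - v • (1 : Matrix (Fin d) (Fin d) ℝ)) *ᵥ x}) ∩
      ⋂ i, {r | ζ ≤ M.Eφ i r} := by
    ext r
    simp [domain, Matrix.posSemidef_iff_dotProduct_mulVec]
  have hc := continuous_cov (d := d)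
  rw [e]
  refine (IsClosed.inter ?_ (isClosed_iInter fun x => ?_)).inter (isClosed_iInter fun i => ?_)
  · exact isClosed_eq (by fun_prop) (by fun_prop)
  · exact isClosed_le continuous_const (by fun_prop)
  · exact isClosed_le continuous_const (continuous_Eφ hlik hb i)

end Model

/-! ### Spectral functions of symmetric matrices -/

section Spectral

variable {d : ℕ} {A B : Matrix (Fin d) (Fin d) ℝ}

/-- The matrix with the eigenvectors of `A` and with `φ` applied to its eigenvalues. -/
def spectralFun (hA : A.IsHermitian) (φ : ℝ → ℝ) : Matrix (Fin d) (Fin d) ℝ :=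
  (hA.eigenvectorUnitary : Matrix (Fin d) (Fin d) ℝ) * Matrix.diagonal (φ ∘ hA.eigenvalues) *
    (hA.eigenvectorUnitary : Matrix (Fin d) (Fin d) ℝ)ᵀ

theorem transpose_mul_eigenvectorUnitary (hA : A.IsHermitian) :
    (hA.eigenvectorUnitary : Matrix (Fin d) (Fin d) ℝ)ᵀ *
      (hA.eigenvectorUnitary : Matrix (Fin d) (Fin d) ℝ) = 1 := by
  simpa [Matrix.star_eq_conjTranspose] using Unitary.coe_star_mul_self hA.eigenvectorUnitary

theorem eigenvectorUnitary_mul_transpose (hA : A.IsHermitian) :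
    (hA.eigenvectorUnitary : Matrix (Fin d) (Fin d) ℝ) *
      (hA.eigenvectorUnitary : Matrix (Fin d) (Fin d) ℝ)ᵀ = 1 := by
  simpa [Matrix.star_eq_conjTranspose] using Unitary.coe_mul_star_self hA.eigenvectorUnitary

theorem spectralFun_id (hA : A.IsHermitian) : spectralFun hA (fun x => x) = A := by
  conv_rhs => rw [hA.spectral_theorem, Unitary.conjStarAlgAut_apply]
  simp [spectralFun, Matrix.star_eq_conjTranspose, Function.comp_def]

theorem transpose_spectralFun (hA : A.IsHermitian) (φ : ℝ → ℝ) :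
    (spectralFun hA φ)ᵀ = spectralFun hA φ := by
  simp [spectralFun, Matrix.mul_assoc]

theorem spectralFun_mul (hA : A.IsHermitian) (φ χ : ℝ → ℝ) :
    spectralFun hA φ * spectralFun hA χ = spectralFun hA fun x => φ x * χ x := by
  have h := transpose_mul_eigenvectorUnitary hA
  set U : Matrix (Fin d) (Fin d) ℝ := hA.eigenvectorUnitary.1
  calc U * Matrix.diagonal (φ ∘ hA.eigenvalues) * Uᵀ *
        (U * Matrix.diagonal (χ ∘ hA.eigenvalues) * Uᵀ)
      = U * Matrix.diagonal (φ ∘ hA.eigenvalues) * (Uᵀ * U) *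
        Matrix.diagonal (χ ∘ hA.eigenvalues) * Uᵀ := by simp only [Matrix.mul_assoc]
    _ = _ := by
      rw [h, Matrix.mul_one, Matrix.mul_assoc U, Matrix.diagonal_mul_diagonal]
      rfl

theorem trace_spectralFun (hA : A.IsHermitian) (φ : ℝ → ℝ) :
    (spectralFun hA φ).trace = ∑ i, φ (hA.eigenvalues i) := by
  rw [spectralFun, Matrix.trace_mul_comm, ← Matrix.mul_assoc, transpose_mul_eigenvectorUnitary,
    Matrix.one_mul, Matrix.trace_diagonal]
  rfl

theorem spectralFun_congr (hA : A.IsHermitian) {φ χ : ℝ → ℝ}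
    (h : ∀ i, φ (hA.eigenvalues i) = χ (hA.eigenvalues i)) :
    spectralFun hA φ = spectralFun hA χ := by
  rw [spectralFun, spectralFun, show φ ∘ hA.eigenvalues = χ ∘ hA.eigenvalues from funext h]

theorem spectralFun_const (hA : A.IsHermitian) (c : ℝ) :
    spectralFun hA (fun _ => c) = c • (1 : Matrix (Fin d) (Fin d) ℝ) := by
  have : Matrix.diagonal ((fun _ => c) ∘ hA.eigenvalues) =
      c • (1 : Matrix (Fin d) (Fin d) ℝ) := (Matrix.smul_one_eq_diagonal c).symm
  rw [spectralFun, this, Matrix.mul_smul, Matrix.mul_one, Matrix.smul_mul,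
    eigenvectorUnitary_mul_transpose]

/-- Only the values of `φ` at the eigenvalues matter, so a continuation of -1/x from [v, ∞) still
produces -A⁻¹ when all eigenvalues are at least v. -/
theorem spectralFun_eq_neg_inv (hA : A.IsHermitian) {φ : ℝ → ℝ}
    (h : ∀ i, φ (hA.eigenvalues i) * hA.eigenvalues i = -1) : spectralFun hA φ = -A⁻¹ := by
  have e := spectralFun_mul hA φ fun x => x
  rw [spectralFun_id, spectralFun_congr hA (φ := fun x => φ x * x) (χ := fun _ => -1) h,
    spectralFun_const, neg_one_smul] at e
  rw [Matrix.inv_eq_left_inv (B := -spectralFun hA φ) (by rw [Matrix.neg_mul, e, neg_neg]),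
    neg_neg]

/-- The traces of products of spectral functions of `A` and `B` are weighted by the squared inner
products of the eigenvectors, which form a doubly stochastic matrix. -/
theorem exists_trace_spectralFun_mul (hA : A.IsHermitian) (hB : B.IsHermitian) :
    ∃ p : Fin d → Fin d → ℝ, (∀ i j, 0 ≤ p i j) ∧ (∀ i, ∑ j, p i j = 1) ∧
      (∀ j, ∑ i, p i j = 1) ∧ ∀ φ χ : ℝ → ℝ,
      (spectralFun hA φ * spectralFun hB χ).trace =
        ∑ i, ∑ j, p i j * (φ (hA.eigenvalues i) * χ (hB.eigenvalues j)) := by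
  set U : Matrix (Fin d) (Fin d) ℝ := hA.eigenvectorUnitary.1 with hU
  set W : Matrix (Fin d) (Fin d) ℝ := hB.eigenvectorUnitary.1 with hW
  set O := Uᵀ * W with hO
  have h1 : O * Oᵀ = 1 := by
    rw [hO, Matrix.transpose_mul, Matrix.transpose_transpose, Matrix.mul_assoc,
      ← Matrix.mul_assoc W, eigenvectorUnitary_mul_transpose, Matrix.one_mul,
      transpose_mul_eigenvectorUnitary]
  have h2 : Oᵀ * O = 1 := by
    rw [hO, Matrix.transpose_mul, Matrix.transpose_transpose, Matrix.mul_assoc,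
      ← Matrix.mul_assoc U, eigenvectorUnitary_mul_transpose, Matrix.one_mul,
      transpose_mul_eigenvectorUnitary]
  refine ⟨fun i j => O i j ^ 2, fun i j => sq_nonneg _, fun i => ?_, fun j => ?_, fun φ χ => ?_⟩
  · have := congrFun (congrFun h1 i) i
    simpa [Matrix.mul_apply, sq] using this
  · have := congrFun (congrFun h2 j) j
    simpa [Matrix.mul_apply, sq] using this
  · have e : (spectralFun hA φ * spectralFun hB χ).trace =
        (Matrix.diagonal (φ ∘ hA.eigenvalues) * (O * Matrix.diagonal (χ ∘ hB.eigenvalues) *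
          Oᵀ)).trace := by
      rw [spectralFun, spectralFun, ← hU, ← hW, Matrix.mul_assoc U, Matrix.mul_assoc U,
        Matrix.trace_mul_comm, hO, Matrix.transpose_mul, Matrix.transpose_transpose]
      simp only [Matrix.mul_assoc]
    rw [e, Matrix.trace]
    refine Finset.sum_congr rfl fun i _ => ?_
    rw [Matrix.diag_apply, Matrix.diagonal_mul, Matrix.mul_apply, Finset.mul_sum]
    refine Finset.sum_congr rfl fun j _ => ?_
    rw [Matrix.mul_diagonal, Matrix.transpose_apply, Function.comp_apply, Function.comp_apply]
    ring

/-- **Klein's inequality**. -/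
theorem sum_add_trace_le (hA : A.IsHermitian) (hB : B.IsHermitian) {ψ ψ' : ℝ → ℝ}
    (h : ∀ x y, ψ x + ψ' x * (y - x) ≤ ψ y) :
    ∑ i, ψ (hA.eigenvalues i) + (spectralFun hA ψ' * (B - A)).trace ≤
      ∑ j, ψ (hB.eigenvalues j) := by
  obtain ⟨p, h0, h1, h2, hp⟩ := exists_trace_spectralFun_mul hA hB
  have eAB := hp ψ' fun x => x
  rw [spectralFun_id] at eAB
  have eAA : (spectralFun hA ψ' * A).trace = ∑ i, ψ' (hA.eigenvalues i) * hA.eigenvalues i := by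
    have e := spectralFun_mul hA ψ' fun x => x
    rw [spectralFun_id] at e
    rw [e, trace_spectralFun]
  -- Row and column sums equal to 1 turn single sums over eigenvalues into double sums with the
  -- weights p. What remains is the scalar tangent inequality for each pair of eigenvalues.
  have eA : ∀ φ : Fin d → ℝ, ∑ i, φ i = ∑ i, ∑ j, p i j * φ i := fun φ => by
    simp_rw [← Finset.sum_mul, h1, one_mul]
  have eB : ∀ φ : Fin d → ℝ, ∑ j, φ j = ∑ i, ∑ j, p i j * φ j := fun φ => by
    rw [Finset.sum_comm]
    simp_rw [← Finset.sum_mul, h2, one_mul]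
  rw [Matrix.mul_sub, Matrix.trace_sub, eAB, eAA, eA fun i => ψ' (hA.eigenvalues i) * _,
    eA fun i => ψ (hA.eigenvalues i), eB fun j => ψ (hB.eigenvalues j)]
  simp only [← Finset.sum_add_distrib, ← Finset.sum_sub_distrib]
  refine Finset.sum_le_sum fun i _ => Finset.sum_le_sum fun j _ => ?_
  have := mul_le_mul_of_nonneg_left (h (hA.eigenvalues i) (hB.eigenvalues j)) (h0 i j)
  linarith

/-- The squared Frobenius distance of φ(A) and φ(B) is the p-weighted sum of (φ(λ_i) - φ(μ_j))², so
a scalar Lipschitz constant carries over to matrices unchanged. -/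
theorem trace_spectralFun_sub_sq (hA : A.IsHermitian) (hB : B.IsHermitian) {φ : ℝ → ℝ} {K : ℝ}
    (hφ : ∀ x y, |φ x - φ y| ≤ K * |x - y|) :
    ((spectralFun hA φ - spectralFun hB φ) * (spectralFun hA φ - spectralFun hB φ)).trace ≤
      K ^ 2 * ((A - B) * (A - B)).trace := by
  obtain ⟨p, h0, h1, h2, hp⟩ := exists_trace_spectralFun_mul hA hB
  have eA : ∀ φ : Fin d → ℝ, ∑ i, φ i = ∑ i, ∑ j, p i j * φ i := fun φ => by
    simp_rw [← Finset.sum_mul, h1, one_mul]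
  have eB : ∀ φ : Fin d → ℝ, ∑ j, φ j = ∑ i, ∑ j, p i j * φ j := fun φ => by
    rw [Finset.sum_comm]
    simp_rw [← Finset.sum_mul, h2, one_mul]
  have key : ∀ φ : ℝ → ℝ, ((spectralFun hA φ - spectralFun hB φ) *
      (spectralFun hA φ - spectralFun hB φ)).trace =
      ∑ i, ∑ j, p i j * (φ (hA.eigenvalues i) - φ (hB.eigenvalues j)) ^ 2 := by
    intro φ
    rw [Matrix.sub_mul, Matrix.mul_sub, Matrix.mul_sub, Matrix.trace_sub, Matrix.trace_sub,
      Matrix.trace_sub, Matrix.trace_mul_comm (spectralFun hB φ) (spectralFun hA φ), hp,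
      spectralFun_mul, spectralFun_mul, trace_spectralFun, trace_spectralFun,
      eA fun i => φ (hA.eigenvalues i) * _, eB fun j => φ (hB.eigenvalues j) * _]
    simp only [← Finset.sum_sub_distrib]
    refine Finset.sum_congr rfl fun i _ => Finset.sum_congr rfl fun j _ => ?_
    ring
  have e := key fun x => x
  rw [spectralFun_id, spectralFun_id] at e
  rw [key, e, Finset.mul_sum]
  refine Finset.sum_le_sum fun i _ => ?_
  rw [Finset.mul_sum]
  refine Finset.sum_le_sum fun j _ => ?_
  rw [mul_left_comm]
  refine mul_le_mul_of_nonneg_left ?_ (h0 i j)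
  have := hφ (hA.eigenvalues i) (hB.eigenvalues j)
  rw [← sq_abs, ← sq_abs (hA.eigenvalues i - _), ← mul_pow]
  exact pow_le_pow_left₀ (abs_nonneg _) this 2

/-- In the two eigenbases the expression is a p-weighted sum of terms s x + ψ(x), with s an
eigenvalue of `B`. Only `B` has to be positive, so the bound is uniform over all symmetric A. -/
theorem exists_le_trace_mul_add_sum (hB : B.PosDef) {ψ : ℝ → ℝ}
    (hψ : ∀ s, 0 < s → ∃ c, ∀ x, c ≤ s * x + ψ x) :
    ∃ c, ∀ (A : Matrix (Fin d) (Fin d) ℝ) (hA : A.IsHermitian),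
      c ≤ (B * A).trace + ∑ i, ψ (hA.eigenvalues i) := by
  choose c hc using fun i => hψ (hB.1.eigenvalues i) (hB.eigenvalues_pos i)
  refine ⟨∑ i, c i, fun A hA => ?_⟩
  obtain ⟨p, h0, h1, h2, hp⟩ := exists_trace_spectralFun_mul hB.1 hA
  have e := hp (fun x => x) fun x => x
  rw [spectralFun_id, spectralFun_id] at e
  have eA : ∑ i, c i = ∑ i, ∑ j, p i j * c i := by
    simp_rw [← Finset.sum_mul, h1, one_mul]
  have eB : ∑ j, ψ (hA.eigenvalues j) = ∑ i, ∑ j, p i j * ψ (hA.eigenvalues j) := by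
    rw [Finset.sum_comm]
    simp_rw [← Finset.sum_mul, h2, one_mul]
  rw [e, eA, eB]
  simp only [← Finset.sum_add_distrib]
  refine Finset.sum_le_sum fun i _ => Finset.sum_le_sum fun j _ => ?_
  rw [← mul_add]
  exact mul_le_mul_of_nonneg_left (hc i _) (h0 i j)

end Spectral

/-! ### The log-determinant -/

section LogDet

variable {d : ℕ}

/-- The symmetric part of the matrix `V` of `r = (m, V)`. -/
def symmCov (r : Param d) : Matrix (Fin d) (Fin d) ℝ := (1 / 2 : ℝ) • (cov r + (cov r)ᵀ)

theorem isHermitian_symmCov (r : Param d) : (symmCov r).IsHermitian := by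
  rw [Matrix.IsHermitian, Matrix.conjTranspose_eq_transpose_of_trivial, symmCov,
    Matrix.transpose_smul, Matrix.transpose_add, Matrix.transpose_transpose, add_comm]

theorem symmCov_eq {r : Param d} (h : (cov r)ᵀ = cov r) : symmCov r = cov r := by
  rw [symmCov, h, ← two_smul ℝ, smul_smul]
  simp

theorem symmCov_sub (x y : Param d) : symmCov (x - y) = symmCov x - symmCov y := by
  simp only [symmCov, cov_sub, Matrix.transpose_sub, ← smul_sub]
  congr 1
  abel

theorem trace_mul_symmCov {G : Matrix (Fin d) (Fin d) ℝ} (hG : Gᵀ = G) (r : Param d) :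
    (G * symmCov r).trace = (G * cov r).trace := by
  have : (G * (cov r)ᵀ).trace = (G * cov r).trace := by
    rw [← Matrix.trace_transpose, Matrix.transpose_mul, Matrix.transpose_transpose, hG,
      Matrix.trace_mul_comm]
  rw [symmCov, Matrix.mul_smul, Matrix.mul_add, Matrix.trace_smul, Matrix.trace_add, this,
    smul_eq_mul]
  ring

/-- Symmetrization is an orthogonal projection: the squared norms of V and of its symmetric part
differ by ‖V - Vᵀ‖²/4. -/
theorem trace_symmCov_sq_le (r : Param d) : (symmCov r * symmCov r).trace ≤ ‖r‖ ^ 2 := by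
  have h1 : 0 ≤ (mean r).ofLp ⬝ᵥ (mean r).ofLp := by
    simpa using dotProduct_star_self_nonneg (mean r).ofLp
  have h2 : 0 ≤ ((cov r - (cov r)ᵀ)ᵀ * (cov r - (cov r)ᵀ)).trace := by
    simpa using (Matrix.posSemidef_conjTranspose_mul_self (cov r - (cov r)ᵀ)).trace_nonneg
  have h3 : ((cov r)ᵀ * (cov r)ᵀ).trace = (cov r * cov r).trace := by
    rw [← Matrix.transpose_mul, Matrix.trace_transpose]
  have h4 := Matrix.trace_mul_comm (cov r) (cov r)ᵀ
  rw [norm_sq_eq_mean_cov]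
  simp only [Matrix.transpose_sub, Matrix.transpose_transpose, Matrix.sub_mul, Matrix.mul_sub,
    Matrix.trace_sub] at h2
  simp only [symmCov, Matrix.smul_mul, Matrix.mul_smul, Matrix.add_mul, Matrix.mul_add,
    Matrix.trace_smul, Matrix.trace_add, smul_eq_mul]
  linarith

/-- Individual eigenvalues need not be differentiable where they cross. The subgradient criterion
avoids them: Klein's inequality gives the subgradient and the trace inequality its Lipschitz bound.
-/
theorem hasLipschitzGradient_sum_eigenvalues {ψ ψ' : ℝ → ℝ} {K : ℝ}
    (h : ∀ x y, ψ x + ψ' x * (y - x) ≤ ψ y) (hK : 0 ≤ K)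
    (hψ' : ∀ x y, |ψ' x - ψ' y| ≤ K * |x - y|) :
    HasLipschitzGradient (fun r : Param d => ∑ i, ψ ((isHermitian_symmCov r).eigenvalues i))
      fun r => pack 0 (spectralFun (isHermitian_symmCov r) ψ') := by
  refine HasLipschitzGradient.of_subgradient (K := K) (fun x y => ?_) fun x y => ?_
  · refine le_trans (le_of_eq ?_) (sum_add_trace_le (isHermitian_symmCov x)
      (isHermitian_symmCov y) h)
    rw [inner_pack, ← symmCov_sub, trace_mul_symmCov (transpose_spectralFun _ _),
      transpose_spectralFun]
    simp
  · rw [← pack_sub, sub_self]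
    refine abs_le_of_sq_le_sq' ?_ (by positivity) |>.2
    rw [norm_sq_pack, mul_pow, Matrix.transpose_sub, transpose_spectralFun, transpose_spectralFun,
      zero_dotProduct, zero_add]
    refine (trace_spectralFun_sub_sq _ _ hψ').trans ?_
    rw [← symmCov_sub]
    exact mul_le_mul_of_nonneg_left (trace_symmCov_sq_le _) (by positivity)

theorem differentiable_det_cov : Differentiable ℝ fun r : Param d => (cov r).det := by
  have : ContDiff ℝ 1 fun r : Param d => (cov r).det := by
    simp only [Matrix.det_apply, cov, Matrix.of_apply]
    exact ContDiff.sum fun σ _ => (contDiff_prod fun i _ => by fun_prop).const_smul _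
  exact this.differentiable one_ne_zero

/-- Jacobi's formula. The determinant is a polynomial, hence differentiable, and its derivative is
read off along lines from det(1 + tH) = 1 + t tr H + O(t²). -/
theorem hasGradientAt_det_cov {x : Param d} (hx : IsUnit (cov x).det) :
    HasGradientAt (fun r : Param d => (cov r).det)
      ((cov x).det • pack 0 ((cov x)⁻¹)ᵀ) x := by
  have hd := (differentiable_det_cov x).hasFDerivAt
  rw [hasGradientAt_iff_hasFDerivAt]
  convert! hd using 1
  refine ContinuousLinearMap.ext fun y => ?_
  have hline : HasDerivAt (fun t : ℝ => x + t • y) y 0 := by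
    simpa using ((hasDerivAt_id (0 : ℝ)).smul_const y).const_add x
  have h1 : HasDerivAt (fun t : ℝ => (cov (x + t • y)).det)
      (fderiv ℝ (fun r : Param d => (cov r).det) x y) 0 := by
    have hd' : HasFDerivAt (fun r : Param d => (cov r).det)
        (fderiv ℝ (fun r : Param d => (cov r).det) x) (x + (0 : ℝ) • y) := by simpa using hd
    exact hd'.comp_hasDerivAt (0 : ℝ) hline
  set H := (cov x)⁻¹ * cov y with hH
  set q := (Matrix.det (1 + (Polynomial.X : Polynomial ℝ) • H.map Polynomial.C)).divX.divX
  have e : ∀ t : ℝ, (cov (x + t • y)).det =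
      (cov x).det * (1 + H.trace * t + q.eval t * t ^ 2) := by
    intro t
    rw [← Matrix.det_one_add_smul, ← Matrix.det_mul, Matrix.mul_add, Matrix.mul_one,
      Matrix.mul_smul, hH, ← Matrix.mul_assoc, Matrix.mul_nonsing_inv _ hx, Matrix.one_mul,
      cov_add, cov_smul]
  have h2 : HasDerivAt (fun t : ℝ => (cov (x + t • y)).det) ((cov x).det * H.trace) 0 := by
    rw [funext e]
    have := ((((hasDerivAt_id (0 : ℝ)).const_mul H.trace).const_add 1).add
      ((q.hasDerivAt 0).mul (hasDerivAt_pow 2 0))).const_mul (cov x).det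
    simpa using this
  rw [h1.unique h2, InnerProductSpace.toDual_apply_apply, inner_smul_left, inner_pack]
  simp [hH]

/-- Perturbations of V here include non-symmetric ones, to which the extension, a function of the
symmetric part, is blind. So this gradient is computed independently. -/
theorem hasGradientAt_neg_log_det_cov {x : Param d} (hx : (cov x).PosDef) :
    HasGradientAt (fun r : Param d => -Real.log (cov r).det) (-pack 0 (cov x)⁻¹) x := by
  have hpos := hx.det_pos
  have h := hasGradientAt_comp (f := fun r : Param d => (cov r).det) (φ := fun y => -Real.log y)
    (Real.hasDerivAt_log hpos.ne').neg
    (hasGradientAt_det_cov hpos.ne'.isUnit)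
  have hs : (cov x)⁻¹ᵀ = (cov x)⁻¹ := by
    simpa using hx.inv.1.eq
  rw [smul_smul, neg_mul, inv_mul_cancel₀ hpos.ne', neg_one_smul, hs] at h
  exact h

theorem le_eigenvalues {A : Matrix (Fin d) (Fin d) ℝ} (hA : A.IsHermitian) {v : ℝ}
    (h : (A - v • (1 : Matrix (Fin d) (Fin d) ℝ)).PosSemidef) (i : Fin d) :
    v ≤ hA.eigenvalues i := by
  have h1 := h.dotProduct_mulVec_nonneg (hA.eigenvectorBasis i).ofLp
  have h2 : star (hA.eigenvectorBasis i).ofLp ⬝ᵥ (hA.eigenvectorBasis i).ofLp = 1 := by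
    have := hA.eigenvectorBasis.orthonormal.1 i
    have h3 := EuclideanSpace.real_norm_sq_eq (hA.eigenvectorBasis i)
    rw [this] at h3
    simpa [dotProduct, sq] using h3.symm
  rw [Matrix.sub_mulVec, hA.mulVec_eigenvectorBasis, Matrix.smul_mulVec, Matrix.one_mulVec,
    dotProduct_sub, dotProduct_smul, dotProduct_smul, h2] at h1
  simp at h1
  exact h1

theorem posDef_of_posSemidef_sub {A : Matrix (Fin d) (Fin d) ℝ} {v : ℝ} (hv : 0 < v)
    (h : (A - v • (1 : Matrix (Fin d) (Fin d) ℝ)).PosSemidef) : A.PosDef := by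
  have h1 : (v • (1 : Matrix (Fin d) (Fin d) ℝ)).PosDef := Matrix.PosDef.one.smul hv
  simpa using Matrix.PosDef.posSemidef_add h h1

end LogDet

/-! ### Extension of the regularizer -/

/-- Convexity of the extension. -/
theorem negLogExtension_tangent_le {a : ℝ} (ha : 0 < a) (x y : ℝ) :
    negLogExtension a x + -(max x a)⁻¹ * (y - x) ≤ negLogExtension a y := by
  -- Left of `a` the function is its own tangent at `a`, so only contact points b ≥ a matter. For y
  -- < a compare at `a` first; the slope -1/a is at least as steep as -1/b.
  have key : ∀ b, a ≤ b → -Real.log b + -b⁻¹ * (y - b) ≤ negLogExtension a y := by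
    intro b hb
    have hb0 := ha.trans_le hb
    have hlog : ∀ z, 0 < z → -Real.log b + -b⁻¹ * (z - b) ≤ -Real.log z := by
      intro z hz
      have h := Real.log_le_sub_one_of_pos (div_pos hz hb0)
      rw [Real.log_div hz.ne' hb0.ne'] at h
      have e : -b⁻¹ * (z - b) = -(z / b - 1) := by field_simp
      rw [e]
      linarith
    rcases le_total a y with h | h
    · rw [negLogExtension_of_le h]
      exact hlog y (ha.trans_le h)
    · rw [negLogExtension, tangentExtension_of_ge _ _ h]
      have h1 := hlog a ha
      have h2 : b⁻¹ * (a - y) ≤ a⁻¹ * (a - y) :=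
        mul_le_mul_of_nonneg_right (inv_anti₀ ha hb) (by linarith)
      linarith
  rcases le_total a x with h | h
  · rw [negLogExtension_of_le h, max_eq_left h]
    exact key x h
  · have h1 := key a le_rfl
    rw [negLogExtension, tangentExtension_of_ge _ _ h, max_eq_right h]
    rw [negLogExtension] at h1
    linarith

/-- The function `-log` on `[a, ∞)`, continued by a quadratic polynomial. -/
def negLogQuadratic (a x : ℝ) : ℝ := negLogExtension a x + 1 / 2 * min (x - a) 0 ^ 2

theorem negLogQuadratic_of_le {a x : ℝ} (h : a ≤ x) : negLogQuadratic a x = -Real.log x := by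
  rw [negLogQuadratic, negLogExtension_of_le h, min_eq_right (by linarith)]
  simp

theorem negLogQuadratic_tangent_le {a : ℝ} (ha : 0 < a) (x y : ℝ) :
    negLogQuadratic a x + (-(max x a)⁻¹ + min (x - a) 0) * (y - x) ≤ negLogQuadratic a y := by
  have h1 := negLogExtension_tangent_le ha x y
  have h2 : 1 / 2 * min (x - a) 0 ^ 2 + min (x - a) 0 * (y - x) ≤ 1 / 2 * min (y - a) 0 ^ 2 := by
    rcases le_total (x - a) 0 with h | h <;> rcases le_total (y - a) 0 with h' | h'
    · rw [min_eq_left h, min_eq_left h']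
      nlinarith [sq_nonneg (x - y)]
    · rw [min_eq_left h, min_eq_right h']
      nlinarith [mul_nonneg (neg_nonneg.2 h) h']
    · rw [min_eq_right h, min_eq_left h']
      nlinarith [sq_nonneg (y - a)]
    · rw [min_eq_right h, min_eq_right h']
      simp
  rw [negLogQuadratic, negLogQuadratic]
  linarith

theorem abs_deriv_negLogQuadratic_sub_le {a : ℝ} (ha : 0 < a) (x y : ℝ) :
    |(-(max x a)⁻¹ + min (x - a) 0) - (-(max y a)⁻¹ + min (y - a) 0)| ≤
      (a⁻¹ ^ 2 + 1) * |x - y| := by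
  have h1 := abs_inv_max_sub_inv_max_le ha y x
  have h2 : |min (x - a) 0 - min (y - a) 0| ≤ |x - y| := by
    simpa using abs_min_sub_min_le_max (x - a) 0 (y - a) 0
  have e : (-(max x a)⁻¹ + min (x - a) 0) - (-(max y a)⁻¹ + min (y - a) 0) =
      ((max y a)⁻¹ - (max x a)⁻¹) + (min (x - a) 0 - min (y - a) 0) := by ring
  rw [abs_sub_comm y x] at h1
  rw [e, add_mul, one_mul]
  exact (abs_add_le _ _).trans (add_le_add h1 h2)

/-- By convexity the minimum is at a point of slope -s. The quadratic part makes every slope -s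
available; with the tangent alone s x + ψ(x) would tend to -∞ on the left as soon as s > 1/a. -/
theorem exists_le_mul_add_negLogQuadratic {a : ℝ} (ha : 0 < a) {s : ℝ} (hs : 0 < s) :
    ∃ c, ∀ x, c ≤ s * x + negLogQuadratic a x := by
  -- For s ≤ 1/a the slope is attained by -log at 1/s, otherwise by the quadratic part left of `a`.
  obtain ⟨z, hz⟩ : ∃ z, -(max z a)⁻¹ + min (z - a) 0 = -s := by
    rcases le_total s a⁻¹ with h | h
    · have h' : a ≤ s⁻¹ := by rwa [le_inv_comm₀ ha hs]
      exact ⟨s⁻¹, by rw [max_eq_left h', min_eq_right (by linarith), inv_inv, add_zero]⟩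
    · exact ⟨a - (s - a⁻¹), by rw [max_eq_right (by linarith), min_eq_left (by linarith)]; ring⟩
  refine ⟨s * z + negLogQuadratic a z, fun x => ?_⟩
  have := negLogQuadratic_tangent_le ha z x
  rw [hz] at this
  linarith

section Quadratic

variable {d : ℕ}

/-- The quadratic form is convex with an affine gradient, so the subgradient criterion applies with
an operator norm as Lipschitz constant. -/
theorem hasLipschitzGradient_quadratic (m₀ : Fin d → ℝ) {Q : Matrix (Fin d) (Fin d) ℝ}
    (hQ : Q.PosSemidef) :
    HasLipschitzGradient
      (fun r : Param d => ((mean r).ofLp - m₀) ⬝ᵥ Q *ᵥ ((mean r).ofLp - m₀))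
      fun r => pack ((2 : ℝ) • Q *ᵥ ((mean r).ofLp - m₀)) 0 := by
  have hQs : Qᵀ = Q := by simpa using hQ.1.eq
  have hsymm : ∀ x y : Fin d → ℝ, x ⬝ᵥ Q *ᵥ y = (Q *ᵥ x) ⬝ᵥ y := fun x y => by
    rw [Matrix.dotProduct_mulVec, ← Matrix.mulVec_transpose, hQs]
  let T : Param d →ₗ[ℝ] Param d :=
    { toFun := fun r => pack ((2 : ℝ) • Q *ᵥ (mean r).ofLp) 0
      map_add' := fun x y => by
        rw [← pack_add, ← smul_add, ← Matrix.mulVec_add, add_zero]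
        rfl
      map_smul' := fun c x => by
        rw [RingHom.id_apply, ← pack_smul, smul_comm c, ← Matrix.mulVec_smul Q c, smul_zero]
        rfl }
  refine HasLipschitzGradient.of_subgradient (K := ‖LinearMap.toContinuousLinearMap T‖)
    (fun x y => ?_) fun x y => ?_
  · have h := hQ.dotProduct_mulVec_nonneg ((mean y).ofLp - (mean x).ofLp)
    rw [inner_pack, mean_sub]
    set a := (mean x).ofLp - m₀ with ha
    set b := (mean y).ofLp - m₀ with hb
    have e : (mean y).ofLp - (mean x).ofLp = b - a := by rw [ha, hb]; abel
    rw [e] at h ⊢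
    simp only [star_trivial, Matrix.mulVec_sub, sub_dotProduct, dotProduct_sub, smul_dotProduct,
      Matrix.transpose_zero, Matrix.zero_mul, Matrix.trace_zero, smul_eq_mul] at h ⊢
    have e1 := hsymm a b
    have e2 := hsymm b a
    have e3 := hsymm a a
    have e4 := dotProduct_comm (Q *ᵥ a) b
    linarith
  · refine le_trans (le_of_eq ?_) ((LinearMap.toContinuousLinearMap T).le_opNorm (x - y))
    rw [LinearMap.coe_toContinuousLinearMap', map_sub, ← pack_sub, ← smul_sub,
      ← Matrix.mulVec_sub]
    change _ = ‖pack ((2 : ℝ) • Q *ᵥ (mean x).ofLp) 0 - pack ((2 : ℝ) • Q *ᵥ (mean y).ofLp) 0‖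
    rw [← pack_sub, ← smul_sub, ← Matrix.mulVec_sub, sub_sub_sub_cancel_right]

end Quadratic

/-! ### The extensions of the regularizer and of the objective. -/

namespace Model

variable {n d : ℕ} {M : Model n d}

/-- On the parameters with `V ⪰ v I`, the regularizer agrees together with its gradient with a
function on the whole parameter space that is bounded below and has a Lipschitz gradient. -/
theorem exists_extension_regularizer (hβ : 0 ≤ M.β) (hS₀ : M.S₀.PosDef) {v : ℝ} (hv : 0 < v) :
    ∃ (R : Param d → ℝ) (G : Param d → Param d) (c : ℝ), HasLipschitzGradient R G ∧
      (∀ x, c ≤ R x) ∧ ∀ x, (cov x - v • (1 : Matrix (Fin d) (Fin d) ℝ)).PosSemidef →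
        R x = M.regularizer x ∧ HasGradientAt M.regularizer (G x) x := by
  have hS := hS₀.inv
  have hSs : (M.S₀⁻¹)ᵀ = M.S₀⁻¹ := by simpa using hS.1.eq
  have hT : HasLipschitzGradient (fun r : Param d => (M.S₀⁻¹ * cov r).trace)
      fun _ => pack 0 M.S₀⁻¹ := by
    have e : (fun r : Param d => (M.S₀⁻¹ * cov r).trace) =
        fun r => inner ℝ (pack 0 M.S₀⁻¹) r + 0 := by
      ext r
      rw [inner_pack, hSs]
      simp
    rw [e]
    exact ⟨hasGradientAt_inner_add_const _ _, 0, LipschitzWith.const _⟩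
  have hq := hasLipschitzGradient_quadratic M.m₀.ofLp hS.posSemidef
  have hΨ := hasLipschitzGradient_sum_eigenvalues (d := d) (negLogQuadratic_tangent_le hv)
    (by positivity) (abs_deriv_negLogQuadratic_sub_le hv)
  set κ : ℝ := Real.log M.S₀.det - d
  have hTq := (hT.add hq).add (HasLipschitzGradient.const κ)
  have hR := ((hTq.add hΨ).const_mul (1 / 2)).const_mul (M.β / n)
  obtain ⟨c, hc⟩ := exists_le_trace_mul_add_sum hS
    fun s hs => exists_le_mul_add_negLogQuadratic hv hs
  refine ⟨_, _, M.β / n * (1 / 2 * (c + κ)), hR, fun x => ?_, fun x hx => ?_⟩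
  · have h1 := hc _ (isHermitian_symmCov x)
    rw [trace_mul_symmCov hSs] at h1
    have h2 := hS.posSemidef.dotProduct_mulVec_nonneg ((mean x).ofLp - M.m₀.ofLp)
    rw [star_trivial] at h2
    have : 0 ≤ M.β / n := by positivity
    refine mul_le_mul_of_nonneg_left ?_ this
    linarith
  · have hpd := posDef_of_posSemidef_sub hv hx
    have hsym : symmCov x = cov x := symmCov_eq (by simpa using hpd.1.eq)
    have hx' : (symmCov x - v • (1 : Matrix (Fin d) (Fin d) ℝ)).PosSemidef := by rwa [hsym]
    have hev := le_eigenvalues (isHermitian_symmCov x) hx'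
    -- On the domain all eigenvalues are at least v, where the continued function is still -log, and
    -- the sum becomes the log-determinant.
    have hlog : ∑ i, negLogQuadratic v ((isHermitian_symmCov x).eigenvalues i) =
        -Real.log (cov x).det := by
      rw [← hsym, (isHermitian_symmCov x).det_eq_prod_eigenvalues]
      simp only [RCLike.ofReal_real_eq_id, id]
      rw [Real.log_prod fun i _ => (hv.trans_le (hev i)).ne', ← Finset.sum_neg_distrib]
      exact Finset.sum_congr rfl fun i _ => negLogQuadratic_of_le (hev i)
    have hgrad : spectralFun (isHermitian_symmCov x) (fun z => -(max z v)⁻¹ + min (z - v) 0) =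
        -(cov x)⁻¹ := by
      refine (spectralFun_eq_neg_inv _ fun i => ?_).trans (by rw [hsym])
      have := hev i
      rw [max_eq_left this, min_eq_right (by linarith), add_zero, neg_mul,
        inv_mul_cancel₀ (hv.trans_le this).ne']
    have hreg : M.regularizer = fun r => M.β / n * (1 / 2 * ((M.S₀⁻¹ * cov r).trace +
        ((mean r).ofLp - M.m₀.ofLp) ⬝ᵥ M.S₀⁻¹ *ᵥ ((mean r).ofLp - M.m₀.ofLp) + κ +
        -Real.log (cov r).det)) := by
      ext r
      simp only [regularizer, gaussianKL, κ]
      ring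
    refine ⟨?_, ?_⟩
    · rw [hreg]
      simp only [hlog]
    · rw [hreg]
      -- The remaining summands coincide with those of the extension everywhere. For the
      -- log-determinant the two gradients are computed separately and both equal -V⁻¹.
      refine hasGradientAt_const_mul _ (hasGradientAt_const_mul _
        (hasGradientAt_add (hTq.1 x) ?_))
      rw [hgrad]
      have := hasGradientAt_neg_log_det_cov hpd
      have e : pack (0 : Fin d → ℝ) (-(cov x)⁻¹) = -pack 0 (cov x)⁻¹ := by
        have := pack_smul (-1) (0 : Fin d → ℝ) (cov x)⁻¹
        simpa using this
      rwa [e]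

/-- On the domain, the objective agrees up to a constant and together with its gradient with a
non-negative function on the whole parameter space that has a Lipschitz gradient. -/
theorem exists_extension_objective (hβ : 0 ≤ M.β) (hS₀ : M.S₀.PosDef)
    (hb₂ : ∀ i, 0 ≤ M.b₂ i) (hlik : ∀ i, Differentiable ℝ (M.lik i))
    (hlik' : ∀ i, Differentiable ℝ (deriv (M.lik i)))
    {B b' B' b'' B'' : ℝ} (hb : M.DerivBounds B b' B' b'' B'')
    {ζ v : ℝ} (hζ : 0 < ζ) (hv : 0 < v) :
    ∃ (f : Param d → ℝ) (F : Param d → Param d) (C : ℝ), HasLipschitzGradient f F ∧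
      (∀ x, 0 ≤ f x) ∧
      ∀ x ∈ M.domain ζ v, f x = M.objective x + C ∧ HasGradientAt M.objective (F x) x ∧
        F x = gradient M.regularizer x - (1 / (n : ℝ)) • ∑ i, pack ((M.Eφ' i x / M.Eφ i x) • M.a₁ i)
          ((M.Eφ'' i x / M.Eφ i x) • ((1 / 2 : ℝ) • Matrix.vecMulVec (M.a₂ i) (M.a₂ i))) := by
  choose Φ D A hΦ hA hB hD using
    fun i => exists_extension_Eφ (M := M) hb₂ hlik hlik' hb hv i
  obtain ⟨R, G, c, hR, hc, hRx⟩ := exists_extension_regularizer (M := M) hβ hS₀ hv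
  have hℓ : ∀ i, HasLipschitzGradient (fun x => negLogExtension ζ (Φ i x))
      fun x => -(max (Φ i x) ζ)⁻¹ • D i x := fun i =>
    HasLipschitzGradient.comp (hasDerivAt_negLogExtension hζ) (lipschitz_deriv_negLogExtension hζ)
      (abs_deriv_negLogExtension_le hζ) (hΦ i) (hA i)
  -- Cancels the lower bounds: each loss is at least its value at B, since Φ ≤ B, and the extended
  -- regularizer is at least c.
  set C : ℝ := -(1 / (n : ℝ) * ∑ _i : Fin n, negLogExtension ζ B + c)
  have hf := (((HasLipschitzGradient.sum Finset.univ fun i _ => hℓ i).const_mul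
    (1 / (n : ℝ))).add hR).add (HasLipschitzGradient.const C)
  refine ⟨_, _, C, hf, fun x => ?_, fun x hx => ?_⟩
  · have h1 : ∑ _i : Fin n, negLogExtension ζ B ≤ ∑ i, negLogExtension ζ (Φ i x) :=
      Finset.sum_le_sum fun i _ => antitone_negLogExtension hζ (hB i x)
    have h2 := mul_le_mul_of_nonneg_left h1 (by positivity : 0 ≤ 1 / (n : ℝ))
    have h3 := hc x
    linarith
  · obtain ⟨hx1, hx2⟩ := hx
    have e1 : ∀ i, Φ i x = M.Eφ i x := fun i => (hD i x hx1).1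
    obtain ⟨r1, r2⟩ := hRx x hx1
    have hpos : ∀ i, 0 < M.Eφ i x := fun i => hζ.trans_le (hx2 i)
    refine ⟨?_, ?_, ?_⟩
    · simp only [e1, negLogExtension_of_le (hx2 _), r1, objective]
    · rw [add_zero]
      refine hasGradientAt_add (f := fun x => 1 / (n : ℝ) * ∑ i, -Real.log (M.Eφ i x))
        (hasGradientAt_const_mul _ (hasGradientAt_sum _ fun i _ => ?_)) r2
      rw [e1, max_eq_left (hx2 i)]
      exact hasGradientAt_comp (φ := fun y => -Real.log y)
        (Real.hasDerivAt_log (hpos i).ne').neg (hD i x hx1).2.1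
    · rw [r2.gradient, add_zero, add_comm, sub_eq_add_neg, ← smul_neg, ← Finset.sum_neg_distrib]
      congr 2
      refine Finset.sum_congr rfl fun i _ => ?_
      rw [e1, max_eq_left (hx2 i), (hD i x hx1).2.2, neg_smul, ← pack_smul, smul_smul,
        smul_smul ((M.Eφ i x)⁻¹), div_eq_inv_mul (M.Eφ' i x),
        div_eq_inv_mul (M.Eφ'' i x)]

end Model

/-! ### Gradient descent with square-summable errors -/

theorem summable_of_le_sub_add {a b e : ℕ → ℝ} {c : ℝ} (ha : ∀ t, c ≤ a t) (hb : ∀ t, 0 ≤ b t)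
    (he0 : ∀ t, 0 ≤ e t) (he : Summable e) (h : ∀ t, a (t + 1) ≤ a t - b t + e t) :
    Summable b := by
  refine summable_of_sum_range_le (c := a 0 - c + ∑' t, e t) hb fun T => ?_
  have key : ∑ t ∈ Finset.range T, b t ≤ a 0 - a T + ∑ t ∈ Finset.range T, e t := by
    induction T with
    | zero => simp
    | succ T ih =>
      rw [Finset.sum_range_succ, Finset.sum_range_succ]
      linarith [h T]
  have := he.sum_le_tsum (Finset.range T) fun t _ => he0 t
  linarith [ha T]

/-- Subtracting the partial sums of the errors leaves a decreasing sequence bounded below. -/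
theorem tendsto_of_le_add {a e : ℕ → ℝ} {c : ℝ} (ha : ∀ t, c ≤ a t)
    (he0 : ∀ t, 0 ≤ e t) (he : Summable e) (h : ∀ t, a (t + 1) ≤ a t + e t) :
    ∃ l, Tendsto a atTop (𝓝 l) := by
  set b : ℕ → ℝ := fun t => a t - ∑ s ∈ Finset.range t, e s with hb
  have hanti : Antitone b := antitone_nat_of_succ_le fun t => by
    simp only [hb, Finset.sum_range_succ]
    linarith [h t]
  have hbdd : BddBelow (Set.range b) := by
    refine ⟨c - ∑' t, e t, ?_⟩
    rintro _ ⟨t, rfl⟩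
    have := he.sum_le_tsum (Finset.range t) fun t _ => he0 t
    simp only [hb]
    linarith [ha t]
  refine ⟨_, ((tendsto_atTop_ciInf hanti hbdd).add he.hasSum.tendsto_sum_nat).congr fun t => ?_⟩
  simp [hb]

section Descent

variable {E : Type*} [NormedAddCommGroup E] [InnerProductSpace ℝ E] [CompleteSpace E]

/-- The cross term γ‖F‖‖w‖ is split into γ²‖F‖²/2 + ‖w‖²/2. With the quadratic term of the descent
lemma the coefficient of ‖F‖² is (2K + 1/2)γ², at most γ/2 by `hγK`; half of the decrease γ‖F‖²
survives. -/
theorem tendsto_of_gradient_descent_of_small {f : E → ℝ} {F : E → E}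
    (hf : ∀ x, HasGradientAt f (F x) x) {K : ℝ≥0} (hK : LipschitzWith K F) (h0 : ∀ x, 0 ≤ f x)
    {x w : ℕ → E} {γ : ℕ → ℝ} (hγ : ∀ t, 0 < γ t) (hγ1 : ∀ t, γ t ≤ 1)
    (hγK : ∀ t, (2 * K + 1 / 2) * γ t ≤ 1 / 2) (hdiv : ¬Summable γ)
    (hw : Summable fun t => ‖w t‖ ^ 2)
    (hx : ∀ t, x (t + 1) = x t + γ t • (-F (x t) + w t)) :
    (∃ l, Tendsto (fun t => f (x t)) atTop (𝓝 l)) ∧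
      Tendsto (fun t => F (x t)) atTop (𝓝 0) := by
  have hK0 : (0 : ℝ) ≤ K := K.2
  have hstep : ∀ t, ‖x (t + 1) - x t‖ ≤ γ t * (‖F (x t)‖ + ‖w t‖) := by
    intro t
    rw [hx, add_sub_cancel_left, norm_smul, Real.norm_eq_abs, abs_of_pos (hγ t)]
    refine mul_le_mul_of_nonneg_left ?_ (hγ t).le
    simpa using norm_add_le (-F (x t)) (w t)
  have hdesc : ∀ t, f (x (t + 1)) ≤
      f (x t) - 1 / 2 * (γ t * ‖F (x t)‖ ^ 2) + (1 / 2 + 2 * K) * ‖w t‖ ^ 2 := by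
    intro t
    have h1 := HasLipschitzGradient.descent hf hK (x t) (x (t + 1))
    have h2 : inner ℝ (F (x t)) (x (t + 1) - x t) ≤
        γ t * (-‖F (x t)‖ ^ 2 + ‖F (x t)‖ * ‖w t‖) := by
      rw [hx, add_sub_cancel_left, inner_smul_right, inner_add_right, inner_neg_right,
        real_inner_self_eq_norm_sq]
      exact mul_le_mul_of_nonneg_left (by linarith [real_inner_le_norm (F (x t)) (w t)])
        (hγ t).le
    have h3 := pow_le_pow_left₀ (norm_nonneg _) (hstep t) 2
    have h3' := mul_le_mul_of_nonneg_left h3 hK0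
    set a := ‖F (x t)‖
    set b := ‖w t‖
    have hg := hγ t
    have h4 : (a + b) ^ 2 ≤ 2 * (a ^ 2 + b ^ 2) := by nlinarith [sq_nonneg (a - b)]
    have h5 : K * (γ t * (a + b)) ^ 2 ≤ 2 * K * γ t ^ 2 * a ^ 2 + 2 * K * b ^ 2 := by
      have e1 : (K : ℝ) * (γ t * (a + b)) ^ 2 ≤ K * γ t ^ 2 * (2 * (a ^ 2 + b ^ 2)) := by
        rw [mul_pow, ← mul_assoc]
        exact mul_le_mul_of_nonneg_left h4 (by positivity)
      have e2 : γ t ^ 2 ≤ 1 := pow_le_one₀ hg.le (hγ1 t)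
      have e3 : (K : ℝ) * b ^ 2 * γ t ^ 2 ≤ K * b ^ 2 :=
        mul_le_of_le_one_right (by positivity) e2
      linarith
    have h6 : γ t * (a * b) ≤ 1 / 2 * (γ t ^ 2 * a ^ 2) + 1 / 2 * b ^ 2 := by
      nlinarith [sq_nonneg (γ t * a - b)]
    have h7 := mul_le_mul_of_nonneg_right (hγK t) (by positivity : 0 ≤ γ t * a ^ 2)
    linarith
  have hwK : Summable fun t => (1 / 2 + 2 * K) * ‖w t‖ ^ 2 := hw.mul_left _
  have hb0 : ∀ t, 0 ≤ 1 / 2 * (γ t * ‖F (x t)‖ ^ 2) := fun t => by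
    have := (hγ t).le
    positivity
  have hs := summable_of_le_sub_add (fun t => h0 (x t)) hb0 (fun t => by positivity) hwK hdesc
  have hs' : Summable fun t => γ t * ‖F (x t)‖ ^ 2 := by
    simpa using hs.mul_left 2
  refine ⟨tendsto_of_le_add (fun t => h0 (x t)) (fun t => by positivity) hwK
    fun t => (hdesc t).trans (by linarith [hb0 t]), ?_⟩
  -- The squared gradient norm can increase only by summable amounts, so it converges. This replaces
  -- an oscillation argument between small and large gradients.
  have hgrow : ∀ t, ‖F (x (t + 1))‖ ^ 2 ≤ ‖F (x t)‖ ^ 2 +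
      ((3 * K + 2 * K ^ 2) * (γ t * ‖F (x t)‖ ^ 2) + (K + 2 * K ^ 2) * ‖w t‖ ^ 2) := by
    intro t
    have h1 : ‖F (x (t + 1))‖ ≤ ‖F (x t)‖ + K * (γ t * (‖F (x t)‖ + ‖w t‖)) := by
      have e1 := hK.dist_le_mul (x (t + 1)) (x t)
      rw [dist_eq_norm, dist_eq_norm] at e1
      have e2 := norm_sub_norm_le (F (x (t + 1))) (F (x t))
      have e3 := mul_le_mul_of_nonneg_left (hstep t) hK0
      linarith
    refine (pow_le_pow_left₀ (norm_nonneg _) h1 2).trans ?_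
    set a := ‖F (x t)‖
    set b := ‖w t‖
    have hg := hγ t
    have h4 : (a + b) ^ 2 ≤ 2 * (a ^ 2 + b ^ 2) := by nlinarith [sq_nonneg (a - b)]
    have h6 : γ t * (a * b) ≤ 1 / 2 * (γ t ^ 2 * a ^ 2) + 1 / 2 * b ^ 2 := by
      nlinarith [sq_nonneg (γ t * a - b)]
    have h7 : γ t ^ 2 * a ^ 2 ≤ γ t * a ^ 2 :=
      mul_le_mul_of_nonneg_right (by nlinarith [hγ1 t]) (by positivity)
    have h8 : γ t ^ 2 * b ^ 2 ≤ b ^ 2 :=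
      mul_le_of_le_one_left (by positivity) (pow_le_one₀ hg.le (hγ1 t))
    have h9 : γ t ^ 2 * (a + b) ^ 2 ≤ 2 * (γ t * a ^ 2) + 2 * b ^ 2 := by
      have := mul_le_mul_of_nonneg_left h4 (by positivity : 0 ≤ γ t ^ 2)
      linarith
    have h10 := mul_le_mul_of_nonneg_left h9 (by positivity : (0 : ℝ) ≤ (K : ℝ) ^ 2)
    have h11 : γ t * (a * b) ≤ 1 / 2 * (γ t * a ^ 2) + 1 / 2 * b ^ 2 := by linarith
    have h12 := mul_le_mul_of_nonneg_left h11 hK0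
    have e : (a + K * (γ t * (a + b))) ^ 2 = a ^ 2 + 2 * (K * (γ t * a ^ 2)) +
        2 * (K * (γ t * (a * b))) + K ^ 2 * (γ t ^ 2 * (a + b) ^ 2) := by ring
    rw [e]
    linarith
  obtain ⟨l, hl⟩ := tendsto_of_le_add (a := fun t => ‖F (x t)‖ ^ 2) (c := 0)
    (fun t => by positivity)
    (fun t => by have := (hγ t).le; positivity)
    ((hs'.mul_left (3 * K + 2 * K ^ 2 : ℝ)).add (hw.mul_left (K + 2 * K ^ 2 : ℝ))) hgrow
  have hl0 : 0 ≤ l := ge_of_tendsto' hl fun t => by positivity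
  -- With a positive limit, γ would eventually be dominated by a multiple of the summable γ‖F‖².
  have hl' : l = 0 := by
    by_contra hne
    have hpos : 0 < l := lt_of_le_of_ne hl0 (Ne.symm hne)
    refine hdiv ?_
    have hev : ∀ᶠ t in atTop, l / 2 < ‖F (x t)‖ ^ 2 := hl.eventually_const_lt (by linarith)
    refine Summable.of_norm_bounded_eventually_nat (hs'.mul_left (2 / l)) ?_
    filter_upwards [hev] with t ht
    rw [Real.norm_eq_abs, abs_of_pos (hγ t)]
    have := mul_le_mul_of_nonneg_left ht.le (hγ t).le
    rw [div_mul_eq_mul_div, le_div_iff₀ hpos]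
    linarith
  rw [hl'] at hl
  rw [tendsto_zero_iff_norm_tendsto_zero]
  have := hl.sqrt
  simpa using this

/-- Gradient descent for a function with Lipschitz gradient, with square-summable step sizes and
errors. -/
theorem tendsto_of_gradient_descent {f : E → ℝ} {F : E → E} (hf : HasLipschitzGradient f F)
    (h0 : ∀ x, 0 ≤ f x) {x w : ℕ → E} {γ : ℕ → ℝ} (hγ : ∀ t, 0 < γ t)
    (hγsum : Tendsto (fun T => ∑ t ∈ Finset.range T, γ t) atTop atTop)
    (hγsq : Summable fun t => γ t ^ 2) (hw : Summable fun t => ‖w t‖ ^ 2)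
    (hx : ∀ t, x (t + 1) = x t + γ t • (-F (x t) + w t)) :
    (∃ l, Tendsto (fun t => f (x t)) atTop (𝓝 l)) ∧
      Tendsto (fun t => F (x t)) atTop (𝓝 0) := by
  obtain ⟨hf, K, hK⟩ := hf
  have hdiv : ¬Summable γ := (not_summable_iff_tendsto_nat_atTop_of_nonneg fun t =>
    (hγ t).le).2 hγsum
  have hγ0 : Tendsto γ atTop (𝓝 0) := by
    have := hγsq.tendsto_atTop_zero.sqrt
    simpa [Real.sqrt_sq (hγ _).le] using this
  have h1 : ∀ᶠ t in atTop, γ t < 1 := hγ0.eventually_lt_const one_pos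
  have h2 : ∀ᶠ t in atTop, (2 * K + 1 / 2) * γ t < 1 / 2 := by
    have := hγ0.const_mul (2 * (K : ℝ) + 1 / 2)
    rw [mul_zero] at this
    exact this.eventually_lt_const one_half_pos
  -- Square-summable steps tend to zero, so the smallness conditions hold after finitely many steps,
  -- which are discarded.
  obtain ⟨N, hN⟩ := eventually_atTop.1 (h1.and h2)
  obtain ⟨⟨l, hl⟩, hF⟩ := tendsto_of_gradient_descent_of_small hf hK h0
    (x := fun t => x (t + N)) (w := fun t => w (t + N)) (γ := fun t => γ (t + N))
    (fun t => hγ _) (fun t => (hN _ (Nat.le_add_left N t)).1.le)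
    (fun t => (hN _ (Nat.le_add_left N t)).2.le)
    (fun h => hdiv ((summable_nat_add_iff N).1 h))
    ((summable_nat_add_iff (f := fun t => ‖w t‖ ^ 2) N).2 hw)
    (fun t => by
      have := hx (t + N)
      rwa [add_right_comm] at this)
  exact ⟨⟨l, (tendsto_add_atTop_iff_nat (f := fun t => f (x t)) N).1 hl⟩,
    (tendsto_add_atTop_iff_nat (f := fun t => F (x t)) N).1 hF⟩

end Descent

/-! ### Monte Carlo averages -/

section MonteCarlo

open Model (avg)

variable {Ω : Type*} [MeasurableSpace Ω] {P : Measure Ω} [IsProbabilityMeasure P]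
  {e : ℕ → Ω → ℝ} {L : ℕ}

theorem avg_mem_Icc (hL : 0 < L) {ψ : ℝ → ℝ} {a b : ℝ} (h : ∀ x, ψ x ∈ Set.Icc a b)
    (x : ℕ → ℝ) : avg L x ψ ∈ Set.Icc a b := by
  have hL' : (0 : ℝ) < L := by exact_mod_cast hL
  have h1 : ∑ _l ∈ Finset.range L, a ≤ ∑ l ∈ Finset.range L, ψ (x l) :=
    Finset.sum_le_sum fun l _ => (h _).1
  have h2 : ∑ l ∈ Finset.range L, ψ (x l) ≤ ∑ _l ∈ Finset.range L, b :=
    Finset.sum_le_sum fun l _ => (h _).2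
  rw [Finset.sum_const, Finset.card_range, nsmul_eq_mul] at h1 h2
  rw [avg, div_mul_eq_mul_div, one_mul]
  exact ⟨by rw [le_div_iff₀ hL']; linarith, by rw [div_le_iff₀ hL']; linarith⟩

theorem measurable_avg (he : ∀ l, Measurable (e l)) {ψ : ℝ → ℝ} (hψ : Measurable ψ) :
    Measurable fun ω => avg L (fun l => e l ω) ψ := by
  unfold avg
  fun_prop

theorem integral_comp_of_map {μ : Measure Ω} {X : Ω → ℝ} (hX : Measurable X)
    (hlaw : μ.map X = gaussianReal 0 1) {ψ : ℝ → ℝ} (hψ : Measurable ψ) :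
    ∫ ω, ψ (X ω) ∂μ = ∫ x, ψ x ∂gaussianReal 0 1 := by
  rw [← hlaw, integral_map hX.aemeasurable hψ.aestronglyMeasurable]

theorem memLp_of_mem_Icc {f : Ω → ℝ} (hf : Measurable f) {a b : ℝ}
    (h : ∀ ω, f ω ∈ Set.Icc a b) : MemLp f 2 P :=
  MemLp.of_bound hf.aestronglyMeasurable (max |a| |b|)
    (ae_of_all _ fun ω => abs_le_max_abs_abs (h ω).1 (h ω).2)

/-- The mean squared error of a Monte Carlo average of a bounded function. -/
theorem integral_avg_sub_sq_le (hL : 0 < L) (he : ∀ l, Measurable (e l))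
    (hlaw : ∀ l, P.map (e l) = gaussianReal 0 1) (hind : iIndepFun e P) {ψ : ℝ → ℝ}
    (hψ : Measurable ψ) {a b : ℝ} (h : ∀ x, ψ x ∈ Set.Icc a b) :
    ∫ ω, (avg L (fun l => e l ω) ψ - ∫ x, ψ x ∂gaussianReal 0 1) ^ 2 ∂P ≤
      (b - a) ^ 2 / (4 * L) := by
  have hL' : (0 : ℝ) < L := by exact_mod_cast hL
  have hm : ∀ l, MemLp (fun ω => ψ (e l ω)) 2 P := fun l =>
    memLp_of_mem_Icc (hψ.comp (he l)) fun ω => h _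
  have hsum : (fun ω => avg L (fun l => e l ω) ψ) =
      fun ω => 1 / (L : ℝ) * (∑ l ∈ Finset.range L, fun ω => ψ (e l ω)) ω := by
    ext ω
    simp [avg]
  have hmean : ∫ ω, avg L (fun l => e l ω) ψ ∂P = ∫ x, ψ x ∂gaussianReal 0 1 := by
    unfold avg
    rw [integral_const_mul, integral_finsetSum _ fun l _ => (hm l).integrable one_le_two]
    simp_rw [integral_comp_of_map (he _) (hlaw _) hψ]
    rw [Finset.sum_const, Finset.card_range, nsmul_eq_mul]
    field_simp
  have hvar : ∫ ω, (avg L (fun l => e l ω) ψ - ∫ x, ψ x ∂gaussianReal 0 1) ^ 2 ∂P =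
      variance (fun ω => avg L (fun l => e l ω) ψ) P := by
    rw [variance_eq_integral (measurable_avg he hψ).aemeasurable, hmean]
  have hpair : Set.Pairwise (Finset.range L : Set ℕ)
      fun i j => IndepFun (fun ω => ψ (e i ω)) (fun ω => ψ (e j ω)) P := fun i _ j _ hij =>
    (hind.indepFun hij).comp hψ hψ
  rw [hvar, hsum, variance_const_mul, IndepFun.variance_sum (fun l _ => hm l) hpair]
  -- Popoviciu's inequality: a variable with values in [a, b] has variance at most ((b - a)/2)².
  have hle : ∑ l ∈ Finset.range L, variance (fun ω => ψ (e l ω)) P ≤ L * ((b - a) / 2) ^ 2 := by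
    have := Finset.sum_le_sum (s := Finset.range L) fun l _ =>
      variance_le_sq_of_bounded (μ := P) (ae_of_all _ fun ω => h (e l ω))
        (hψ.comp (he l)).aemeasurable
    rwa [Finset.sum_const, Finset.card_range, nsmul_eq_mul] at this
  refine (mul_le_mul_of_nonneg_left hle (by positivity)).trans_eq ?_
  field_simp
  norm_num

/-- A Monte Carlo average of a non-negative bounded function is unlikely to be less than half of
the mean. -/
theorem measureReal_avg_le_half (hL : 0 < L) (he : ∀ l, Measurable (e l))
    (hlaw : ∀ l, P.map (e l) = gaussianReal 0 1) (hind : iIndepFun e P) {ψ : ℝ → ℝ}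
    (hψ : Measurable ψ) {B : ℝ} (h : ∀ x, ψ x ∈ Set.Icc 0 B)
    (hα : 0 ≤ ∫ x, ψ x ∂gaussianReal 0 1) (hB : 0 < B) :
    P.real {ω | avg L (fun l => e l ω) ψ ≤ (∫ x, ψ x ∂gaussianReal 0 1) / 2} ≤
      Real.exp (-(L * (∫ x, ψ x ∂gaussianReal 0 1) ^ 2 / (2 * B ^ 2))) := by
  set α := ∫ x, ψ x ∂gaussianReal 0 1 with hαd
  have hL' : (0 : ℝ) < L := by exact_mod_cast hL
  -- Hoeffding's lemma for the negated centred variables, because the lower tail is wanted.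
  have hsub : ∀ l < L, HasSubgaussianMGF (fun ω => -(ψ (e l ω) - α)) ((‖B - 0‖₊ / 2) ^ 2) P := by
    intro l _
    have h1 := hasSubgaussianMGF_of_mem_Icc (μ := P) (hψ.comp (he l)).aemeasurable
      (ae_of_all _ fun ω => h (e l ω))
    have h2 : ∫ ω, (ψ ∘ e l) ω ∂P = α := integral_comp_of_map (he l) (hlaw l) hψ
    rw [h2] at h1
    exact h1.neg
  have hind' : iIndepFun (fun l ω => -(ψ (e l ω) - α)) P :=
    hind.comp (fun _ x => -(ψ x - α)) fun _ => by fun_prop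
  have hmain := HasSubgaussianMGF.measure_sum_range_ge_le_of_iIndepFun hind' hsub
    (by positivity : 0 ≤ (L : ℝ) * α / 2)
  have hset : {ω | avg L (fun l => e l ω) ψ ≤ α / 2} =
      {ω | (L : ℝ) * α / 2 ≤ ∑ l ∈ Finset.range L, -(ψ (e l ω) - α)} := by
    ext ω
    simp only [Set.mem_ofPred_eq, avg]
    rw [Finset.sum_neg_distrib, Finset.sum_sub_distrib, Finset.sum_const, Finset.card_range,
      nsmul_eq_mul, div_mul_eq_mul_div, one_mul, div_le_iff₀ hL']
    constructor <;> intro h <;> linarith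
  rw [hset]
  refine hmain.trans_eq ?_
  congr 1
  simp only [sub_zero, NNReal.coe_pow, NNReal.coe_div, coe_nnnorm, Real.norm_eq_abs,
    NNReal.coe_ofNat, abs_of_pos hB]
  field_simp

/-- From 1 + x + x²/2 ≤ eˣ. At x = 1/(4γ²) it turns the exponential tail into 32γ⁴. -/
theorem exp_neg_le {x : ℝ} (hx : 0 < x) : Real.exp (-x) ≤ 2 / x ^ 2 := by
  have h := Real.quadratic_le_exp_of_nonneg hx.le
  rw [Real.exp_neg, le_div_iff₀ (by positivity), inv_mul_le_iff₀ (Real.exp_pos x)]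
  linarith

/-- The good event, where the denominator is at least ζ/2. The error splits into a numerator error,
a denominator error and the smoothing bias; 12 = 3 · 4 comes from squaring three terms and from
(ζ/2)². -/
theorem sq_ratio_error_le {a a' α α' ζ M γ : ℝ} (hζ : 0 < ζ) (hα : ζ ≤ α) (hγ : 0 < γ)
    (ha : α / 2 < a) (hα' : |α'| ≤ M) :
    (a' / (a + γ * ζ) - α' / α) ^ 2 ≤
      12 / ζ ^ 2 * (a' - α') ^ 2 + 12 * M ^ 2 / ζ ^ 4 * (a - α) ^ 2 +
        12 * M ^ 2 / ζ ^ 2 * γ ^ 2 := by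
  have hα0 : 0 < α := hζ.trans_le hα
  have hM : 0 ≤ M := (abs_nonneg _).trans hα'
  have hd : ζ / 2 ≤ a + γ * ζ := by nlinarith [mul_pos hγ hζ]
  have hd0 : 0 < a + γ * ζ := lt_of_lt_of_le (by positivity) hd
  have e : a' / (a + γ * ζ) - α' / α = (a' - α') / (a + γ * ζ) +
      α' * (α - a) / ((a + γ * ζ) * α) - α' * (γ * ζ) / ((a + γ * ζ) * α) := by
    field_simp
    ring
  have i1 : (a' - α') ^ 2 / (a + γ * ζ) ^ 2 ≤ 4 / ζ ^ 2 * (a' - α') ^ 2 := by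
    have : (ζ / 2) ^ 2 ≤ (a + γ * ζ) ^ 2 := pow_le_pow_left₀ (by positivity) hd 2
    rw [div_mul_eq_mul_div, div_le_div_iff₀ (by positivity) (by positivity)]
    nlinarith [mul_le_mul_of_nonneg_left this (sq_nonneg (a' - α'))]
  have hprod : (ζ ^ 2 / 2) ^ 2 ≤ ((a + γ * ζ) * α) ^ 2 := by
    refine pow_le_pow_left₀ (by positivity) ?_ 2
    calc ζ ^ 2 / 2 = ζ / 2 * ζ := by ring
      _ ≤ _ := mul_le_mul hd hα hζ.le hd0.le
  have hM2 : α' ^ 2 ≤ M ^ 2 := sq_le_sq' (by linarith [(abs_le.1 hα').1]) (abs_le.1 hα').2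
  have i23 : ∀ z : ℝ, (α' * z) ^ 2 / ((a + γ * ζ) * α) ^ 2 ≤ 4 * M ^ 2 / ζ ^ 4 * z ^ 2 := by
    intro z
    calc (α' * z) ^ 2 / ((a + γ * ζ) * α) ^ 2 ≤ (M ^ 2 * z ^ 2) / (ζ ^ 2 / 2) ^ 2 := by
          rw [mul_pow]
          gcongr
      _ = _ := by field_simp; norm_num
  have i2 := i23 (α - a)
  have i3 := i23 (γ * ζ)
  have e3 : 4 * M ^ 2 / ζ ^ 4 * (γ * ζ) ^ 2 = 4 * M ^ 2 / ζ ^ 2 * γ ^ 2 := by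
    field_simp
  rw [e3] at i3
  have h3 : ∀ x y z : ℝ, (x + y - z) ^ 2 ≤ 3 * (x ^ 2 + y ^ 2 + z ^ 2) := fun x y z => by
    nlinarith [sq_nonneg (x - y), sq_nonneg (x + z), sq_nonneg (y + z)]
  rw [e]
  refine (h3 _ _ _).trans ?_
  rw [div_pow, div_pow, div_pow]
  have e4 : (α - a) ^ 2 = (a - α) ^ 2 := by ring
  rw [e4] at i2
  have f1 : 12 / ζ ^ 2 * (a' - α') ^ 2 = 3 * (4 / ζ ^ 2 * (a' - α') ^ 2) := by ring
  have f2 : 12 * M ^ 2 / ζ ^ 4 * (a - α) ^ 2 = 3 * (4 * M ^ 2 / ζ ^ 4 * (a - α) ^ 2) := by ring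
  have f3 : 12 * M ^ 2 / ζ ^ 2 * γ ^ 2 = 3 * (4 * M ^ 2 / ζ ^ 2 * γ ^ 2) := by ring
  rw [f1, f2, f3]
  linarith

/-- Without control of the sampled denominator, only the smoothing keeps it above γζ. -/
theorem abs_ratio_error_le {a a' α α' ζ M γ : ℝ} (hζ : 0 < ζ) (hα : ζ ≤ α) (hγ : 0 < γ)
    (ha : 0 ≤ a) (ha' : |a'| ≤ M) (hα' : |α'| ≤ M) :
    |a' / (a + γ * ζ) - α' / α| ≤ M / (γ * ζ) + M / ζ := by
  have hM : 0 ≤ M := (abs_nonneg _).trans hα'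
  have hg := mul_pos hγ hζ
  have hd : 0 < a + γ * ζ := by linarith
  have hα0 : 0 < α := hζ.trans_le hα
  refine (abs_sub _ _).trans ?_
  rw [abs_div, abs_div, abs_of_pos hd, abs_of_pos hα0]
  have : γ * ζ ≤ a + γ * ζ := by linarith
  gcongr

/-- The mean squared error of the smoothed ratio of two Monte Carlo averages. -/
theorem integral_sq_ratio_error_le (hL : 0 < L) (he : ∀ l, Measurable (e l))
    (hlaw : ∀ l, P.map (e l) = gaussianReal 0 1) (hind : iIndepFun e P) {p q : ℝ → ℝ}
    (hp : Measurable p) (hq : Measurable q) {B b' B' ζ M γ Q : ℝ}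
    (hpB : ∀ x, p x ∈ Set.Icc 0 B) (hqB : ∀ x, q x ∈ Set.Icc b' B') (hM : ∀ x, |q x| ≤ M)
    (hζ : 0 < ζ) (hα : ζ ≤ ∫ x, p x ∂gaussianReal 0 1) (hγ : 0 < γ) (hQ : |Q| ≤ M + 1)
    (hL1 : γ ≤ 1 → B ^ 2 ≤ 2 * γ ^ 2 * (∫ x, p x ∂gaussianReal 0 1) ^ 2 * L)
    (hL2 : γ ≤ 1 → (B' - b') ^ 2 ≤ 2 * γ ^ 2 * Q ^ 2 * L) :
    ∫ ω, (avg L (fun l => e l ω) q / (avg L (fun l => e l ω) p + γ * ζ) -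
      (∫ x, q x ∂gaussianReal 0 1) / ∫ x, p x ∂gaussianReal 0 1) ^ 2 ∂P ≤
      (12 * (M + 1) ^ 2 / ζ ^ 2 + 12 * M ^ 2 * B ^ 2 / ζ ^ 4 + 140 * M ^ 2 / ζ ^ 2) * γ ^ 2 := by
  set α := ∫ x, p x ∂gaussianReal 0 1 with hαd
  set α' := ∫ x, q x ∂gaussianReal 0 1 with hαd'
  have hL' : (0 : ℝ) < L := by exact_mod_cast hL
  have hα0 : 0 < α := hζ.trans_le hα
  have hα' : |α'| ≤ M := abs_integral_le hM
  have hM0 : 0 ≤ M := (abs_nonneg _).trans hα'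
  have hp0 : ∀ x, |p x| ≤ B := fun x => by rw [abs_of_nonneg (hpB x).1]; exact (hpB x).2
  have hαB : α ≤ B := (le_abs_self _).trans (abs_integral_le hp0)
  have hB0 : 0 < B := hα0.trans_le hαB
  set a : Ω → ℝ := fun ω => avg L (fun l => e l ω) p with had
  set a' : Ω → ℝ := fun ω => avg L (fun l => e l ω) q with had'
  have hav : ∀ ω, a ω ∈ Set.Icc 0 B := fun ω => avg_mem_Icc hL hpB _
  have hav' : ∀ ω, |a' ω| ≤ M := fun ω =>
    abs_le.2 (avg_mem_Icc hL (fun x => abs_le.1 (hM x)) _)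
  have ham : Measurable a := measurable_avg he hp
  have ham' : Measurable a' := measurable_avg he hq
  have hbound : ∀ ω, |a' ω / (a ω + γ * ζ) - α' / α| ≤ M / (γ * ζ) + M / ζ := fun ω =>
    abs_ratio_error_le hζ hα hγ (hav ω).1 (hav' ω) hα'
  have hc1 : 0 ≤ 12 * (M + 1) ^ 2 / ζ ^ 2 := by positivity
  have hc2 : 0 ≤ 12 * M ^ 2 * B ^ 2 / ζ ^ 4 := by positivity
  change ∫ ω, (a' ω / (a ω + γ * ζ) - α' / α) ^ 2 ∂P ≤ _
  have hZi : Integrable (fun ω => (a' ω / (a ω + γ * ζ) - α' / α) ^ 2) P :=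
    integrable_of_abs_le (by fun_prop) (A := (M / (γ * ζ) + M / ζ) ^ 2) fun ω => by
      rw [abs_of_nonneg (sq_nonneg _), ← sq_abs]
      exact pow_le_pow_left₀ (abs_nonneg _) (hbound ω) 2
  -- The sample-size conditions are available only for γ ≤ 1. For γ > 1 the crude bound 4M²/ζ² is
  -- already at most a multiple of γ².
  rcases le_or_gt γ 1 with h1 | h1
  · have i1 : Integrable (fun ω => (a' ω - α') ^ 2) P :=
      integrable_of_abs_le (by fun_prop) (A := (M + M) ^ 2) fun ω => by
        rw [abs_of_nonneg (sq_nonneg _), ← sq_abs]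
        exact pow_le_pow_left₀ (abs_nonneg _)
          ((abs_sub _ _).trans (add_le_add (hav' ω) hα')) 2
    have i2 : Integrable (fun ω => (a ω - α) ^ 2) P :=
      integrable_of_abs_le (by fun_prop) (A := B ^ 2) fun ω => by
        rw [abs_of_nonneg (sq_nonneg _)]
        have := hav ω
        exact sq_le_sq' (by linarith [this.1]) (by linarith [this.2])
    have hS : MeasurableSet {ω | a ω ≤ α / 2} := measurableSet_le ham measurable_const
    have i3 : Integrable (Set.indicator {ω | a ω ≤ α / 2} fun _ => (4 * M ^ 2 / (γ ^ 2 * ζ ^ 2)))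
        P := (integrable_const _).indicator hS
    -- The good-event bound plus the crude bound on the event that the denominator is at most half
    -- its mean.
    have hpt : ∀ ω, (a' ω / (a ω + γ * ζ) - α' / α) ^ 2 ≤
        12 / ζ ^ 2 * (a' ω - α') ^ 2 + 12 * M ^ 2 / ζ ^ 4 * (a ω - α) ^ 2 +
          12 * M ^ 2 / ζ ^ 2 * γ ^ 2 +
          Set.indicator {ω | a ω ≤ α / 2} (fun _ => (4 * M ^ 2 / (γ ^ 2 * ζ ^ 2))) ω := by
      intro ω
      by_cases hω : a ω ≤ α / 2
      · rw [Set.indicator_of_mem (by exact hω)]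
        have e1 : M / (γ * ζ) + M / ζ ≤ 2 * M / (γ * ζ) := by
          have : M / ζ ≤ M / (γ * ζ) := by
            have := mul_le_of_le_one_left hζ.le h1
            gcongr
          rw [mul_div_assoc]
          linarith
        have e2 := pow_le_pow_left₀ (abs_nonneg _) ((hbound ω).trans e1) 2
        rw [sq_abs] at e2
        have e3 : (2 * M / (γ * ζ)) ^ 2 = 4 * M ^ 2 / (γ ^ 2 * ζ ^ 2) := by
          rw [div_pow, mul_pow, mul_pow]; norm_num
        have e4 : 0 ≤ 12 / ζ ^ 2 * (a' ω - α') ^ 2 + 12 * M ^ 2 / ζ ^ 4 * (a ω - α) ^ 2 +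
          12 * M ^ 2 / ζ ^ 2 * γ ^ 2 := by positivity
        linarith
      · rw [Set.indicator_of_notMem (by exact hω), add_zero]
        exact sq_ratio_error_le hζ hα hγ (not_le.1 hω) hα'
    have hint : ∫ ω, (a' ω / (a ω + γ * ζ) - α' / α) ^ 2 ∂P ≤
        12 / ζ ^ 2 * ∫ ω, (a' ω - α') ^ 2 ∂P + 12 * M ^ 2 / ζ ^ 4 * ∫ ω, (a ω - α) ^ 2 ∂P +
          12 * M ^ 2 / ζ ^ 2 * γ ^ 2 +
          P.real {ω | a ω ≤ α / 2} * (4 * M ^ 2 / (γ ^ 2 * ζ ^ 2)) := by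
      have j1 := i1.const_mul (12 / ζ ^ 2)
      have j2 := i2.const_mul (12 * M ^ 2 / ζ ^ 4)
      have j12 : Integrable (fun ω => 12 / ζ ^ 2 * (a' ω - α') ^ 2 +
        12 * M ^ 2 / ζ ^ 4 * (a ω - α) ^ 2) P := j1.add j2
      have j3 : Integrable (fun _ : Ω => 12 * M ^ 2 / ζ ^ 2 * γ ^ 2) P := integrable_const _
      have j123 : Integrable (fun ω => 12 / ζ ^ 2 * (a' ω - α') ^ 2 +
        12 * M ^ 2 / ζ ^ 4 * (a ω - α) ^ 2 + 12 * M ^ 2 / ζ ^ 2 * γ ^ 2) P := j12.add j3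
      refine (integral_mono hZi (j123.add i3) hpt).trans_eq ?_
      rw [integral_add' j123 i3, integral_add j12 j3, integral_add j1 j2, integral_const_mul,
        integral_const_mul, integral_indicator_const _ hS]
      simp
    -- The normalisation Q may be 1 instead of the mean when the mean vanishes; both are at most M +
    -- 1.
    have k1 : ∫ ω, (a' ω - α') ^ 2 ∂P ≤ (M + 1) ^ 2 * γ ^ 2 := by
      refine (integral_avg_sub_sq_le hL he hlaw hind hq hqB).trans ?_
      rw [div_le_iff₀ (by positivity)]
      have hQ2 : Q ^ 2 ≤ (M + 1) ^ 2 := by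
        rw [← sq_abs]; exact pow_le_pow_left₀ (abs_nonneg _) hQ 2
      have e1 := hL2 h1
      have e2 := mul_le_mul_of_nonneg_right hQ2 (by positivity : 0 ≤ γ ^ 2 * (L : ℝ))
      have e3 : 0 ≤ (M + 1) ^ 2 * (γ ^ 2 * (L : ℝ)) := by positivity
      nlinarith
    have k2 : ∫ ω, (a ω - α) ^ 2 ∂P ≤ B ^ 2 * γ ^ 2 := by
      refine (integral_avg_sub_sq_le hL he hlaw hind hp hpB).trans ?_
      rw [div_le_iff₀ (by positivity)]
      have hα2 : α ^ 2 ≤ B ^ 2 := pow_le_pow_left₀ hα0.le hαB 2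
      have e1 := hL1 h1
      have e2 := mul_le_mul_of_nonneg_right hα2 (by positivity : 0 ≤ γ ^ 2 * (L : ℝ))
      have e3 : 0 ≤ B ^ 2 * (γ ^ 2 * (L : ℝ)) := by positivity
      nlinarith
    have k3 : P.real {ω | a ω ≤ α / 2} ≤ 32 * γ ^ 4 := by
      refine (measureReal_avg_le_half hL he hlaw hind hp hpB hα0.le hB0).trans ?_
      have e1 : 1 / (4 * γ ^ 2) ≤ L * α ^ 2 / (2 * B ^ 2) := by
        rw [div_le_div_iff₀ (by positivity) (by positivity)]
        nlinarith [hL1 h1]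
      refine (Real.exp_le_exp.2 (neg_le_neg e1)).trans ?_
      refine (exp_neg_le (by positivity)).trans_eq ?_
      field_simp
      norm_num
    have k4 : P.real {ω | a ω ≤ α / 2} * (4 * M ^ 2 / (γ ^ 2 * ζ ^ 2)) ≤
        128 * M ^ 2 / ζ ^ 2 * γ ^ 2 := by
      refine (mul_le_mul_of_nonneg_right k3 (by positivity)).trans_eq ?_
      field_simp
      ring
    have k1' := mul_le_mul_of_nonneg_left k1 (by positivity : 0 ≤ 12 / ζ ^ 2)
    have k2' := mul_le_mul_of_nonneg_left k2 (by positivity : 0 ≤ 12 * M ^ 2 / ζ ^ 4)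
    -- The constant 140 collects 12 from the smoothing bias and 128 = 32 · 4 from the bad event.
    have etot : (12 * (M + 1) ^ 2 / ζ ^ 2 + 12 * M ^ 2 * B ^ 2 / ζ ^ 4 + 140 * M ^ 2 / ζ ^ 2) *
        γ ^ 2 = 12 / ζ ^ 2 * ((M + 1) ^ 2 * γ ^ 2) + 12 * M ^ 2 / ζ ^ 4 * (B ^ 2 * γ ^ 2) +
        12 * M ^ 2 / ζ ^ 2 * γ ^ 2 + 128 * M ^ 2 / ζ ^ 2 * γ ^ 2 := by
      ring
    rw [etot]
    linarith
  · have e1 : M / (γ * ζ) + M / ζ ≤ 2 * M / ζ := by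
      have : M / (γ * ζ) ≤ M / ζ := by
        have := le_mul_of_one_le_left hζ.le h1.le
        gcongr
      rw [mul_div_assoc]
      linarith
    have hpt : ∀ ω, (a' ω / (a ω + γ * ζ) - α' / α) ^ 2 ≤ 4 * M ^ 2 / ζ ^ 2 := by
      intro ω
      have e2 := pow_le_pow_left₀ (abs_nonneg _) ((hbound ω).trans e1) 2
      rw [sq_abs] at e2
      refine e2.trans_eq ?_
      rw [div_pow, mul_pow]
      norm_num
    have h2 := integral_mono hZi (integrable_const _) hpt
    rw [integral_const, probReal_univ, one_smul] at h2
    have hc3 : 4 * M ^ 2 / ζ ^ 2 ≤ 140 * M ^ 2 / ζ ^ 2 := by gcongr; norm_num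
    have h3 : 1 ≤ γ ^ 2 := one_le_pow₀ h1.le
    have h4 : 0 ≤ 140 * M ^ 2 / ζ ^ 2 := by positivity
    refine h2.trans (le_trans ?_ (le_mul_of_one_le_right (by positivity) h3))
    linarith

end MonteCarlo

/-! ### Conditioning on the history -/

section Conditioning

variable {Ω : Type*} {m mΩ : MeasurableSpace Ω} {P : Measure Ω} [IsProbabilityMeasure P]

/-- For `Y` independent of `m` and `X` measurable with respect to `m`, a bound for the expectation
of `Ψ (x, Y)` at the values `x` of `X` bounds the integral of `Ψ (X, Y)` over the sets of `m`. -/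
theorem setLIntegral_le_of_indep {S T : Type*} [MeasurableSpace S] [mT : MeasurableSpace T]
    (hm : m ≤ mΩ) {X : Ω → S} {Y : Ω → T} (hX : Measurable[m] X) (hY : Measurable Y)
    (hind : Indep (MeasurableSpace.comap Y mT) m P) {Ψ : S × T → ENNReal} (hΨ : Measurable Ψ)
    {c : ENNReal} (h : ∀ᵐ ω ∂P, ∫⁻ ω', Ψ (X ω, Y ω') ∂P ≤ c) {A : Set Ω}
    (hA : MeasurableSet[m] A) : ∫⁻ ω in A, Ψ (X ω, Y ω) ∂P ≤ c * P A := by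
  -- Carrying the indicator of A along with X makes the integral over A an integral of one function
  -- of independent variables, so the product law and Tonelli's theorem apply.
  have hX' : Measurable[m] fun ω => (X ω, A.indicator (fun _ => (1 : ENNReal)) ω) :=
    hX.prodMk (measurable_const.indicator hA)
  have hX'm := hX'.mono hm le_rfl
  have hindep : IndepFun (fun ω => (X ω, A.indicator (fun _ => (1 : ENNReal)) ω)) Y P :=
    indep_of_indep_of_le_left hind.symm hX'.comap_le
  have hprod := (indepFun_iff_map_prod_eq_prod_map_map hX'm.aemeasurable hY.aemeasurable).1 hindep
  have hΘ : Measurable fun z : (S × ENNReal) × T => z.1.2 * Ψ (z.1.1, z.2) := by fun_prop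
  have hmul : ∀ ω, A.indicator (fun ω => Ψ (X ω, Y ω)) ω =
      A.indicator (fun _ => (1 : ENNReal)) ω * Ψ (X ω, Y ω) := fun ω => by
    by_cases hω : ω ∈ A <;> simp [hω]
  calc ∫⁻ ω in A, Ψ (X ω, Y ω) ∂P
      = ∫⁻ ω, A.indicator (fun _ => (1 : ENNReal)) ω * Ψ (X ω, Y ω) ∂P := by
        rw [← lintegral_indicator (hm A hA)]
        exact lintegral_congr hmul
    _ = ∫⁻ z, z.1.2 * Ψ (z.1.1, z.2)
          ∂P.map (fun ω => ((X ω, A.indicator (fun _ => (1 : ENNReal)) ω), Y ω)) := by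
        rw [lintegral_map hΘ (hX'm.prodMk hY)]
    _ = ∫⁻ ω, ∫⁻ ω', A.indicator (fun _ => (1 : ENNReal)) ω * Ψ (X ω, Y ω') ∂P ∂P := by
        rw [hprod, lintegral_prod _ hΘ.aemeasurable, lintegral_map _ hX'm]
        · refine lintegral_congr fun ω => ?_
          rw [lintegral_map (by fun_prop) hY]
        · exact hΘ.lintegral_prod_right'
    _ ≤ ∫⁻ ω, A.indicator (fun _ => (1 : ENNReal)) ω * c ∂P := by
        refine lintegral_mono_ae ?_
        filter_upwards [h] with ω hω
        have hXm := hX.mono hm le_rfl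
        rw [lintegral_const_mul _ (by fun_prop)]
        gcongr
    _ = c * P A := by
        rw [lintegral_mul_const _ (measurable_const.indicator (hm A hA)),
          lintegral_indicator_const (hm A hA), one_mul, mul_comm]

/-- The conditional expectation is measurable for `m` and has the same integrals over sets of `m`,
so comparing these integrals suffices. -/
theorem condExp_le_of_setIntegral_le (hm : m ≤ mΩ) {W : Ω → ℝ} (hW : Integrable W P) {c : ℝ}
    (h : ∀ A, MeasurableSet[m] A → ∫ ω in A, W ω ∂P ≤ c * P.real A) :
    ∀ᵐ ω ∂P, (P[W|m]) ω ≤ c := by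
  have hint : Integrable (P[W|m]) (P.trim hm) :=
    integrable_condExp.trim hm stronglyMeasurable_condExp
  refine ae_le_of_ae_le_trim (hm := hm) (f₂ := fun _ => c)
    (ae_le_of_forall_setIntegral_le hint (integrable_const c) fun A hA _ => ?_)
  rw [← setIntegral_trim hm stronglyMeasurable_condExp hA,
    ← setIntegral_trim hm stronglyMeasurable_const hA, setIntegral_condExp hm hW hA,
    setIntegral_const, smul_eq_mul, mul_comm]
  exact h A hA

theorem memLp_lipschitz_comp {E F : Type*} [NormedAddCommGroup E] [NormedAddCommGroup F]
    {G : E → F} (hG : ∃ K : ℝ≥0, LipschitzWith K G) {X : Ω → E} (hX : MemLp X 2 P) :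
    MemLp (fun ω => G (X ω)) 2 P := by
  obtain ⟨K, hK⟩ := hG
  have h1 : MemLp (fun _ : Ω => ‖G 0‖) 2 P := memLp_const _
  have h2 : MemLp (fun ω => K * ‖X ω‖) 2 P := hX.norm.const_mul (K : ℝ)
  have hg : MemLp (fun ω => ‖G 0‖ + K * ‖X ω‖) 2 P := h1.add h2
  refine hg.mono' (hK.continuous.comp_aestronglyMeasurable hX.1) (ae_of_all _ fun ω => ?_)
  have h1 := hK.dist_le_mul (X ω) 0
  rw [dist_eq_norm, dist_eq_norm, sub_zero] at h1
  have h2 := norm_le_norm_add_norm_sub' (G (X ω)) (G 0)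
  linarith

end Conditioning

/-! ### Measurability -/

theorem measurable_gradient {E : Type*} [NormedAddCommGroup E] [InnerProductSpace ℝ E]
    [CompleteSpace E] [MeasurableSpace E] [BorelSpace E] (f : E → ℝ) :
    Measurable (gradient f) :=
  (InnerProductSpace.toDual ℝ E).symm.continuous.measurable.comp (measurable_fderiv ℝ f)

namespace Model

variable {n d : ℕ} {M : Model n d}

theorem measurable_g (i : Fin n) : Measurable fun p : Param d × ℝ => M.g i p.1 p.2 := by
  have h1 := (M.continuous_latentMean i).measurable
  have h2 := (M.continuous_latentVar i).measurable
  unfold g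
  fun_prop

theorem measurable_φ (hlik : ∀ i, Differentiable ℝ (M.lik i)) (i : Fin n) :
    Measurable fun p : Param d × ℝ => M.φ i p.1 p.2 :=
  (hlik i).continuous.measurable.comp (measurable_g i)

theorem measurable_φ_right (hlik : ∀ i, Differentiable ℝ (M.lik i)) (i : Fin n) (x : Param d) :
    Measurable (M.φ i x) := by
  have h : Measurable fun y => √(M.latentVar i x) * y + M.latentMean i x := by fun_prop
  exact (hlik i).continuous.measurable.comp h

theorem measurable_φ' (i : Fin n) : Measurable fun p : Param d × ℝ => M.φ' i p.1 p.2 :=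
  (measurable_deriv _).comp (measurable_g i)

theorem measurable_φ'' (i : Fin n) : Measurable fun p : Param d × ℝ => M.φ'' i p.1 p.2 :=
  (measurable_deriv _).comp (measurable_g i)

section Measurability

variable {α : Type*} [MeasurableSpace α] {L : α → ℕ} {e : α → ℕ → ℝ} {x : α → Param d}

/-- The number of summands is random but takes countably many values, so measurability is checked
for each fixed length. -/
theorem measurable_avg_comp (hL : Measurable L) (he : ∀ l, Measurable fun a => e a l)
    (hx : Measurable x) {ψ : Param d → ℝ → ℝ}
    (hψ : Measurable fun p : Param d × ℝ => ψ p.1 p.2) :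
    Measurable fun a => avg (L a) (e a) (ψ (x a)) := by
  have h : Measurable fun p : ℕ × α => avg p.1 (e p.2) (ψ (x p.2)) := by
    refine measurable_from_prod_countable_right fun l => ?_
    unfold avg
    have hk : ∀ k, Measurable fun a => ψ (x a) (e a k) := fun k => hψ.comp (hx.prodMk (he k))
    exact (Finset.measurable_fun_sum (Finset.range l) fun k _ => hk k).const_mul (1 / (l : ℝ))
  exact h.comp (hL.prodMk measurable_id)

theorem measurable_direction (hlik : ∀ i, Differentiable ℝ (M.lik i)) {e : α → Fin n → ℕ → ℝ}
    (ν : ℝ) (hL : Measurable L) (he : ∀ i l, Measurable fun a => e a i l) (hx : Measurable x) :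
    Measurable fun a => M.direction ν (L a) (e a) (x a) := by
  unfold direction
  refine Measurable.sub ((measurable_const_smul _).comp (Finset.measurable_fun_sum _ fun i _ => ?_))
    ((measurable_gradient _).comp hx)
  have h0 := measurable_avg_comp hL (he i) hx (measurable_φ hlik i)
  have h1 := measurable_avg_comp hL (he i) hx (measurable_φ' (M := M) i)
  have h2 := measurable_avg_comp hL (he i) hx (measurable_φ'' (M := M) i)
  simp only [lossDirection, pack_smul_smul]
  exact ((h1.div (h0.add_const ν)).smul_const _).add ((h2.div (h0.add_const ν)).smul_const _)

end Measurability

/-- The error of the smoothed Monte Carlo estimate of `E ψ / E φ_i`. -/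
def ratioError (M : Model n d) (i : Fin n) (ψ : Param d → ℝ → ℝ) (ν : ℝ) (l : ℕ) (x : Param d)
    (e : ℕ → ℝ) : ℝ :=
  avg l e (ψ x) / (avg l e (M.φ i x) + ν) - (∫ ε, ψ x ε ∂gaussianReal 0 1) / M.Eφ i x

theorem measurable_ratioError (hlik : ∀ i, Differentiable ℝ (M.lik i)) (i : Fin n)
    {ψ : Param d → ℝ → ℝ} (hψ : Measurable fun p : Param d × ℝ => ψ p.1 p.2) (ν : ℝ)
    {α : Type*} [MeasurableSpace α] {L : α → ℕ} {e : α → ℕ → ℝ} {x : α → Param d}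
    (hL : Measurable L) (he : ∀ l, Measurable fun a => e a l) (hx : Measurable x) :
    Measurable fun a => M.ratioError i ψ ν (L a) (x a) (e a) := by
  have h0 := measurable_avg_comp hL he hx (measurable_φ hlik i)
  have h1 := measurable_avg_comp hL he hx hψ
  have hE : ∀ {χ : Param d → ℝ → ℝ}, (Measurable fun p : Param d × ℝ => χ p.1 p.2) →
      Measurable fun a => ∫ ε, χ (x a) ε ∂gaussianReal 0 1 := fun hχ =>
    (hχ.stronglyMeasurable.integral_prod_right'.measurable).comp hx
  exact (h1.div (h0.add_const ν)).sub ((hE hψ).div (hE (measurable_φ hlik i)))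

/-- The conditions on the sample size contained in the bound by `sampleFactor`. -/
theorem sample_size_bounds (hn : 0 < n) {B b' B' b'' B'' : ℝ}
    {i : Fin n} {x : Param d} {γ : ℝ} (hγ : 0 < γ) (hγ1 : γ ≤ 1) {l : ℕ} (hE : M.Eφ i x ≠ 0)
    (h : Real.log (6 * n / γ ^ 4) / (2 * γ ^ 2) * M.sampleFactor B b' B' b'' B'' i x < l) :
    B ^ 2 ≤ 2 * γ ^ 2 * M.Eφ i x ^ 2 * l ∧
    (B' - b') ^ 2 ≤ 2 * γ ^ 2 * (if M.Eφ' i x ≠ 0 then |M.Eφ' i x| else 1) ^ 2 * l ∧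
    (B'' - b'') ^ 2 ≤ 2 * γ ^ 2 * (if M.Eφ'' i x ≠ 0 then |M.Eφ'' i x| else 1) ^ 2 * l := by
  -- For γ ≤ 1 and n ≥ 1 the argument is at least 6 > e. This is all that is used of the logarithmic
  -- factor; for large γ it may be negative.
  have hlog : 1 ≤ Real.log (6 * n / γ ^ 4) := by
    have hn' : (1 : ℝ) ≤ n := by exact_mod_cast hn
    have h4 : γ ^ 4 ≤ 1 := pow_le_one₀ hγ.le hγ1
    rw [Real.le_log_iff_exp_le (by positivity), le_div_iff₀ (by positivity)]
    have := Real.exp_one_lt_d9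
    have h5 := mul_le_mul this.le h4 (by positivity) (by norm_num)
    linarith
  have key : ∀ {y z : ℝ}, z ≠ 0 → y ^ 2 / z ^ 2 ≤ M.sampleFactor B b' B' b'' B'' i x →
      y ^ 2 ≤ 2 * γ ^ 2 * z ^ 2 * l := by
    intro y z hz hy
    have hz2 : 0 < z ^ 2 := by positivity
    have h0 : 0 ≤ y ^ 2 / z ^ 2 := by positivity
    have h1 : 1 / (2 * γ ^ 2) * (y ^ 2 / z ^ 2) ≤ l := by
      refine le_trans ?_ h.le
      gcongr
    rw [div_mul_div_comm, one_mul, div_le_iff₀ (by positivity)] at h1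
    linarith
  have hite : ∀ y : ℝ, (if y ≠ 0 then |y| else 1) ≠ 0 := fun y => by
    split_ifs with hy
    · exact abs_ne_zero.2 hy
    · exact one_ne_zero
  refine ⟨?_, ?_, ?_⟩
  · rw [← sq_abs (M.Eφ i x)]
    exact key (abs_ne_zero.2 hE) (le_max_left _ _)
  · exact key (hite _) ((le_max_left _ _).trans (le_max_right _ _))
  · exact key (hite _) ((le_max_right _ _).trans (le_max_right _ _))

theorem abs_ite_le {y A : ℝ} (h : |y| ≤ A) : |if y ≠ 0 then |y| else 1| ≤ A + 1 := by
  have := abs_nonneg y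
  split_ifs
  · rw [abs_abs]; linarith
  · rw [abs_one]; linarith

/-! ### Adaptedness of a run and the mean squared errors over events of the history. -/

section Run

variable {Ω : Type*} [MeasurableSpace Ω] {P : Measure Ω}
  {ℱ : Filtration ℕ ‹MeasurableSpace Ω›} {γ ν : ℕ → ℝ} {L : ℕ → Ω → ℕ}
  {ε : ℕ → Fin n → ℕ → Ω → ℝ} {r : ℕ → Ω → Param d}

theorem IsSmoothBMC.measurable_draw (hrun : M.IsSmoothBMC P ℱ γ ν L ε r) (t : ℕ) (i : Fin n)
    (l : ℕ) : Measurable (ε t i l) :=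
  (hrun.draw_measurable t i l).mono (ℱ.le _) le_rfl

theorem IsSmoothBMC.adapted (hlik : ∀ i, Differentiable ℝ (M.lik i))
    (hrun : M.IsSmoothBMC P ℱ γ ν L ε r) (t : ℕ) : Measurable[ℱ t] (r t) := by
  induction t with
  | zero => exact hrun.init_measurable
  | succ t ih =>
    have hle := ℱ.mono (Nat.le_succ t)
    have h1 : Measurable[ℱ (t + 1)] (r t) := ih.mono hle le_rfl
    have h2 : Measurable[ℱ (t + 1)] (L t) := (hrun.sampleSize_measurable t).mono hle le_rfl
    have h3 := @measurable_direction n d M Ω (ℱ (t + 1)) (L t) (r t) hlik (fun ω i l => ε t i l ω)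
      (ν t) h2 (fun i l => hrun.draw_measurable t i l) h1
    rw [funext (hrun.update t)]
    exact h1.add (h3.const_smul (γ t))

/-- The mean squared error of the estimates over the events of the history. -/
theorem IsSmoothBMC.setIntegral_ratioError_sq_le [IsProbabilityMeasure P]
    (hlik : ∀ i, Differentiable ℝ (M.lik i))
    {B b' B' b'' B'' : ℝ} (hb : M.DerivBounds B b' B' b'' B'') {ζ : ℝ} (hζ : 0 < ζ)
    (hrun : M.IsSmoothBMC P ℱ γ ν L ε r) {t : ℕ} (hγ : 0 < γ t) {i : Fin n}
    {ψ : Param d → ℝ → ℝ} (hψ : Measurable fun p : Param d × ℝ => ψ p.1 p.2) {c c' A : ℝ}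
    (hc : ∀ x e, ψ x e ∈ Set.Icc c c') (hA : ∀ x e, |ψ x e| ≤ A) {Q : Ω → ℝ}
    (hQ : ∀ ω, |Q ω| ≤ A + 1)
    (hgood : ∀ᵐ ω ∂P, ζ ≤ M.Eφ i (r t ω) ∧
      (γ t ≤ 1 → B ^ 2 ≤ 2 * γ t ^ 2 * M.Eφ i (r t ω) ^ 2 * L t ω) ∧
      (γ t ≤ 1 → (c' - c) ^ 2 ≤ 2 * γ t ^ 2 * Q ω ^ 2 * L t ω)) :
    Integrable (fun ω =>
      M.ratioError i ψ (γ t * ζ) (L t ω) (r t ω) (fun l => ε t i l ω) ^ 2) P ∧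
    ∀ S, MeasurableSet[ℱ t] S →
    ∫ ω in S, M.ratioError i ψ (γ t * ζ) (L t ω) (r t ω) (fun l => ε t i l ω) ^ 2 ∂P ≤
      (12 * (A + 1) ^ 2 / ζ ^ 2 + 12 * A ^ 2 * B ^ 2 / ζ ^ 4 + 140 * A ^ 2 / ζ ^ 2) * γ t ^ 2 *
        P.real S := by
  have hεm := hrun.measurable_draw t i
  have hLm : Measurable (L t) := (hrun.sampleSize_measurable t).mono (ℱ.le t) le_rfl
  have hrm : Measurable (r t) := (hrun.adapted hlik t).mono (ℱ.le t) le_rfl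
  have hZ : Measurable fun z : (ℕ × Param d) × (ℕ → ℝ) =>
      ENNReal.ofReal (M.ratioError i ψ (γ t * ζ) z.1.1 z.1.2 z.2 ^ 2) :=
    ((measurable_ratioError hlik i hψ _ (by fun_prop) (fun l => by fun_prop)
      (by fun_prop)).pow_const 2).ennreal_ofReal
  have hbd : ∀ {x : Param d} {l : ℕ} (e : ℕ → ℝ), 0 < l → ζ ≤ M.Eφ i x →
      |M.ratioError i ψ (γ t * ζ) l x e ^ 2| ≤ (A / (γ t * ζ) + A / ζ) ^ 2 := by
    intro x l e hl hx
    rw [abs_of_nonneg (sq_nonneg _), ← sq_abs]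
    refine pow_le_pow_left₀ (abs_nonneg _) ?_ 2
    exact abs_ratio_error_le hζ hx hγ (avg_mem_Icc hl (fun y => (hb i x y).1) _).1
      (abs_le.2 (avg_mem_Icc hl (fun y => abs_le.1 (hA x y)) _)) (abs_integral_le (hA x))
  have hint : Integrable (fun ω =>
      M.ratioError i ψ (γ t * ζ) (L t ω) (r t ω) (fun l => ε t i l ω) ^ 2) P := by
    refine Integrable.of_bound ((measurable_ratioError hlik i hψ _ hLm hεm
      hrm).pow_const 2).aestronglyMeasurable ((A / (γ t * ζ) + A / ζ) ^ 2) ?_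
    filter_upwards [hgood] with ω hω
    exact hbd _ (hrun.sampleSize_pos t ω) hω.1
  refine ⟨hint, fun S hS => ?_⟩
  set C := (12 * (A + 1) ^ 2 / ζ ^ 2 + 12 * A ^ 2 * B ^ 2 / ζ ^ 4 + 140 * A ^ 2 / ζ ^ 2) *
    γ t ^ 2 with hC
  have hC0 : 0 ≤ C := by positivity
  -- Sample size and parameter are frozen at their history-measurable values and the draws are
  -- integrated out. Only almost every frozen value has to satisfy the sample-size bound.
  have hmain := setLIntegral_le_of_indep (P := P) (ℱ.le t)
    (X := fun ω => (L t ω, r t ω)) (Y := fun ω l => ε t i l ω) (c := ENNReal.ofReal C)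
    ((hrun.sampleSize_measurable t).prodMk (hrun.adapted hlik t))
    (measurable_pi_lambda _ hεm) (hrun.draw_indep_history t i) hZ ?_ hS
  · rw [← ofReal_integral_eq_lintegral_ofReal hint.integrableOn
      (ae_of_all _ fun ω => sq_nonneg _), ← ofReal_measureReal, ← ENNReal.ofReal_mul hC0] at hmain
    exact (ENNReal.ofReal_le_ofReal_iff (by positivity)).1 hmain
  · filter_upwards [hgood] with ω hω
    have hl := hrun.sampleSize_pos t ω
    have hpair : Measurable fun y : ℝ => (r t ω, y) := measurable_prodMk_left
    have hm1 : Measurable fun y => ψ (r t ω) y := hψ.comp hpair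
    have hm0 : Measurable (M.φ i (r t ω)) := measurable_φ_right hlik i (r t ω)
    have hi : Integrable (fun ω' => M.ratioError i ψ (γ t * ζ) (L t ω) (r t ω)
        (fun l => ε t i l ω') ^ 2) P :=
      integrable_of_abs_le ((measurable_ratioError hlik i hψ _ measurable_const hεm
        measurable_const).pow_const 2) fun ω' => hbd _ hl hω.1
    rw [← ofReal_integral_eq_lintegral_ofReal hi (ae_of_all _ fun ω => sq_nonneg _)]
    refine ENNReal.ofReal_le_ofReal ?_
    have hp : ∀ y, M.φ i (r t ω) y ∈ Set.Icc 0 B := fun y => (hb i (r t ω) y).1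
    simp only [ratioError, Eφ] at hω ⊢
    exact integral_sq_ratio_error_le (P := P) (e := ε t i) (L := L t ω) (γ := γ t) (ζ := ζ)
      (p := M.φ i (r t ω)) (q := ψ (r t ω)) (Q := Q ω) hl hεm
      (hrun.draw_law t i) (hrun.draw_indep t i) hm0 hm1 hp (hc _) (hA _) hζ hω.1 hγ
      (hQ ω) hω.2.1 hω.2.2

end Run

end Model

/-! ### The error of the step direction -/

namespace Model

variable {n d : ℕ} {M : Model n d}

/-- Cauchy–Schwarz over the examples. Nothing is needed about the joint law of their errors, which
is why draws may be shared between examples. -/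
theorem norm_sq_mean_pack_le (u : Fin n → Fin d → ℝ) (W : Fin n → Matrix (Fin d) (Fin d) ℝ)
    (y z : Fin n → ℝ) :
    ‖(1 / (n : ℝ)) • ∑ i, pack (y i • u i) (z i • W i)‖ ^ 2 ≤
      ∑ i, (2 * ‖pack (u i) 0‖ ^ 2 * y i ^ 2 + 2 * ‖pack 0 (W i)‖ ^ 2 * z i ^ 2) := by
  rcases Nat.eq_zero_or_pos n with rfl | hn
  · simp
  have hn1 : (1 : ℝ) ≤ n := by exact_mod_cast hn
  have h1 : ∀ i, ‖pack (y i • u i) (z i • W i)‖ ^ 2 ≤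
      2 * ‖pack (u i) 0‖ ^ 2 * y i ^ 2 + 2 * ‖pack 0 (W i)‖ ^ 2 * z i ^ 2 := by
    intro i
    rw [pack_smul_smul]
    have h := norm_add_le (y i • pack (u i) 0) (z i • pack 0 (W i))
    rw [norm_smul, norm_smul] at h
    have h2 := pow_le_pow_left₀ (norm_nonneg _) h 2
    have h3 := sq_abs (y i)
    have h4 := sq_abs (z i)
    rw [← Real.norm_eq_abs] at h3 h4
    rw [← h3, ← h4]
    nlinarith [sq_nonneg (‖y i‖ * ‖pack (u i) 0‖ - ‖z i‖ * ‖pack 0 (W i)‖)]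
  have h2 : ‖∑ i, pack (y i • u i) (z i • W i)‖ ^ 2 ≤
      n * ∑ i, ‖pack (y i • u i) (z i • W i)‖ ^ 2 := by
    refine (pow_le_pow_left₀ (norm_nonneg _) (norm_sum_le _ _) 2).trans ?_
    simpa using sq_sum_le_card_mul_sum_sq (s := Finset.univ)
      (f := fun i => ‖pack (y i • u i) (z i • W i)‖)
  have h3 := Finset.sum_le_sum fun i (_ : i ∈ Finset.univ) => h1 i
  have h0 : 0 ≤ ∑ i, ‖pack (y i • u i) (z i • W i)‖ ^ 2 :=
    Finset.sum_nonneg fun i _ => sq_nonneg _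
  rw [norm_smul, mul_pow, Real.norm_eq_abs, sq_abs]
  calc (1 / (n : ℝ)) ^ 2 * ‖∑ i, pack (y i • u i) (z i • W i)‖ ^ 2
      ≤ (1 / (n : ℝ)) ^ 2 * (n * ∑ i, ‖pack (y i • u i) (z i • W i)‖ ^ 2) := by gcongr
    _ = (1 / (n : ℝ)) * ∑ i, ‖pack (y i • u i) (z i • W i)‖ ^ 2 := by field_simp
    _ ≤ 1 * ∑ i, ‖pack (y i • u i) (z i • W i)‖ ^ 2 := by
        gcongr
        rw [div_le_one (by linarith)]
        exact hn1
    _ ≤ _ := by rw [one_mul]; exact h3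

/-- The regularizer enters the direction exactly and cancels, leaving only the errors of the ratios.
-/
theorem direction_add_gradient_objective {x F : Param d} (hF : HasGradientAt M.objective F x)
    (h : F = gradient M.regularizer x - (1 / (n : ℝ)) • ∑ i, pack ((M.Eφ' i x / M.Eφ i x) • M.a₁ i)
      ((M.Eφ'' i x / M.Eφ i x) • ((1 / 2 : ℝ) • Matrix.vecMulVec (M.a₂ i) (M.a₂ i))))
    (ν : ℝ) (l : ℕ) (e : Fin n → ℕ → ℝ) :
    M.direction ν l e x + gradient M.objective x =
      (1 / (n : ℝ)) • ∑ i, pack (M.ratioError i (M.φ' i) ν l x (e i) • M.a₁ i)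
        (M.ratioError i (M.φ'' i) ν l x (e i) •
          ((1 / 2 : ℝ) • Matrix.vecMulVec (M.a₂ i) (M.a₂ i))) := by
  rw [hF.gradient, h, direction, sub_add_sub_cancel, ← smul_sub, ← Finset.sum_sub_distrib]
  congr 1
  refine Finset.sum_congr rfl fun i _ => ?_
  rw [lossDirection, ← pack_sub, ← sub_smul, ← sub_smul]
  rfl

variable {Ω : Type*} [MeasurableSpace Ω] {P : Measure Ω} [IsProbabilityMeasure P]
  {ℱ : Filtration ℕ ‹MeasurableSpace Ω›} {γ : ℕ → ℝ} {L : ℕ → Ω → ℕ}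
  {ε : ℕ → Fin n → ℕ → Ω → ℝ} {r : ℕ → Ω → Param d}

/-- The mean squared error of the step direction over the events of the history is of the order of
the squared step size. -/
theorem IsSmoothBMC.exists_setIntegral_error_le (hn : 0 < n)
    (hlik : ∀ i, Differentiable ℝ (M.lik i)) {B b' B' b'' B'' : ℝ}
    (hb : M.DerivBounds B b' B' b'' B'') {ζ : ℝ} (hζ : 0 < ζ)
    (hrun : M.IsSmoothBMC P ℱ γ (fun t => γ t * ζ) L ε r) (hγ : ∀ t, 0 < γ t)
    (hlower : ∀ᵐ ω ∂P, ∀ t i, ζ ≤ M.Eφ i (r t ω))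
    (hL : ∀ᵐ ω ∂P, ∀ t i, Real.log (6 * n / γ t ^ 4) / (2 * γ t ^ 2) *
      M.sampleFactor B b' B' b'' B'' i (r t ω) < L t ω)
    {w : ℕ → Ω → Param d} (hwm : ∀ t, Measurable (w t))
    (hw : ∀ᵐ ω ∂P, ∀ t, w t ω = (1 / (n : ℝ)) • ∑ i,
      pack (M.ratioError i (M.φ' i) (γ t * ζ) (L t ω) (r t ω) (fun l => ε t i l ω) • M.a₁ i)
        (M.ratioError i (M.φ'' i) (γ t * ζ) (L t ω) (r t ω) (fun l => ε t i l ω) •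
          ((1 / 2 : ℝ) • Matrix.vecMulVec (M.a₂ i) (M.a₂ i)))) :
    ∃ C : ℝ, 0 ≤ C ∧ ∀ t, Integrable (fun ω => ‖w t ω‖ ^ 2) P ∧
      ∀ S, MeasurableSet[ℱ t] S → ∫ ω in S, ‖w t ω‖ ^ 2 ∂P ≤ C * γ t ^ 2 * P.real S := by
  set K : ℝ → ℝ := fun A => 12 * (A + 1) ^ 2 / ζ ^ 2 + 12 * A ^ 2 * B ^ 2 / ζ ^ 4
    + 140 * A ^ 2 / ζ ^ 2 with hK
  have hK0 : ∀ A, 0 ≤ K A := fun A => by positivity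
  set k₁ : Fin n → ℝ := fun i => 2 * ‖pack (M.a₁ i) 0‖ ^ 2
  set k₂ : Fin n → ℝ := fun i =>
    2 * ‖pack 0 ((1 / 2 : ℝ) • Matrix.vecMulVec (M.a₂ i) (M.a₂ i))‖ ^ 2
  have hA₁ : ∀ i x e, |M.φ' i x e| ≤ max |b'| |B'| := fun i x e =>
    abs_le_max_abs_abs (hb i x e).2.1.1 (hb i x e).2.1.2
  have hA₂ : ∀ i x e, |M.φ'' i x e| ≤ max |b''| |B''| := fun i x e =>
    abs_le_max_abs_abs (hb i x e).2.2.1 (hb i x e).2.2.2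
  have hsize : ∀ t i, ∀ᵐ ω ∂P, ζ ≤ M.Eφ i (r t ω) ∧ (γ t ≤ 1 →
      B ^ 2 ≤ 2 * γ t ^ 2 * M.Eφ i (r t ω) ^ 2 * L t ω ∧
      (B' - b') ^ 2 ≤
        2 * γ t ^ 2 * (if M.Eφ' i (r t ω) ≠ 0 then |M.Eφ' i (r t ω)| else 1) ^ 2 * L t ω ∧
      (B'' - b'') ^ 2 ≤
        2 * γ t ^ 2 * (if M.Eφ'' i (r t ω) ≠ 0 then |M.Eφ'' i (r t ω)| else 1) ^ 2 * L t ω) := by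
    intro t i
    filter_upwards [hlower, hL] with ω h1 h2
    exact ⟨h1 t i, fun hγ1 =>
      sample_size_bounds hn (hγ t) hγ1 (hζ.trans_le (h1 t i)).ne' (h2 t i)⟩
  have hZ₁ := fun t i => hrun.setIntegral_ratioError_sq_le hlik hb hζ (hγ t) (i := i)
    (measurable_φ' i) (fun x e => (hb i x e).2.1) (hA₁ i)
    (Q := fun ω => if M.Eφ' i (r t ω) ≠ 0 then |M.Eφ' i (r t ω)| else 1)
    (fun ω => abs_ite_le (abs_integral_le (hA₁ i (r t ω))))
    ((hsize t i).mono fun ω h => ⟨h.1, fun h1 => (h.2 h1).1, fun h1 => (h.2 h1).2.1⟩)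
  have hZ₂ := fun t i => hrun.setIntegral_ratioError_sq_le hlik hb hζ (hγ t) (i := i)
    (measurable_φ'' i) (fun x e => (hb i x e).2.2) (hA₂ i)
    (Q := fun ω => if M.Eφ'' i (r t ω) ≠ 0 then |M.Eφ'' i (r t ω)| else 1)
    (fun ω => abs_ite_le (abs_integral_le (hA₂ i (r t ω))))
    ((hsize t i).mono fun ω h => ⟨h.1, fun h1 => (h.2 h1).1, fun h1 => (h.2 h1).2.2⟩)
  have hk₁ : ∀ i, 0 ≤ k₁ i := fun i => by positivity
  have hk₂ : ∀ i, 0 ≤ k₂ i := fun i => by positivity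
  refine ⟨∑ i, (k₁ i * K (max |b'| |B'|) + k₂ i * K (max |b''| |B''|)),
    Finset.sum_nonneg fun i _ => add_nonneg (mul_nonneg (hk₁ i) (hK0 _))
      (mul_nonneg (hk₂ i) (hK0 _)), fun t => ?_⟩
  have hint : ∀ i, Integrable (fun ω =>
      k₁ i * M.ratioError i (M.φ' i) (γ t * ζ) (L t ω) (r t ω) (fun l => ε t i l ω) ^ 2 +
      k₂ i * M.ratioError i (M.φ'' i) (γ t * ζ) (L t ω) (r t ω) (fun l => ε t i l ω) ^ 2) P :=
    fun i => ((hZ₁ t i).1.const_mul (k₁ i)).add ((hZ₂ t i).1.const_mul (k₂ i))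
  have hle : ∀ᵐ ω ∂P, ‖w t ω‖ ^ 2 ≤ ∑ i,
      (k₁ i * M.ratioError i (M.φ' i) (γ t * ζ) (L t ω) (r t ω) (fun l => ε t i l ω) ^ 2 +
       k₂ i * M.ratioError i (M.φ'' i) (γ t * ζ) (L t ω) (r t ω) (fun l => ε t i l ω) ^ 2) := by
    filter_upwards [hw] with ω hω
    rw [hω t]
    exact norm_sq_mean_pack_le _ _ _ _
  have hsum := integrable_finsetSum (μ := P) Finset.univ fun i (_ : i ∈ Finset.univ) => hint i
  have hwint : Integrable (fun ω => ‖w t ω‖ ^ 2) P := by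
    refine hsum.mono' ((hwm t).norm.pow_const 2).aestronglyMeasurable ?_
    filter_upwards [hle] with ω hω
    rw [Real.norm_of_nonneg (sq_nonneg _)]
    exact hω
  refine ⟨hwint, fun S hS => ?_⟩
  calc ∫ ω in S, ‖w t ω‖ ^ 2 ∂P
      ≤ ∫ ω in S, ∑ i,
      (k₁ i * M.ratioError i (M.φ' i) (γ t * ζ) (L t ω) (r t ω) (fun l => ε t i l ω) ^ 2 +
       k₂ i * M.ratioError i (M.φ'' i) (γ t * ζ) (L t ω) (r t ω) (fun l => ε t i l ω) ^ 2) ∂P := by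
        exact setIntegral_mono_ae hwint.integrableOn hsum.integrableOn hle
    _ = ∑ i, (k₁ i * ∫ ω in S,
        M.ratioError i (M.φ' i) (γ t * ζ) (L t ω) (r t ω) (fun l => ε t i l ω) ^ 2 ∂P + k₂ i *
        ∫ ω in S, M.ratioError i (M.φ'' i) (γ t * ζ) (L t ω) (r t ω) (fun l => ε t i l ω) ^ 2
          ∂P) := by
        rw [integral_finsetSum _ fun i _ => (hint i).integrableOn]
        refine Finset.sum_congr rfl fun i _ => ?_
        rw [integral_add ((hZ₁ t i).1.const_mul (k₁ i)).integrableOn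
          ((hZ₂ t i).1.const_mul (k₂ i)).integrableOn, integral_const_mul, integral_const_mul]
    _ ≤ ∑ i, (k₁ i * (K (max |b'| |B'|) * γ t ^ 2 * P.real S)
          + k₂ i * (K (max |b''| |B''|) * γ t ^ 2 * P.real S)) :=
        Finset.sum_le_sum fun i _ => add_le_add
          (mul_le_mul_of_nonneg_left ((hZ₁ t i).2 S hS) (hk₁ i))
          (mul_le_mul_of_nonneg_left ((hZ₂ t i).2 S hS) (hk₂ i))
    _ = _ := by
        rw [Finset.sum_mul, Finset.sum_mul]
        refine Finset.sum_congr rfl fun i _ => ?_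
        ring

end Model

/-- The expectation of the nonnegative series is finite by exchanging sum and integral, so the
series is finite almost surely. -/
theorem ae_summable_of_integral_le {Ω : Type*} [MeasurableSpace Ω] {P : Measure Ω}
    {X : ℕ → Ω → ℝ} {c : ℕ → ℝ} (hX : ∀ t, Integrable (X t) P) (h0 : ∀ t ω, 0 ≤ X t ω)
    (hc : Summable c) (h : ∀ t, ∫ ω, X t ω ∂P ≤ c t) :
    ∀ᵐ ω ∂P, Summable fun t => X t ω := by
  have hfin : ∫⁻ ω, ∑' t, ENNReal.ofReal (X t ω) ∂P ≠ ⊤ := by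
    rw [lintegral_tsum fun t => (hX t).aemeasurable.ennreal_ofReal]
    refine ne_top_of_le_ne_top hc.tsum_ofReal_ne_top (ENNReal.tsum_le_tsum fun t => ?_)
    rw [← ofReal_integral_eq_lintegral_ofReal (hX t) (ae_of_all _ (h0 t))]
    exact ENNReal.ofReal_le_ofReal (h t)
  filter_upwards [ae_lt_top' (AEMeasurable.tsum fun t =>
    (hX t).aemeasurable.ennreal_ofReal) hfin] with ω hω
  refine (ENNReal.summable_toReal hω.ne).congr fun t => ?_
  rw [ENNReal.toReal_ofReal (h0 t ω)]

end SmoothBMC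

end

/-! ### The conditions of the proposition and pathwise convergence. -/

theorem mainTheorem2 {n d : ℕ} (hn : 0 < n) (M : SmoothBMC.Model n d)
    (hβ : 0 ≤ M.β) (hS₀ : M.S₀.PosDef) (hb₂ : ∀ i, 0 ≤ M.b₂ i)
    (hlik : ∀ i, Differentiable ℝ (M.lik i)) (hlik' : ∀ i, Differentiable ℝ (deriv (M.lik i)))
    {B b' B' b'' B'' : ℝ} (hbounds : M.DerivBounds B b' B' b'' B'')
    {Ω : Type*} [MeasurableSpace Ω] (P : Measure Ω) [IsProbabilityMeasure P]
    (ℱ : Filtration ℕ ‹MeasurableSpace Ω›)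
    (γ : ℕ → ℝ) (hγ : ∀ t, 0 < γ t)
    (hγsum : Tendsto (fun T => ∑ t ∈ Finset.range T, γ t) atTop atTop)
    (hγsq : Summable fun t => γ t ^ 2)
    (ζ v : ℝ) (hζ : 0 < ζ) (hv : 0 < v)
    (L : ℕ → Ω → ℕ) (ε : ℕ → Fin n → ℕ → Ω → ℝ) (r : ℕ → Ω → SmoothBMC.Param d)
    (hrun : M.IsSmoothBMC P ℱ γ (fun t => γ t * ζ) L ε r)
    (hlower : ∀ᵐ ω ∂P, ∀ t i, ζ ≤ M.Eφ i (r t ω))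
    (hcov : ∀ᵐ ω ∂P, ∀ t,
      (SmoothBMC.cov (r t ω) - v • (1 : Matrix (Fin d) (Fin d) ℝ)).PosSemidef)
    (hL : ∀ᵐ ω ∂P, ∀ t i, Real.log (6 * n / γ t ^ 4) / (2 * γ t ^ 2) *
      M.sampleFactor B b' B' b'' B'' i (r t ω) < L t ω) :
    (∃ (f : SmoothBMC.Param d → ℝ) (C : ℝ),
      (∀ x ∈ M.domain ζ v, f x = M.objective x + C ∧
        HasGradientAt M.objective (gradient f x) x) ∧
      SmoothBMC.StochasticGradientConditions P ℱ γ f r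
        (fun t ω => -gradient M.objective (r t ω))
        (fun t ω => M.direction (γ t * ζ) (L t ω) (fun i l => ε t i l ω) (r t ω)
          + gradient M.objective (r t ω))) ∧
    ∀ᵐ ω ∂P,
      (∃ c : ℝ, Tendsto (fun t => M.objective (r t ω)) atTop (𝓝 c)) ∧
      Tendsto (fun t => gradient M.objective (r t ω)) atTop (𝓝 0) ∧
      ∀ x, MapClusterPt x atTop (fun t => r t ω) → HasGradientAt M.objective 0 x := by
  obtain ⟨f, F, C, hf, h0, hdom⟩ :=
    M.exists_extension_objective hβ hS₀ hb₂ hlik hlik' hbounds hζ hv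
  have hgrad : gradient f = F := hf.gradient_eq
  have hmem : ∀ᵐ ω ∂P, ∀ t, r t ω ∈ M.domain ζ v := by
    filter_upwards [hlower, hcov] with ω h1 h2 t
    exact ⟨h2 t, h1 t⟩
  have hF : ∀ x ∈ M.domain ζ v, gradient M.objective x = F x := fun x hx =>
    (hdom x hx).2.1.gradient
  have hF0 : Continuous F := hf.2.choose_spec.continuous
  have hrm : ∀ t, Measurable[ℱ t] (r t) := hrun.adapted hlik
  set s : ℕ → Ω → SmoothBMC.Param d := fun t ω => -gradient M.objective (r t ω) with hs
  set w : ℕ → Ω → SmoothBMC.Param d := fun t ω =>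
    M.direction (γ t * ζ) (L t ω) (fun i l => ε t i l ω) (r t ω) + gradient M.objective (r t ω)
    with hw
  have hupdate : ∀ t ω, r (t + 1) ω = r t ω + γ t • (s t ω + w t ω) := fun t ω => by
    rw [hrun.update, hs, hw]
    simp only [neg_add_cancel_comm_assoc]
  have hsm : ∀ t, Measurable[ℱ t] (s t) := fun t =>
    ((SmoothBMC.measurable_gradient M.objective).comp (hrm t)).neg
  have hwm : ∀ t, Measurable (w t) := fun t =>
    (SmoothBMC.Model.measurable_direction hlik _
      ((hrun.sampleSize_measurable t).mono (ℱ.le t) le_rfl) (hrun.measurable_draw t)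
      ((hrm t).mono (ℱ.le t) le_rfl)).add
      ((SmoothBMC.measurable_gradient M.objective).comp ((hrm t).mono (ℱ.le t) le_rfl))
  have hsF : ∀ᵐ ω ∂P, ∀ t, s t ω = -F (r t ω) := by
    filter_upwards [hmem] with ω hω t
    rw [hs, ← hF _ (hω t)]
  obtain ⟨K, hK0, hK⟩ := hrun.exists_setIntegral_error_le hn hlik hbounds hζ hγ hlower hL hwm (by
    filter_upwards [hmem] with ω hω t
    obtain ⟨-, h2, h3⟩ := hdom _ (hω t)
    exact SmoothBMC.Model.direction_add_gradient_objective h2 h3 _ _ _)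
  have hwL : ∀ t, MemLp (w t) 2 P := fun t =>
    (memLp_two_iff_integrable_sq_norm (hwm t).aestronglyMeasurable).2 (hK t).1
  have hsL : ∀ t, MemLp (r t) 2 P → MemLp (s t) 2 P := fun t ht =>
    (SmoothBMC.memLp_lipschitz_comp hf.2 ht).neg.ae_eq (hsF.mono fun ω hω => (hω t).symm)
  -- Square-integrability propagates along the run: ∇h agrees almost surely with a Lipschitz map at
  -- r_t, and the error has a finite second moment.
  have hrL : ∀ t, MemLp (r t) 2 P := by
    intro t
    induction t with
    | zero => exact hrun.init_memLp
    | succ t ih =>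
      rw [funext (hupdate t)]
      exact ih.add (((hsL t ih).add (hwL t)).const_smul (γ t))
  refine ⟨⟨f, C, fun x hx => ⟨(hdom x hx).1, ?_⟩, ?_⟩, ?_⟩
  · rw [hgrad]
    exact (hdom x hx).2.1
  -- Since s_t = -∇f(r_t) almost surely and is known at time t, c₁ = c₂ = 1. The error bound Kγ²
  -- requires only q ≥ √K; the added 1 keeps q positive, and p = 1 is arbitrary.
  · refine ⟨hrm, fun t => hsL t (hrL t), hwL, hupdate, fun t => (hγ t).le, hγsum, hγsq, h0,
      hf.contDiff, ?_, ⟨1, 1, one_pos, one_pos, fun t => ⟨?_, ?_⟩⟩,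
      ⟨1, √K + 1, one_pos, by positivity, fun t => ?_⟩⟩
    · rw [hgrad]
      exact hf.2
    · rw [condExp_of_stronglyMeasurable (ℱ.le t) (hsm t).stronglyMeasurable
        ((hsL t (hrL t)).integrable one_le_two), hgrad]
      filter_upwards [hsF] with ω hω
      rw [hω t, inner_neg_right, neg_neg, real_inner_self_eq_norm_sq, one_mul]
    · rw [condExp_of_stronglyMeasurable (ℱ.le t) (f := fun ω => ‖s t ω‖ ^ 2)
        ((hsm t).stronglyMeasurable.norm.pow 2)
        ((memLp_two_iff_integrable_sq_norm (hsL t (hrL t)).1).1 (hsL t (hrL t))), hgrad]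
      filter_upwards [hsF] with ω hω
      rw [hω t, norm_neg, one_mul]
    · filter_upwards [SmoothBMC.condExp_le_of_setIntegral_le (ℱ.le t) (hK t).1 (hK t).2] with ω hω
      refine hω.trans ?_
      rw [mul_pow, mul_comm K]
      gcongr
      calc K = √K ^ 2 := (Real.sq_sqrt hK0).symm
        _ ≤ _ := by
          have := norm_nonneg (gradient f (r t ω))
          gcongr
          linarith
  -- Taking the whole space as the event gives E‖w_t‖² ≤ Kγ_t², which is summable.
  · have hsum : ∀ᵐ ω ∂P, Summable fun t => ‖w t ω‖ ^ 2 :=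
      SmoothBMC.ae_summable_of_integral_le (fun t => (hK t).1) (fun t ω => sq_nonneg _)
        (hγsq.mul_left K) fun t => by simpa using (hK t).2 Set.univ MeasurableSet.univ
    filter_upwards [hmem, hsF, hsum] with ω hω hωs hωw
    obtain ⟨⟨l, hl⟩, hlim⟩ := SmoothBMC.tendsto_of_gradient_descent hf h0 hγ hγsum hγsq hωw
      (x := fun t => r t ω) fun t => by rw [hupdate, hωs]
    refine ⟨⟨l - C, ?_⟩, ?_, fun x hx => ?_⟩
    · refine (hl.sub_const C).congr fun t => ?_
      rw [(hdom _ (hω t)).1, add_sub_cancel_right]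
    · exact hlim.congr fun t => (hF _ (hω t)).symm
    · have hxdom : x ∈ M.domain ζ v :=
        (SmoothBMC.Model.isClosed_domain hlik hbounds ζ v).mem_of_mapClusterPt hx
          (Eventually.of_forall hω)
      -- By continuity F x is a cluster point of F(r_t), which tends to zero.
      have hFx : F x = 0 := by
        have h1 : MapClusterPt (F x) atTop (F ∘ fun t => r t ω) :=
          hx.continuousAt_comp hF0.continuousAt
        have h2 : ClusterPt (F x) (𝓝 0) := ClusterPt.mono h1 hlim
        exact eq_of_nhds_neBot h2
      rw [← hFx]
      exact (hdom x hxdom).2.1
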